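/- **Setting.** Let $p>2$ and let $\mathcal G$ be a connected metric graph with finitely many vertices (set $\mathcal V$) and finitely many, but at least one, edges; an edge ${\rm e}$ is identified with $[0,\ell_{\rm e}]$, $0<\ell_{\rm e}\le+\infty$ (with $[0,+\infty)$ if $\ell_{\rm e}=+\infty$), so $\mathcal G$ need not be compact. ${\rm dist}$ is the path distance, $B_r(x)$ the open balls. For each $n$ let $\lambda_n,\rho_n\in\mathbb R$ and let $u_n\in H^1(\mathcal G)$ be a (classical) solution of $$-u_n''+\lambda_nu_n=\rho_nu_n^{p-1}\ \text{ on every edge},\qquad u_n>0,\qquad \sum_{{\rm e}\succ{\rm v}}u_{{\rm e},n}'({\rm v})=0\ \ \forall\,{\rm v}\in\mathcal V$$ (derivatives at ${\rm v}$ in the direction of the edge; a loop at ${\rm v}$ is counted with both its ends), with $\rho_n\to1$. Let $Q(\varphi;u_n,\mathcal G)=\int_{\mathcal G}|\varphi'|^2+(\lambda_n-(p-1)\rho_n|u_n|^{p-2})\varphi^2\,dx$, and let the Morse index $m(u_n)$ be the maximal dimension of a subspace $W\subset H^1(\mathcal G)\cap C_c(\mathcal G)$ with $Q(\varphi;u_n,\mathcal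 G)<0$ for all $\varphi\in W\setminus\{0\}$. $C_c^\infty(\mathcal G)$ denotes the continuous, compactly supported functions on $\mathcal G$ that are smooth on every closed edge. $\mathcal G_m$ is the star graph of $m\ge 1$ half-lines glued at their common origin $0$. **Theorem.** Suppose that $\lambda_n\to+\infty$ and $m(u_n)\le\bar k$ for all $n$, for some integer $\bar k\ge1$. Let $x_n\in\mathcal G$, $\tilde\varepsilon_n=u_n(x_n)^{-\frac{p-2}2}$, $\varepsilon_n=\lambda_n^{-\frac12}$, and suppose that for some $R_n\to\infty$ $$u_n(x_n)=\max_{B_{R_n\tilde\varepsilon_n}(x_n)}u_n .$$ **(A)** If $\limsup_n{\rm dist}(x_n,\mathcal V)/\tilde\varepsilon_n=+\infty$, then, up to a subsequence: * (i) all the $x_n$ lie in the interior of the same edge ${\rm e}\simeq[0,\ell_{\rm e}]$. * (ii) $\tilde\varepsilon_n/\varepsilon_n$ converges to a limit in $(0,1]$, ${\rm dist}(x_n,\mathcal V)/\varepsilon_n\to+\infty$, and $v_n(y)=\varepsilon_n^{\frac2{p-2}}u_n(x_n+\varepsilon_ny)$, $y\in([0,\ell_{\rm e}]-x_n)/\varepsilon_n$,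 converges in $C^2_{\rm loc}(\mathbb R)$ to $V$, where $V\in H^1(\mathbb R)\cap C^2(\mathbb R)$ is the unique function in this space with $-V''+V=V^{p-1}$ and $V>0$ in $\mathbb R$, $V(0)=\max_{\mathbb R}V$, $V(x)\to0$ as $|x|\to\infty$. * (iii) There are $\bar R>0$ and, for every $n$, $\phi_n\in C_c^\infty(\mathcal G)$ with ${\rm supp}\,\phi_n\subset B_{\bar R\varepsilon_n}(x_n)$ and $Q(\phi_n;u_n,\mathcal G)<0$. * (iv) For all $R>0$ and $q\ge1$, $$\lim_n\lambda_n^{\frac12-\frac q{p-2}}\int_{B_{R\varepsilon_n}(x_n)}u_n^q\,dx=\lim_n\int_{B_R(0)}v_n^q\,dy=\int_{B_R(0)}V^q\,dy .$$ **(B)** If $\limsup_n{\rm dist}(x_n,\mathcal V)/\tilde\varepsilon_n<+\infty$, then, up to a subsequence: * (i') $x_n\to{\rm v}\in\mathcal V$, all the $x_n$ lie on the same edge ${\rm e}_1$, on which ${\rm v}$ is identified with the coordinate $0$, and the coordinate of $x_n$ on ${\rm e}_1$ is ${\rm dist}(x_n,\mathcal V)$. * (ii') Let ${\rm e}_2,\dots,{\rm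 e}_m$ be the other edges having ${\rm v}$ as a vertex, with ${\rm v}$ at the coordinate $0$ on each ${\rm e}_i$; a loop at ${\rm v}$ appears twice among ${\rm e}_1,\dots,{\rm e}_m$, once for each of its ends, so that $m$ is the degree of ${\rm v}$. Then $\tilde\varepsilon_n/\varepsilon_n$ converges to a limit in $(0,1]$, $\limsup_n{\rm dist}(x_n,\mathcal V)/\varepsilon_n<+\infty$, and $v_n(y)=\varepsilon_n^{\frac2{p-2}}u_n(\varepsilon_ny)$, $y\in{\rm e}_i/\varepsilon_n$, $i=1,\dots,m$, converges to some $V$ in $C^0_{\rm loc}(\mathcal G_m)$; the restrictions of $v_n$ to ${\rm e}_i/\varepsilon_n$ converge in $C^2_{\rm loc}([0,+\infty))$ to the restriction $V_i$ of $V$ to the $i$-th half-line. Moreover $V\in H^1(\mathcal G_m)$, $-V''+V=V^{p-1}$ and $V>0$ in $\mathcal G_m$, $\sum_{i=1}^mV_i'(0^+)=0$, $V(x)\to0$ as ${\rm dist}(x,0)\to\infty$, and $V$ has a global maximum point on the first half-line, with coordinate $\bar x=\lim_n\bar x_n\in[0,+\infty)$, where $\bar x_n={\rm dist}(x_n,\mathcal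 V)/\varepsilon_n$. * (iii') Same as (iii). * (iv') For all $R>0$ and $q\ge1$, $$\lim_n\lambda_n^{\frac12-\frac q{p-2}}\int_{B_{R\varepsilon_n}(x_n)}u_n^q\,dx=\lim_n\int_{B_R(\bar x_n)}v_n^q\,dy=\int_{[\max\{0,\bar x-R\},\,\bar x+R]}V_1^q\,dy+\sum_{i=2}^m\int_{[0,R-\bar x]}V_i^q\,dy=\int_{B_R(\bar x)}V^q\,dy,$$ where $B_R(\bar x_n)$, $B_R(\bar x)$ are the balls around the points with coordinates $\bar x_n$, $\bar x$ on the first edge, resp. half-line, of the star of the rescaled edges ${\rm e}_i/\varepsilon_n$ and of $\mathcal G_m$ (and $[0,R-\bar x]=\emptyset$ if $R<\bar x$). -/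

import Mathlib

open Filter Topology MeasureTheory Set
open scoped ENNReal ContDiff

/-- A metric graph with vertex set `V` and edge set `E`. The edge `e` is the interval `[0, len e]`
(the half-line `[0, ∞)` if `len e = ⊤`); its point `0` is glued to the vertex `src e` and, if `e` is
bounded, its point `len e` is glued to the vertex `tgt e`. Loops and multiple edges are allowed. -/
structure MetricGraph (V E : Type*) where
  len : E → ℝ≥0∞
  len_pos : ∀ e, 0 < len e
  src : E → V
  tgt : ∀ e, len e ≠ ⊤ → V
  connected : ∀ v w, Relation.EqvGen (fun a b => ∃ e, ∃ h : len e ≠ ⊤, src e = a ∧ tgt e h = b) v w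

namespace MetricGraph

section Basic

variable {V E : Type*} (G : MetricGraph V E)

/-- The points of the glued space: the vertices, and the interior points of the edges. -/
inductive Point (G : MetricGraph V E)
  | vertex (v : V) : Point G
  | interior (e : E) (x : ℝ) (h0 : 0 < x) (h1 : ENNReal.ofReal x < G.len e) : Point G

/-- The interval `[0, len e]`, resp. `[0, ∞)`, with which the edge `e` is identified. -/
def I (e : E) : Set ℝ := {x | 0 ≤ x ∧ ENNReal.ofReal x ≤ G.len e}

open Classical in
/-- The point of `G` with coordinate `x` on the edge `e`, for `x ∈ G.I e`. (A real number `x` outside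
of `G.I e` is first moved to the nearest endpoint of the interval.) -/
noncomputable def pt (e : E) (x : ℝ) : G.Point :=
  if h0 : x ≤ 0 then .vertex (G.src e)
  else if h1 : ENNReal.ofReal x < G.len e then .interior e x (not_le.mp h0) h1
  else .vertex (G.tgt e (ne_top_of_le_ne_top ENNReal.ofReal_ne_top (not_lt.mp h1)))

/-- The set of the vertices, as points of `G`. -/
def vertices : Set G.Point := Set.range Point.vertex

/-- `G.PathLen x y r`: one can go from `x` to `y` by finitely many moves, each inside one edge, of
total length `r`. -/
inductive PathLen (G : MetricGraph V E) (x : G.Point) : G.Point → ℝ → Prop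
  | nil : PathLen G x x 0
  | cons {e : E} {s t r : ℝ} (hs : s ∈ G.I e) (ht : t ∈ G.I e) (h : PathLen G x (G.pt e s) r) :
      PathLen G x (G.pt e t) (r + |s - t|)

variable {G}

lemma zero_mem_I (e : E) : (0 : ℝ) ∈ G.I e := ⟨le_rfl, by simp⟩

lemma len_mem_I (e : E) (h : G.len e ≠ ⊤) : (G.len e).toReal ∈ G.I e :=
  ⟨ENNReal.toReal_nonneg, by rw [ENNReal.ofReal_toReal h]⟩

lemma pt_zero (e : E) : G.pt e 0 = .vertex (G.src e) := by simp [pt]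

lemma pt_len (e : E) (h : G.len e ≠ ⊤) : G.pt e (G.len e).toReal = .vertex (G.tgt e h) := by
  have h0 : 0 < (G.len e).toReal := ENNReal.toReal_pos (G.len_pos e).ne' h
  simp [pt, not_le.mpr h0, ENNReal.ofReal_toReal h]

lemma pt_interior (e : E) (x : ℝ) (h0 : 0 < x) (h1 : ENNReal.ofReal x < G.len e) :
    G.pt e x = .interior e x h0 h1 := by
  simp [pt, not_le.mpr h0, h1]

lemma PathLen.nonneg {x y : G.Point} {r : ℝ} (h : G.PathLen x y r) : 0 ≤ r := by
  induction h with
  | nil => exact le_rfl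
  | cons _ _ _ ih => positivity

lemma PathLen.step {e : E} {s t : ℝ} (hs : s ∈ G.I e) (ht : t ∈ G.I e) :
    G.PathLen (G.pt e s) (G.pt e t) |s - t| := by
  simpa using PathLen.cons hs ht PathLen.nil

lemma PathLen.trans {x y z : G.Point} {r s : ℝ} (h : G.PathLen x y r) (h' : G.PathLen y z s) :
    G.PathLen x z (r + s) := by
  induction h' with
  | nil => simpa using h
  | cons hs ht _ ih => rw [← add_assoc]; exact PathLen.cons hs ht ih

lemma PathLen.symm {x y : G.Point} {r : ℝ} (h : G.PathLen x y r) : G.PathLen y x r := by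
  induction h with
  | nil => exact PathLen.nil
  | cons hs ht _ ih => rw [abs_sub_comm, add_comm]; exact (PathLen.step ht hs).trans ih

lemma exists_pathLen_vertex (v w : V) : ∃ r, G.PathLen (.vertex v) (.vertex w) r := by
  induction G.connected v w with
  | rel a b h =>
    obtain ⟨e, h, rfl, rfl⟩ := h
    exact ⟨_, by simpa only [pt_zero, pt_len e h] using
      PathLen.step (zero_mem_I e) (len_mem_I e h)⟩
  | refl a => exact ⟨0, PathLen.nil⟩
  | symm a b _ ih => exact ⟨_, ih.choose_spec.symm⟩
  | trans a b c _ _ ih ih' => exact ⟨_, ih.choose_spec.trans ih'.choose_spec⟩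

lemma exists_pathLen (x y : G.Point) : ∃ r, G.PathLen x y r := by
  have key : ∀ x : G.Point, ∃ v r, G.PathLen x (.vertex v) r := by
    rintro (v | ⟨e, x, h0, h1⟩)
    · exact ⟨v, 0, PathLen.nil⟩
    · have := PathLen.step (G := G) (e := e) (s := x) ⟨h0.le, h1.le⟩ (zero_mem_I e)
      rw [pt_zero, pt_interior e x h0 h1] at this
      exact ⟨_, _, this⟩
  obtain ⟨v, r, hr⟩ := key x
  obtain ⟨w, s, hs⟩ := key y
  obtain ⟨t, ht⟩ := exists_pathLen_vertex (G := G) v w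
  exact ⟨_, (hr.trans ht).trans hs.symm⟩

lemma bddBelow_pathLen (x y : G.Point) : BddBelow {r | G.PathLen x y r} :=
  ⟨0, fun _ h => PathLen.nonneg h⟩

/-- The distance on a metric graph is the infimum of the lengths of the paths joining two points. -/
noncomputable instance : PseudoMetricSpace G.Point where
  dist x y := sInf {r | G.PathLen x y r}
  dist_self x := le_antisymm (csInf_le (bddBelow_pathLen x x) PathLen.nil)
    (le_csInf ⟨0, PathLen.nil⟩ fun _ h => PathLen.nonneg h)
  dist_comm x y := congrArg sInf (Set.ext fun _ => ⟨PathLen.symm, PathLen.symm⟩)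
  dist_triangle x y z := by
    have h : ∀ r, G.PathLen x y r → ∀ s, G.PathLen y z s →
        sInf {r | G.PathLen x z r} ≤ r + s := fun r hr s hs =>
      csInf_le (bddBelow_pathLen x z) (hr.trans hs)
    have h1 : ∀ r, G.PathLen x y r →
        sInf {r | G.PathLen x z r} - r ≤ sInf {r | G.PathLen y z r} := fun r hr =>
      le_csInf (exists_pathLen y z) fun s hs => by linarith [h r hr s hs]
    have h2 : sInf {r | G.PathLen x z r} - sInf {r | G.PathLen y z r} ≤
        sInf {r | G.PathLen x y r} :=
      le_csInf (exists_pathLen x y) fun r hr => by linarith [h1 r hr]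
    linarith

variable (G)

/-- The ends of the edges (half-edges): every edge has the end `0`, and every bounded edge has in
addition the end `len e`. A loop at `v` contributes two ends at `v`. -/
inductive HalfEdge (G : MetricGraph V E)
  | initial (e : E) : HalfEdge G
  | terminal (e : E) (h : G.len e ≠ ⊤) : HalfEdge G

variable {G}

/-- The edge to which an end belongs. -/
def HalfEdge.edge : G.HalfEdge → E
  | .initial e => e
  | .terminal e _ => e

/-- The vertex at which an end is located. -/
def HalfEdge.base : G.HalfEdge → V
  | .initial e => G.src e
  | .terminal e h => G.tgt e h

/-- The point at arclength `t` from the given end along its edge: this is the coordinate on the edge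
for which the vertex of the end is the point `0`. -/
noncomputable def HalfEdge.pt : G.HalfEdge → ℝ → G.Point
  | .initial e, t => G.pt e t
  | .terminal e _, t => G.pt e ((G.len e).toReal - t)

variable (G)

/-- The ends of edges located at the vertex `v`; their number is the degree of `v`. -/
def Ends (v : V) : Type _ := {h : G.HalfEdge // h.base = v}

noncomputable instance (v : V) : DecidableEq (G.Ends v) := Classical.decEq _

instance [Finite E] : Finite G.HalfEdge :=
  Finite.of_injective (β := E × Bool)
    (fun h => match h with
      | .initial e => (e, false)
      | .terminal e _ => (e, true))
    (by rintro (e | ⟨e, h⟩) (e' | ⟨e', h'⟩) <;> simp)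

noncomputable instance [Finite E] (v : V) : Fintype (G.Ends v) :=
  @Fintype.ofFinite _ (inferInstanceAs (Finite {h : G.HalfEdge // h.base = v}))

/-- The star graph made of the half-lines `[0, ∞)`, one for each element of `ι`, glued together at
their common origin. (For `ι` with `m` elements this is `𝒢_m`.) -/
def star (ι : Type*) : MetricGraph Unit ι where
  len _ := ⊤
  len_pos _ := ENNReal.zero_lt_top
  src _ := ()
  tgt _ _ := ()
  connected _ _ := Relation.EqvGen.refl _

end Basic

/-- `f ∈ H¹(J)` for an interval `J`, for functions `f` defined pointwise: `f ∈ L²(J)`, and `f` is the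
primitive of a function `g ∈ L²(J)` (its weak derivative). -/
def MemH1On (J : Set ℝ) (f : ℝ → ℝ) : Prop :=
  MemLp f 2 (volume.restrict J) ∧ ∃ g : ℝ → ℝ, MemLp g 2 (volume.restrict J) ∧
    ∀ a ∈ J, ∀ b ∈ J, f b - f a = ∫ x in a..b, g x

section Functions

variable {V E : Type*} [Fintype E] (G : MetricGraph V E)

/-- The Sobolev space `H¹(G)`. -/
def MemH1 (u : G.Point → ℝ) : Prop :=
  Continuous u ∧ ∀ e, MemH1On (G.I e) (fun x => u (G.pt e x))

/-- The integral over `S ⊆ G` with respect to the Lebesgue measure on the edges. -/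
noncomputable def integral (S : Set G.Point) (f : G.Point → ℝ) : ℝ :=
  ∑ e, ∫ x in {x | x ∈ G.I e ∧ G.pt e x ∈ S}, f (G.pt e x)

/-- `u` is a positive (classical) solution of `-u'' + lam u = ρ u ^ (p - 1)` on every edge of `G`, with
the Kirchhoff condition at every vertex: the sum of the derivatives, taken at the vertex in the
directions pointing into the edges, over all ends of edges located at the vertex, is zero. -/
structure IsPositiveSolution (p lam ρ : ℝ) (u : G.Point → ℝ) : Prop where
  continuous : Continuous u
  pos : ∀ x, 0 < u x
  contDiffOn : ∀ e, ContDiffOn ℝ 2 (fun x => u (G.pt e x)) (G.I e)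
  equation : ∀ e, ∀ x ∈ G.I e,
    -iteratedDerivWithin 2 (fun x => u (G.pt e x)) (G.I e) x + lam * u (G.pt e x)
      = ρ * u (G.pt e x) ^ (p - 1)
  kirchhoff : ∀ v, ∑ h : G.Ends v, derivWithin (fun t => u (h.1.pt t)) (Set.Ici 0) 0 = 0

/-- The quadratic form `Q(φ; u, G) = ∫_G |φ'|² + (lam - (p - 1) ρ |u| ^ (p - 2)) φ²`. A function
`φ ∈ H¹(G)` is differentiable almost everywhere on the edges, and `φ'` is its derivative. -/
noncomputable def Q (p lam ρ : ℝ) (u φ : G.Point → ℝ) : ℝ :=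
  ∑ e, ∫ x in G.I e, ((deriv (fun x => φ (G.pt e x)) x) ^ 2
    + (lam - (p - 1) * ρ * |u (G.pt e x)| ^ (p - 2)) * φ (G.pt e x) ^ 2)

/-- The Morse index: the maximal dimension of a linear space `W` of compactly supported functions in
`H¹(G)` such that `Q` is negative on `W \ {0}` (it is `⊤` if these dimensions are unbounded). -/
noncomputable def morseIndex (p lam ρ : ℝ) (u : G.Point → ℝ) : ℕ∞ :=
  ⨆ (W : Submodule ℝ (G.Point → ℝ)) (_ : ∀ φ ∈ W, G.MemH1 φ ∧ HasCompactSupport φ)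
    (_ : ∀ φ ∈ W, φ ≠ 0 → G.Q p lam ρ u φ < 0), Cardinal.toENat (Module.rank ℝ W)

/-- `φ ∈ C_c^∞(G)`: `φ` is continuous on `G`, has compact support, and is smooth on each closed
edge. -/
def IsTestFunction (φ : G.Point → ℝ) : Prop :=
  Continuous φ ∧ HasCompactSupport φ ∧ ∀ e, ContDiffOn ℝ ∞ (fun x => φ (G.pt e x)) (G.I e)

end Functions

section Limits

/-- `V` is a positive finite energy solution of `-V'' + V = V ^ (p - 1)` on the real line that attains
its maximum at `0` and vanishes at infinity. -/
structure IsSoliton (p : ℝ) (V : ℝ → ℝ) : Prop where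
  memH1 : MemH1On Set.univ V
  contDiff : ContDiff ℝ 2 V
  pos : ∀ x, 0 < V x
  equation : ∀ x, -iteratedDeriv 2 V x + V x = V x ^ (p - 1)
  max : ∀ x, V x ≤ V 0
  tendsto : Tendsto V (cocompact ℝ) (𝓝 0)

/-- `v n → V` in `C²_loc(S)`, for functions `v n` defined on sets `D n` that exhaust `S`
(here `S` is the real line or `[0, ∞)`): on every `S ∩ [-a, a]` the functions and their first and second
derivatives converge uniformly. -/
def TendstoC2Loc (S : Set ℝ) (D : ℕ → Set ℝ) (v : ℕ → ℝ → ℝ) (V : ℝ → ℝ) : Prop :=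
  ContDiffOn ℝ 2 V S ∧ ∀ a > 0,
    (∀ᶠ n in atTop, S ∩ Set.Icc (-a) a ⊆ D n ∧ ContDiffOn ℝ 2 (v n) (S ∩ Set.Icc (-a) a)) ∧
    ∀ k ≤ 2, TendstoUniformlyOn (fun n => iteratedDerivWithin k (v n) S)
      (iteratedDerivWithin k V S) atTop (S ∩ Set.Icc (-a) a)

variable {V E : Type*} (G : MetricGraph V E)

/-- The dilation by the factor `ε` near the vertex `v`: the point with coordinate `y` on a half-line of
the star graph goes to the point at arclength `ε y` from `v` on the corresponding edge end at `v`. -/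
noncomputable def zoom (v : V) (ε : ℝ) : (star (G.Ends v)).Point → G.Point
  | .vertex _ => .vertex v
  | .interior h y _ _ => h.1.pt (ε * y)

/-- The part of the star graph at the vertex `v` that consists of the rescaled edges
`[0, len e / ε]`. -/
def scaledStar (v : V) (ε : ℝ) : Set (star (G.Ends v)).Point :=
  {P | ∃ (h : G.Ends v) (y : ℝ), 0 ≤ y ∧ ENNReal.ofReal (ε * y) ≤ G.len h.1.edge ∧
    P = (star (G.Ends v)).pt h y}

end Limits

end MetricGraph

/-! The proof is a blow-up. Stretching lengths by `1/δ` and multiplying `u_n` by `δ^(2/(p-2))` turns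
the equation into `-v'' + δ² λ_n v = ρ_n v^(p-1)`. An interior point of an edge is the centre of a
star with two branches, where the Kirchhoff condition holds trivially. Hence (A) and (B) are two
instances of one statement about finitely many rays with a common starting point: the data are
`IsBlowUp`, the result is `IsBlowUp.exists_limit`.

Comparison of the scales. At the maximum point `λ_n u ≤ ρ_n u^(p-1)`
(`IsPositiveSolution.lam_mul_le`); at a vertex this uses that all outward derivatives are
nonpositive with sum zero, hence zero. So `ε̃_n² λ_n ≤ ρ_n`, and this quantity has a limit point
`a₀` in `[0, 1]`. Rescale with `δ = ε̃_n`, so that the maximum is 1. If `a₀ = 0`, the limit would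
solve `-V'' = V^(p-1)` on an infinite star. It would be concave and nonnegative on each half-line,
so its outward derivatives would be nonnegative; Kirchhoff makes them zero, and then `V = 0`
(`star_eq_zero`), against `V = 1` at the maximum. Thus `ε̃_n/ε_n → √a₀ > 0`, and one may rescale by
`ε_n` instead.

Compactness comes from Gronwall's inequality: bounded solutions have bounded slopes, so the values
and slopes at the centre converge along a subsequence, and then the solutions converge locally
uniformly together with their derivatives (`IsSolOn.abs_sub_le`, `exists_limit_of_isSolOn`,
`exists_star_limit`).

The Morse index is used for one thing, the finite energy of the limit. For a cutoff `χ`, integration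
by parts and Kirchhoff give `Q(uχ) = ∫ u² χ'² - (p-2) ρ u^p χ²` (`IsCutoff.Q_eq`). If `∫ V^p` were
infinite on a branch, `k + 1` disjoint windows with large mass would give `k + 1` independent
negative directions (`exists_integral_rpow_le`, `exists_nonneg_of_morseIndex_le`). A finite `∫ V^p`
forces `V → 0` and `V ∈ H¹` (`IsSolOn.tendsto_zero`, `IsSolOn.integrableOn_sq`). On the line,
conservation of energy then fixes `V(0)`, hence `V` (`IsSoliton.unique`).

The same formula for `Q`, with one cutoff of width `R` around the centre, has gradient part `O(1/R)`
and a power part bounded away from zero; this is the test function of (iii) and (iii')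
(`exists_sum_integral_cutoff_neg`). The integrals in (iv) and (iv') converge by bounded convergence,
once small balls are described in edge coordinates (`pt_mem_ball_iff`, `halfEdge_pt_mem_ball_iff`).
-/

namespace MetricGraph

/-! ### Solutions on an interval and their continuous dependence on the data -/

/-- On `[0, L]` the function `f` is nonnegative with derivative `g`, and
`f'' = a f - ρ f ^ (p - 1)`. -/
structure IsSolOn (p a ρ L : ℝ) (f g : ℝ → ℝ) : Prop where
  deriv : ∀ y ∈ Icc 0 L, HasDerivWithinAt f (g y) (Icc 0 L) y
  deriv2 : ∀ y ∈ Icc 0 L, HasDerivWithinAt g (a * f y - ρ * f y ^ (p - 1)) (Icc 0 L) y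
  nonneg : ∀ y ∈ Icc 0 L, 0 ≤ f y

namespace IsSolOn

variable {p a ρ L : ℝ} {f g : ℝ → ℝ}

lemma mono (h : IsSolOn p a ρ L f g) {L' : ℝ} (hL : L' ≤ L) : IsSolOn p a ρ L' f g where
  deriv y hy := (h.deriv y ⟨hy.1, hy.2.trans hL⟩).mono (Icc_subset_Icc_right hL)
  deriv2 y hy := (h.deriv2 y ⟨hy.1, hy.2.trans hL⟩).mono (Icc_subset_Icc_right hL)
  nonneg y hy := h.nonneg y ⟨hy.1, hy.2.trans hL⟩

lemma continuousOn (h : IsSolOn p a ρ L f g) : ContinuousOn f (Icc 0 L) :=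
  fun y hy => (h.deriv y hy).continuousWithinAt

lemma continuousOn' (h : IsSolOn p a ρ L f g) : ContinuousOn g (Icc 0 L) :=
  fun y hy => (h.deriv2 y hy).continuousWithinAt

lemma zero (hp : 2 < p) (a ρ L : ℝ) : IsSolOn p a ρ L (fun _ => 0) (fun _ => 0) where
  deriv y _ := hasDerivWithinAt_const ..
  deriv2 y _ := by
    simpa [Real.zero_rpow (by linarith : p - 1 ≠ 0)] using hasDerivWithinAt_const y (Icc 0 L) (0 : ℝ)
  nonneg y _ := le_rfl

end IsSolOn

lemma abs_rpow_sub_rpow_le {q M s t : ℝ} (hq : 1 ≤ q) (hs : s ∈ Icc 0 M) (ht : t ∈ Icc 0 M) :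
    |s ^ q - t ^ q| ≤ q * M ^ (q - 1) * |s - t| := by
  have := Convex.norm_image_sub_le_of_norm_hasDerivWithin_le (f := fun x : ℝ => x ^ q)
    (f' := fun x => q * x ^ (q - 1)) (s := Icc 0 M) (C := q * M ^ (q - 1))
    (fun x _ => (Real.hasDerivAt_rpow_const (Or.inr hq)).hasDerivWithinAt)
    (fun x hx => by
      have h1 : (0 : ℝ) ≤ x ^ (q - 1) := Real.rpow_nonneg hx.1 _
      rw [Real.norm_eq_abs, abs_of_nonneg (by positivity)]
      exact mul_le_mul_of_nonneg_left
        (Real.rpow_le_rpow hx.1 hx.2 (by linarith)) (by linarith))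
    (convex_Icc 0 M) ht hs
  simpa [Real.norm_eq_abs] using this

/-- Continuous dependence of solutions on the data and on the coefficients. -/
lemma IsSolOn.abs_sub_le {p a ρ a' ρ' L M A : ℝ} {f g f' g' : ℝ → ℝ} (hp : 2 < p)
    (h : IsSolOn p a ρ L f g) (h' : IsSolOn p a' ρ' L f' g')
    (hM : ∀ y ∈ Icc 0 L, f y ≤ M) (hM' : ∀ y ∈ Icc 0 L, f' y ≤ M)
    (hA : |a| ≤ A) (hA' : |ρ| ≤ A) {y : ℝ} (hy : y ∈ Icc 0 L) :
    max |f y - f' y| |g y - g' y| ≤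
      (max |f 0 - f' 0| |g 0 - g' 0| + (|a - a'| * M + |ρ - ρ'| * M ^ (p - 1))) *
        Real.exp ((1 + A + A * ((p - 1) * M ^ (p - 2))) * y) := by
  have hL : (0 : ℝ) ∈ Icc 0 L := ⟨le_rfl, hy.1.trans hy.2⟩
  have hM0 : 0 ≤ M := (h.nonneg 0 hL).trans (hM 0 hL)
  have hA0 : 0 ≤ A := (abs_nonneg a).trans hA
  have hMp : 0 ≤ M ^ (p - 2) := Real.rpow_nonneg hM0 _
  have hMp' : 0 ≤ M ^ (p - 1) := Real.rpow_nonneg hM0 _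
  have hK0 : 0 ≤ A * ((p - 1) * M ^ (p - 2)) := by
    have : 0 ≤ p - 1 := by linarith
    positivity
  -- A Lipschitz constant of the vector field `(z₁, z₂) ↦ (z₂, a z₁ - ρ z₁^(p-1))` on the strip `0 ≤
  -- z₁ ≤ M`. The summand 1 makes `K ≥ 1`, which handles the first component and lets `e / K` be
  -- replaced by `e` in the Gronwall bound.
  set K : ℝ := 1 + A + A * ((p - 1) * M ^ (p - 2)) with hK
  have hK1 : 1 ≤ K := by linarith
  set e := |a - a'| * M + |ρ - ρ'| * M ^ (p - 1) with he
  have he0 : 0 ≤ e := by positivity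
  -- The second solution is regarded as an approximate trajectory of the first equation, with the
  -- error `e` caused by the difference of the coefficients.
  have key := dist_le_of_approx_trajectories_ODE_of_mem (E := ℝ × ℝ)
    (v := fun _ z => (z.2, a * z.1 - ρ * z.1 ^ (p - 1))) (s := fun _ => Icc 0 M ×ˢ univ)
    (K := K.toNNReal) (a := 0) (b := L) (f := fun y => (f y, g y)) (g := fun y => (f' y, g' y))
    (f' := fun y => (g y, a * f y - ρ * f y ^ (p - 1)))
    (g' := fun y => (g' y, a' * f' y - ρ' * f' y ^ (p - 1))) (εf := 0) (εg := e)
    (δ := max |f 0 - f' 0| |g 0 - g' 0|) ?_ ?_ ?_ ?_ ?_ ?_ ?_ ?_ ?_ ?_ y hy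
  · rw [Prod.dist_eq, Real.dist_eq, Real.dist_eq, Real.coe_toNNReal _ (by linarith),
      gronwallBound_of_K_ne_0 (by linarith), sub_zero, zero_add] at key
    refine key.trans ?_
    have h1 : 1 ≤ Real.exp (K * y) := Real.one_le_exp (by have := hy.1; positivity)
    have h2 : e / K * (Real.exp (K * y) - 1) ≤ e * Real.exp (K * y) :=
      mul_le_mul (div_le_self he0 hK1) (by linarith) (by linarith) he0
    linarith
  · intro t _
    refine LipschitzOnWith.of_dist_le_mul fun z hz z' hz' => ?_
    rw [Real.coe_toNNReal _ (by linarith), Prod.dist_eq, Prod.dist_eq]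
    simp only [Real.dist_eq]
    have hd := abs_rpow_sub_rpow_le (q := p - 1) (by linarith) hz.1 hz'.1
    rw [show p - 1 - 1 = p - 2 by ring] at hd
    set D := max |z.1 - z'.1| |z.2 - z'.2|
    have h1 : |z.1 - z'.1| ≤ D := le_max_left _ _
    have h2 : |z.2 - z'.2| ≤ D := le_max_right _ _
    have hD : 0 ≤ D := (abs_nonneg _).trans h1
    refine max_le (h2.trans (le_mul_of_one_le_left hD hK1)) ?_
    calc |a * z.1 - ρ * z.1 ^ (p - 1) - (a * z'.1 - ρ * z'.1 ^ (p - 1))|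
        = |a * (z.1 - z'.1) - ρ * (z.1 ^ (p - 1) - z'.1 ^ (p - 1))| := by ring_nf
      _ ≤ |a * (z.1 - z'.1)| + |ρ * (z.1 ^ (p - 1) - z'.1 ^ (p - 1))| := abs_sub _ _
      _ ≤ A * D + A * ((p - 1) * M ^ (p - 2) * D) := by
          rw [abs_mul, abs_mul]
          have : 0 ≤ p - 1 := by linarith
          gcongr
          exact hd.trans (by gcongr)
      _ ≤ K * D := by rw [hK]; nlinarith
  · exact h.continuousOn.prodMk h.continuousOn'
  · intro t ht
    exact ((h.deriv t ⟨ht.1, ht.2.le⟩).prodMk (h.deriv2 t ⟨ht.1, ht.2.le⟩)).mono_of_mem_nhdsWithin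
      (Icc_mem_nhdsGE_of_mem ht)
  · intro t _; simp
  · exact fun t ht => ⟨⟨h.nonneg t ⟨ht.1, ht.2.le⟩, hM t ⟨ht.1, ht.2.le⟩⟩, trivial⟩
  · exact h'.continuousOn.prodMk h'.continuousOn'
  · intro t ht
    exact ((h'.deriv t ⟨ht.1, ht.2.le⟩).prodMk
      (h'.deriv2 t ⟨ht.1, ht.2.le⟩)).mono_of_mem_nhdsWithin (Icc_mem_nhdsGE_of_mem ht)
  · intro t ht
    have h0 := h'.nonneg t ⟨ht.1, ht.2.le⟩
    have h1 := hM' t ⟨ht.1, ht.2.le⟩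
    rw [Prod.dist_eq]
    refine max_le (by simpa using he0) ?_
    simp only [Real.dist_eq]
    calc |a' * f' t - ρ' * f' t ^ (p - 1) - (a * f' t - ρ * f' t ^ (p - 1))|
        = |(ρ - ρ') * f' t ^ (p - 1) - (a - a') * f' t| := by ring_nf
      _ ≤ |(ρ - ρ') * f' t ^ (p - 1)| + |(a - a') * f' t| := abs_sub _ _
      _ ≤ e := by
        rw [abs_mul, abs_mul, abs_of_nonneg h0, abs_of_nonneg (Real.rpow_nonneg h0 _), add_comm, he]
        gcongr
        linarith
  · exact fun t ht => ⟨⟨h'.nonneg t ⟨ht.1, ht.2.le⟩, hM' t ⟨ht.1, ht.2.le⟩⟩, trivial⟩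
  · rw [Prod.dist_eq, Real.dist_eq, Real.dist_eq]

/-- Uniform limits of functions and of their derivatives, on a closed interval. -/
lemma hasDerivWithinAt_of_tendstoUniformlyOn {b : ℝ} {F G : ℕ → ℝ → ℝ} {V W : ℝ → ℝ}
    (hF : ∀ᶠ n in atTop, ∀ y ∈ Icc 0 b, HasDerivWithinAt (F n) (G n y) (Icc 0 b) y)
    (hG : ∀ᶠ n in atTop, ContinuousOn (G n) (Icc 0 b))
    (hV : ∀ y ∈ Icc 0 b, Tendsto (fun n => F n y) atTop (𝓝 (V y)))
    (hW : TendstoUniformlyOn G W atTop (Icc 0 b)) :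
    ∀ y ∈ Icc 0 b, HasDerivWithinAt V (W y) (Icc 0 b) y := by
  intro y hy
  have hb : (0 : ℝ) ≤ b := hy.1.trans hy.2
  have hWc : ContinuousOn W (Icc 0 b) := hW.continuousOn hG.frequently
  -- The limit of `F n z - F n 0 = ∫ G n` is an integral formula for `V`, which can then be
  -- differentiated because `W` is continuous.
  have hint : ∀ z ∈ Icc 0 b, V z = V 0 + ∫ s in (0 : ℝ)..z, W s := by
    intro z hz
    have hsub : Icc 0 z ⊆ Icc 0 b := Icc_subset_Icc_right hz.2
    have h1 : Tendsto (fun n => ∫ s in (0 : ℝ)..z, G n s) atTop (𝓝 (∫ s in (0 : ℝ)..z, W s)) := by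
      refine TendstoUniformlyOn.tendsto_intervalIntegral_of_continuousOn ?_ ?_
      all_goals rw [uIcc_of_le hz.1]
      exacts [hG.mono fun n hn => hn.mono hsub, hW.mono hsub]
    have h2 : Tendsto (fun n => F n z - F n 0) atTop (𝓝 (V z - V 0)) :=
      (hV z hz).sub (hV 0 ⟨le_rfl, hb⟩)
    have h3 : ∀ᶠ n in atTop, ∫ s in (0 : ℝ)..z, G n s = F n z - F n 0 := by
      filter_upwards [hF, hG] with n hn hn'
      refine intervalIntegral.integral_eq_sub_of_hasDeriv_right_of_le hz.1
        (fun x hx => ((hn x (hsub hx)).continuousWithinAt).mono hsub) (fun x hx => ?_)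
        (((hn'.mono hsub).mono (by rw [uIcc_of_le hz.1])).intervalIntegrable)
      exact (hn x (hsub ⟨hx.1.le, hx.2.le⟩)).mono_of_mem_nhdsWithin
        (mem_nhdsWithin_of_mem_nhds (Icc_mem_nhds hx.1 (hx.2.trans_le hz.2)) )
    have := tendsto_nhds_unique (h1.congr' h3) h2
    linarith
  have hsm : StronglyMeasurableAtFilter W (𝓝[Icc 0 b] y) volume :=
    ⟨Icc 0 b, self_mem_nhdsWithin, hWc.aestronglyMeasurable measurableSet_Icc⟩
  have : Fact (y ∈ Icc 0 b) := ⟨hy⟩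
  have := intervalIntegral.integral_hasDerivWithinAt_right (a := 0) (s := Icc 0 b) (t := Icc 0 b)
    ((hWc.mono (by rw [uIcc_of_le hy.1]; exact Icc_subset_Icc_right hy.2)).intervalIntegrable)
    hsm (hWc y hy)
  exact ((hasDerivWithinAt_const y (Icc 0 b) (V 0)).add this).congr_of_mem
    (fun z hz => hint z hz) hy |>.congr_deriv (by simp)

end MetricGraph

/-! ### Compactness of bounded solutions -/

namespace MetricGraph

lemma uniformCauchySeqOn_of_abs_sub_le {F : ℕ → ℝ → ℝ} {s : Set ℝ} {E : ℕ × ℕ → ℝ}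
    (hE : Tendsto E (atTop ×ˢ atTop) (𝓝 0))
    (h : ∀ᶠ m in atTop ×ˢ atTop, ∀ y ∈ s, |F m.1 y - F m.2 y| ≤ E m) :
    UniformCauchySeqOn F atTop s := by
  intro U hU
  obtain ⟨e, he, heU⟩ := Metric.mem_uniformity_dist.1 hU
  filter_upwards [h, hE.eventually (gt_mem_nhds he)] with m hm hm' y hy
  exact heU (by rw [Real.dist_eq]; exact (hm y hy).trans_lt hm')

/-- The map `(a, ρ, s) ↦ a s - ρ s^(p-1)` is uniformly continuous on a compact box, and the bounds
by `M` keep all arguments in it. This upgrades the convergence of solutions to that of their second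
derivatives. -/
lemma tendstoUniformlyOn_nonlinearity {p M a₀ ρ₀ : ℝ} (hp : 2 < p) {a ρ : ℕ → ℝ}
    {f : ℕ → ℝ → ℝ} {V : ℝ → ℝ} {S : Set ℝ} (hf : TendstoUniformlyOn f V atTop S)
    (ha : Tendsto a atTop (𝓝 a₀)) (hρ : Tendsto ρ atTop (𝓝 ρ₀))
    (hfM : ∀ᶠ n in atTop, ∀ y ∈ S, f n y ∈ Icc 0 M) (hVM : ∀ y ∈ S, V y ∈ Icc 0 M) :
    TendstoUniformlyOn (fun n y => a n * f n y - ρ n * f n y ^ (p - 1))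
      (fun y => a₀ * V y - ρ₀ * V y ^ (p - 1)) atTop S := by
  set K : Set (ℝ × ℝ × ℝ) := Metric.closedBall a₀ 1 ×ˢ Metric.closedBall ρ₀ 1 ×ˢ Icc 0 M
  have hK : IsCompact K :=
    (isCompact_closedBall _ _).prod ((isCompact_closedBall _ _).prod isCompact_Icc)
  have hΦ : ContinuousOn (fun z : ℝ × ℝ × ℝ => z.1 * z.2.2 - z.2.1 * z.2.2 ^ (p - 1)) K := by
    refine Continuous.continuousOn ?_
    have : Continuous fun z : ℝ × ℝ × ℝ => z.2.2 ^ (p - 1) :=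
      (continuous_snd.comp continuous_snd).rpow_const fun _ => Or.inr (by linarith)
    fun_prop
  have hc : ∀ {s : ℕ → ℝ} {c : ℝ}, Tendsto s atTop (𝓝 c) →
      TendstoUniformlyOn (fun n (_ : ℝ) => s n) (fun _ => c) atTop S :=
    fun h => h.tendstoUniformlyOn_const S
  have htr : TendstoUniformlyOn (fun n y => (a n, ρ n, f n y)) (fun y => (a₀, ρ₀, V y)) atTop S := by
    have h1 : TendstoUniformlyOn (fun n y => (ρ n, f n y)) (fun y => (ρ₀, V y)) atTop S :=
      fun U hU => ((hc hρ).prodMk hf U hU).diag_of_prod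
    exact fun U hU => ((hc ha).prodMk h1 U hU).diag_of_prod
  refine (hK.uniformContinuousOn_of_continuous hΦ).comp_tendstoUniformlyOn_eventually
    ?_ ?_ htr
  · filter_upwards [hfM, ha (Metric.closedBall_mem_nhds a₀ one_pos),
      hρ (Metric.closedBall_mem_nhds ρ₀ one_pos)] with n h1 h2 h3 y hy
    exact ⟨h2, h3, h1 y hy⟩
  · exact fun y hy => ⟨Metric.mem_closedBall_self zero_le_one,
      Metric.mem_closedBall_self zero_le_one, hVM y hy⟩

/-- Solutions that are bounded by `M` on longer and longer intervals converge locally uniformly to a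
solution on `[0, ∞)` as soon as their initial data converge. -/
lemma exists_limit_of_isSolOn {p M a₀ ρ₀ α β : ℝ} (hp : 2 < p) {a ρ L : ℕ → ℝ} {f g : ℕ → ℝ → ℝ}
    (hL : Tendsto L atTop atTop) (hsol : ∀ n, IsSolOn p (a n) (ρ n) (L n) (f n) (g n))
    (hM : ∀ n, ∀ y ∈ Icc 0 (L n), f n y ≤ M)
    (ha : Tendsto a atTop (𝓝 a₀)) (hρ : Tendsto ρ atTop (𝓝 ρ₀))
    (hα : Tendsto (fun n => f n 0) atTop (𝓝 α)) (hβ : Tendsto (fun n => g n 0) atTop (𝓝 β)) :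
    ∃ V W : ℝ → ℝ, (∀ b, TendstoUniformlyOn f V atTop (Icc 0 b)) ∧
      (∀ b, TendstoUniformlyOn g W atTop (Icc 0 b)) ∧ (∀ b, IsSolOn p a₀ ρ₀ b V W) ∧
      ∀ y, 0 ≤ y → V y ≤ M := by
  -- Two members of the sequence are compared by Gronwall on `[0, b]`; convergence of the initial
  -- data and of the coefficients makes the right-hand side small, so the sequences are uniformly
  -- Cauchy.
  have key : ∀ b, 0 ≤ b → UniformCauchySeqOn f atTop (Icc 0 b) ∧
      UniformCauchySeqOn g atTop (Icc 0 b) := by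
    intro b hb
    set A := |a₀| + |ρ₀| + 1 with hA
    have ha' : ∀ᶠ n in atTop, |a n| ≤ A :=
      (ha.abs.eventually (gt_mem_nhds (show |a₀| < A by
        have := abs_nonneg ρ₀; linarith))).mono fun _ h => h.le
    have hρ' : ∀ᶠ n in atTop, |ρ n| ≤ A :=
      (hρ.abs.eventually (gt_mem_nhds (show |ρ₀| < A by
        have := abs_nonneg a₀; linarith))).mono fun _ h => h.le
    have diff : ∀ {s : ℕ → ℝ} {c : ℝ}, Tendsto s atTop (𝓝 c) →
        Tendsto (fun m : ℕ × ℕ => |s m.1 - s m.2|) (atTop ×ˢ atTop) (𝓝 0) := by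
      intro s c hs
      simpa using ((hs.comp tendsto_fst).sub (hs.comp tendsto_snd)).abs
    have hE : Tendsto (fun m : ℕ × ℕ =>
        (max |f m.1 0 - f m.2 0| |g m.1 0 - g m.2 0| +
          (|a m.1 - a m.2| * M + |ρ m.1 - ρ m.2| * M ^ (p - 1))) *
        Real.exp ((1 + A + A * ((p - 1) * M ^ (p - 2))) * b)) (atTop ×ˢ atTop) (𝓝 0) := by
      simpa using (((diff hα).max (diff hβ)).add
        (((diff ha).mul_const M).add ((diff hρ).mul_const (M ^ (p - 1))))).mul_const
          (Real.exp ((1 + A + A * ((p - 1) * M ^ (p - 2))) * b))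
    have hle : ∀ᶠ m : ℕ × ℕ in atTop ×ˢ atTop, ∀ y ∈ Icc 0 b,
        max |f m.1 y - f m.2 y| |g m.1 y - g m.2 y| ≤
        (max |f m.1 0 - f m.2 0| |g m.1 0 - g m.2 0| +
          (|a m.1 - a m.2| * M + |ρ m.1 - ρ m.2| * M ^ (p - 1))) *
        Real.exp ((1 + A + A * ((p - 1) * M ^ (p - 2))) * b) := by
      filter_upwards [(ha'.and (hρ'.and (hL.eventually_ge_atTop b))).prod_mk
        (hL.eventually_ge_atTop b)] with m hm y hy
      obtain ⟨⟨h1, h2, h3⟩, h4⟩ := hm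
      have hsub : ∀ {b' : ℝ}, b ≤ b' → ∀ z ∈ Icc 0 b, z ∈ Icc 0 b' := fun h z hz =>
        ⟨hz.1, hz.2.trans h⟩
      have h0 : (0 : ℝ) ∈ Icc 0 (L m.1) := ⟨le_rfl, hb.trans h3⟩
      have hM0 : 0 ≤ M := ((hsol m.1).nonneg 0 h0).trans (hM m.1 0 h0)
      have hA0 : 0 ≤ A := (abs_nonneg _).trans h1
      refine (((hsol m.1).mono h3).abs_sub_le hp ((hsol m.2).mono h4)
        (fun z hz => hM _ z (hsub h3 z hz)) (fun z hz => hM _ z (hsub h4 z hz)) h1 h2 hy).trans ?_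
      have hMp : 0 ≤ M ^ (p - 2) := Real.rpow_nonneg hM0 _
      have hMp' : 0 ≤ M ^ (p - 1) := Real.rpow_nonneg hM0 _
      have : 0 ≤ p - 1 := by linarith
      have := hy.2
      gcongr
    exact ⟨uniformCauchySeqOn_of_abs_sub_le hE (hle.mono fun m h y hy =>
      (le_max_left _ _).trans (h y hy)), uniformCauchySeqOn_of_abs_sub_le hE
      (hle.mono fun m h y hy => (le_max_right _ _).trans (h y hy))⟩
  have hlim : ∀ {F : ℕ → ℝ → ℝ}, (∀ b, 0 ≤ b → UniformCauchySeqOn F atTop (Icc 0 b)) →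
      ∃ V : ℝ → ℝ, ∀ b, TendstoUniformlyOn F V atTop (Icc 0 b) := by
    intro F hF
    have : ∀ y, ∃ l, 0 ≤ y → Tendsto (fun n => F n y) atTop (𝓝 l) := by
      intro y
      by_cases hy : 0 ≤ y
      · obtain ⟨l, hl⟩ := cauchySeq_tendsto_of_complete ((hF y hy).cauchySeq (x := y) ⟨hy, le_rfl⟩)
        exact ⟨l, fun _ => hl⟩
      -- Negative arguments never matter; the value there is arbitrary.
      · exact ⟨0, fun h => absurd h hy⟩
    choose V hV using this
    refine ⟨V, fun b => ?_⟩
    rcases le_or_gt 0 b with hb | hb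
    · exact (hF b hb).tendstoUniformlyOn_of_tendsto fun y hy => hV y hy.1
    · simp [Icc_eq_empty hb.not_ge, tendstoUniformlyOn_empty]
  obtain ⟨V, hV⟩ := hlim fun b hb => (key b hb).1
  obtain ⟨W, hW⟩ := hlim fun b hb => (key b hb).2
  have hpt : ∀ y, 0 ≤ y → Tendsto (fun n => f n y) atTop (𝓝 (V y)) := fun y hy =>
    (hV y).tendsto_at ⟨hy, le_rfl⟩
  have hV0 : ∀ y, 0 ≤ y → 0 ≤ V y := fun y hy => ge_of_tendsto (hpt y hy) <| by
    filter_upwards [hL.eventually_ge_atTop y] with n hn using (hsol n).nonneg y ⟨hy, hn⟩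
  have hVM : ∀ y, 0 ≤ y → V y ≤ M := fun y hy => le_of_tendsto (hpt y hy) <| by
    filter_upwards [hL.eventually_ge_atTop y] with n hn using hM n y ⟨hy, hn⟩
  refine ⟨V, W, hV, hW, fun b => ?_, hVM⟩
  have hsol' : ∀ᶠ n in atTop, IsSolOn p (a n) (ρ n) b (f n) (g n) := by
    filter_upwards [hL.eventually_ge_atTop b] with n hn using (hsol n).mono hn
  refine ⟨hasDerivWithinAt_of_tendstoUniformlyOn (F := f) (G := g)
    (hsol'.mono fun n h => h.deriv) (hsol'.mono fun n h => h.continuousOn')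
    (fun y hy => hpt y hy.1) (hW b), ?_, fun y hy => hV0 y hy.1⟩
  -- The passage to the limit is repeated one derivative higher, with the right-hand side of the
  -- equation as the derivative of `g n`.
  refine hasDerivWithinAt_of_tendstoUniformlyOn (F := g)
    (G := fun n y => a n * f n y - ρ n * f n y ^ (p - 1))
    (hsol'.mono fun n h => h.deriv2) (hsol'.mono fun n h => ?_)
    (fun y hy => (hW b).tendsto_at hy) ?_
  · exact (continuousOn_const.mul h.continuousOn).sub (continuousOn_const.mul
      (h.continuousOn.rpow_const fun y _ => Or.inr (by linarith)))
  · refine tendstoUniformlyOn_nonlinearity (M := M) hp (hV b) ha hρ ?_ fun y hy =>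
      ⟨hV0 y hy.1, hVM y hy.1⟩
    filter_upwards [hL.eventually_ge_atTop b] with n hn y hy
    exact ⟨(hsol n).nonneg y ⟨hy.1, hy.2.trans hn⟩, hM n y ⟨hy.1, hy.2.trans hn⟩⟩

end MetricGraph

/-! ### Derivative bounds, maxima, uniqueness and concavity for nonnegative solutions -/

namespace MetricGraph

lemma sub_le_mul_of_hasDerivWithinAt {F G : ℝ → ℝ} {b C x y : ℝ}
    (h : ∀ z ∈ Icc 0 b, HasDerivWithinAt F (G z) (Icc 0 b) z) (hx : 0 ≤ x) (hxy : x ≤ y)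
    (hy : y ≤ b) (hC : ∀ z ∈ Icc x y, G z ≤ C) : F y - F x ≤ C * (y - x) := by
  have hsub : Icc x y ⊆ Icc 0 b := Icc_subset_Icc hx hy
  have hd : ∀ z ∈ Ioo x y, HasDerivAt F (G z) z := fun z hz =>
    (h z (hsub (Ioo_subset_Icc_self hz))).hasDerivAt
      (Icc_mem_nhds (hx.trans_lt hz.1) (hz.2.trans_le hy))
  refine (convex_Icc x y).image_sub_le_mul_sub_of_deriv_le
    (fun z hz => ((h z (hsub hz)).continuousWithinAt).mono hsub) ?_ ?_ x ⟨le_rfl, hxy⟩ y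
    ⟨hxy, le_rfl⟩ hxy
  · rw [interior_Icc]
    exact fun z hz => (hd z hz).differentiableAt.differentiableWithinAt
  · rw [interior_Icc]
    exact fun z hz => by rw [(hd z hz).deriv]; exact hC z (Ioo_subset_Icc_self hz)

lemma mul_le_sub_of_hasDerivWithinAt {F G : ℝ → ℝ} {b C x y : ℝ}
    (h : ∀ z ∈ Icc 0 b, HasDerivWithinAt F (G z) (Icc 0 b) z) (hx : 0 ≤ x) (hxy : x ≤ y)
    (hy : y ≤ b) (hC : ∀ z ∈ Icc x y, C ≤ G z) : C * (y - x) ≤ F y - F x := by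
  have := sub_le_mul_of_hasDerivWithinAt (F := fun z => - F z) (G := fun z => - G z) (C := -C)
    (fun z hz => (h z hz).neg) hx hxy hy fun z hz => neg_le_neg (hC z hz)
  linarith

namespace IsSolOn

variable {p a ρ L M : ℝ} {f g : ℝ → ℝ}

lemma shift {y₀ : ℝ} (h : IsSolOn p a ρ L f g) (hy₀ : 0 ≤ y₀) :
    IsSolOn p a ρ (L - y₀) (fun y => f (y₀ + y)) (fun y => g (y₀ + y)) := by
  have hm : MapsTo (fun y => y₀ + y) (Icc 0 (L - y₀)) (Icc 0 L) := fun y hy =>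
    ⟨by linarith [hy.1], by linarith [hy.2]⟩
  have hd : ∀ y, HasDerivWithinAt (fun y => y₀ + y) 1 (Icc 0 (L - y₀)) y := fun y =>
    (hasDerivWithinAt_id y _).const_add y₀
  refine ⟨fun y hy => ?_, fun y hy => ?_, fun y hy => h.nonneg _ (hm hy)⟩
  · simpa [Function.comp_def] using (h.deriv _ (hm hy)).scomp y (hd y) hm
  · simpa [Function.comp_def] using (h.deriv2 _ (hm hy)).scomp y (hd y) hm

/-- The equation is autonomous and even in the derivative. Together with `shift`, this gives
uniqueness on both sides of an arbitrary point although `IsSolOn` always starts at 0. -/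
lemma reflect {y₀ : ℝ} (h : IsSolOn p a ρ L f g) (hy₀ : y₀ ≤ L) :
    IsSolOn p a ρ y₀ (fun y => f (y₀ - y)) (fun y => - g (y₀ - y)) := by
  have hm : MapsTo (fun y => y₀ - y) (Icc 0 y₀) (Icc 0 L) := fun y hy =>
    ⟨by linarith [hy.2], by linarith [hy.1]⟩
  have hd : ∀ y, HasDerivWithinAt (fun y => y₀ - y) (-1) (Icc 0 y₀) y := fun y =>
    (hasDerivWithinAt_id y _).const_sub y₀
  refine ⟨fun y hy => ?_, fun y hy => ?_, fun y hy => h.nonneg _ (hm hy)⟩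
  · simpa [Function.comp_def] using (h.deriv _ (hm hy)).scomp y (hd y) hm
  · exact ((h.deriv2 _ (hm hy)).scomp y (hd y) hm).neg.congr_deriv (by simp)

lemma abs_deriv2_le (hp : 2 < p) (h : IsSolOn p a ρ L f g) {A : ℝ} (hM : ∀ y ∈ Icc 0 L, f y ≤ M)
    (hA : |a| ≤ A) (hA' : |ρ| ≤ A) {y : ℝ} (hy : y ∈ Icc 0 L) :
    |a * f y - ρ * f y ^ (p - 1)| ≤ A * M + A * M ^ (p - 1) := by
  have h0 := h.nonneg y hy
  have h1 := hM y hy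
  have hA0 : 0 ≤ A := (abs_nonneg a).trans hA
  calc |a * f y - ρ * f y ^ (p - 1)| ≤ |a * f y| + |ρ * f y ^ (p - 1)| := abs_sub _ _
    _ ≤ A * M + A * M ^ (p - 1) := by
      rw [abs_mul, abs_mul, abs_of_nonneg h0, abs_of_nonneg (Real.rpow_nonneg h0 _)]
      gcongr
      linarith

/-- A bounded solution has a bounded derivative. -/
lemma abs_deriv_le (hp : 2 < p) (h : IsSolOn p a ρ L f g) {A : ℝ} (hM : ∀ y ∈ Icc 0 L, f y ≤ M)
    (hA : |a| ≤ A) (hA' : |ρ| ≤ A) {y : ℝ} (hy : 0 ≤ y) (hyL : y + 1 ≤ L) :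
    |g y| ≤ M + (A * M + A * M ^ (p - 1)) := by
  have hsub : Icc y (y + 1) ⊆ Icc 0 L := Icc_subset_Icc hy hyL
  -- Somewhere in a unit interval the slope is at most `M` in absolute value, since `0 ≤ f ≤ M`; the
  -- bound on the second derivative carries this back to `y`.
  obtain ⟨ξ, hξ, hξ'⟩ := exists_hasDerivAt_eq_slope f g (show y < y + 1 by linarith)
    (h.continuousOn.mono hsub) fun z hz => (h.deriv z (hsub (Ioo_subset_Icc_self hz))).hasDerivAt
      (Icc_mem_nhds (hy.trans_lt hz.1) (hz.2.trans_le hyL))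
  have hξI : ξ ∈ Icc 0 L := hsub (Ioo_subset_Icc_self hξ)
  have hyI : y ∈ Icc 0 L := ⟨hy, by linarith⟩
  have hyI' : y + 1 ∈ Icc 0 L := ⟨by linarith, hyL⟩
  have h1 : |g ξ| ≤ M := by
    rw [hξ', abs_le]
    have := h.nonneg y hyI
    have := h.nonneg _ hyI'
    have := hM y hyI
    have := hM _ hyI'
    constructor <;> simp <;> linarith
  have hB : ∀ z ∈ Icc 0 L, |a * f z - ρ * f z ^ (p - 1)| ≤ A * M + A * M ^ (p - 1) :=
    fun z hz => h.abs_deriv2_le hp hM hA hA' hz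
  have h2 := sub_le_mul_of_hasDerivWithinAt h.deriv2 hy hξ.1.le hξI.2
    fun z hz => (abs_le.1 (hB z ⟨hy.trans hz.1, hz.2.trans hξI.2⟩)).2
  have h3 := mul_le_sub_of_hasDerivWithinAt h.deriv2 hy hξ.1.le hξI.2
    fun z hz => (abs_le.1 (hB z ⟨hy.trans hz.1, hz.2.trans hξI.2⟩)).1
  have hB0 := (abs_nonneg _).trans (hB y hyI)
  have : ξ - y ≤ 1 := by linarith [hξ.2]
  have : 0 ≤ ξ - y := by linarith [hξ.1]
  rw [abs_le] at h1 ⊢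
  constructor <;> nlinarith

/-- A positive slope at 0 would persist to the right of 0 and push `f` above its maximum. The
maximum is one-sided, so the slope need not vanish. -/
lemma deriv_zero_nonpos_of_le (h : IsSolOn p a ρ L f g) (hL : 0 < L)
    (hmax : ∀ y ∈ Icc 0 L, f y ≤ f 0) : g 0 ≤ 0 := by
  by_contra! hg
  have hc : ∀ᶠ y in 𝓝[Icc 0 L] 0, 0 < g y :=
    (h.continuousOn' 0 ⟨le_rfl, hL.le⟩).eventually (lt_mem_nhds hg)
  rw [nhdsWithin_Icc_eq_nhdsGE hL] at hc
  obtain ⟨d, hd, hd'⟩ := mem_nhdsGE_iff_exists_Icc_subset.1 hc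
  obtain ⟨e, he0, hed, heL⟩ : ∃ e, 0 < e ∧ e ≤ d ∧ e ≤ L :=
    ⟨min d L, lt_min hd hL, min_le_left _ _, min_le_right _ _⟩
  obtain ⟨ξ, hξ, hξ'⟩ := exists_hasDerivAt_eq_slope f g he0
    (h.continuousOn.mono (Icc_subset_Icc_right heL)) fun z hz =>
      (h.deriv z ⟨hz.1.le, hz.2.le.trans heL⟩).hasDerivAt
      (Icc_mem_nhds hz.1 (hz.2.trans_le heL))
  have h1 : 0 < g ξ := hd' ⟨hξ.1.le, hξ.2.le.trans hed⟩
  rw [hξ', sub_zero] at h1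
  have := hmax e ⟨he0.le, heL⟩
  have := (div_pos_iff_of_pos_right he0).1 h1
  linarith

/-- If the second derivative at 0 were positive, then `g`, starting from 0, would be positive just
to the right, and `f` would exceed `f 0`. -/
lemma deriv2_zero_nonpos_of_le (h : IsSolOn p a ρ L f g) (hL : 0 < L)
    (hmax : ∀ y ∈ Icc 0 L, f y ≤ f 0) (hg : g 0 = 0) (hp : 2 < p) :
    a * f 0 - ρ * f 0 ^ (p - 1) ≤ 0 := by
  by_contra! hk
  have hcont : ContinuousOn (fun y => a * f y - ρ * f y ^ (p - 1)) (Icc 0 L) :=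
    (continuousOn_const.mul h.continuousOn).sub (continuousOn_const.mul
      (h.continuousOn.rpow_const fun y _ => Or.inr (by linarith)))
  have hc : ∀ᶠ y in 𝓝[Icc 0 L] 0, 0 < a * f y - ρ * f y ^ (p - 1) :=
    (hcont 0 ⟨le_rfl, hL.le⟩).eventually (lt_mem_nhds hk)
  rw [nhdsWithin_Icc_eq_nhdsGE hL] at hc
  obtain ⟨d, hd, hd'⟩ := mem_nhdsGE_iff_exists_Icc_subset.1 hc
  obtain ⟨e, he0, hed, heL⟩ : ∃ e, 0 < e ∧ e ≤ d ∧ e ≤ L :=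
    ⟨min d L, lt_min hd hL, min_le_left _ _, min_le_right _ _⟩
  have hpos : ∀ y ∈ Ioo 0 e, 0 < g y := by
    intro y hy
    obtain ⟨ξ, hξ, hξ'⟩ := exists_hasDerivAt_eq_slope g _ hy.1
      (h.continuousOn'.mono (Icc_subset_Icc_right (hy.2.le.trans heL))) fun z hz =>
        (h.deriv2 z ⟨hz.1.le, hz.2.le.trans (hy.2.le.trans heL)⟩).hasDerivAt
        (Icc_mem_nhds hz.1 (hz.2.trans_le (hy.2.le.trans heL)))
    have h1 := hd' ⟨hξ.1.le, hξ.2.le.trans (hy.2.le.trans hed)⟩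
    simp only [mem_ofPred_eq] at h1
    rw [hξ', sub_zero, hg, sub_zero] at h1
    exact (div_pos_iff_of_pos_right hy.1).1 h1
  obtain ⟨ξ, hξ, hξ'⟩ := exists_hasDerivAt_eq_slope f g he0
    (h.continuousOn.mono (Icc_subset_Icc_right heL)) fun z hz =>
      (h.deriv z ⟨hz.1.le, hz.2.le.trans heL⟩).hasDerivAt
      (Icc_mem_nhds hz.1 (hz.2.trans_le heL))
  have h1 := hpos ξ hξ
  rw [hξ', sub_zero] at h1
  have := hmax e ⟨he0.le, heL⟩
  have := (div_pos_iff_of_pos_right he0).1 h1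
  linarith

/-- A solution with vanishing data at `0` vanishes. -/
lemma eq_zero (hp : 2 < p) (h : IsSolOn p a ρ L f g) (hM : ∀ y ∈ Icc 0 L, f y ≤ M)
    (hf : f 0 = 0) (hg : g 0 = 0) {y : ℝ} (hy : y ∈ Icc 0 L) : f y = 0 ∧ g y = 0 := by
  have hM0 : 0 ≤ M := (h.nonneg y hy).trans (hM y hy)
  have := h.abs_sub_le hp (IsSolOn.zero hp a ρ L) hM (fun _ _ => hM0)
    (le_max_left |a| |ρ|) (le_max_right _ _) hy
  simp only [hf, hg, sub_self, abs_zero, max_self, zero_mul, add_zero, sub_zero] at this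
  exact ⟨abs_nonpos_iff.1 ((le_max_left _ _).trans this),
    abs_nonpos_iff.1 ((le_max_right _ _).trans this)⟩

/-- Two solutions of the same equation with the same data at `0` agree. -/
lemma eq_of_data {f' g' : ℝ → ℝ} (hp : 2 < p) (h : IsSolOn p a ρ L f g)
    (h' : IsSolOn p a ρ L f' g')
    (hM : ∀ y ∈ Icc 0 L, f y ≤ M) (hM' : ∀ y ∈ Icc 0 L, f' y ≤ M) (hf : f 0 = f' 0)
    (hg : g 0 = g' 0) {y : ℝ} (hy : y ∈ Icc 0 L) : f y = f' y := by
  have := h.abs_sub_le hp h' hM hM' (le_max_left |a| |ρ|) (le_max_right _ _) hy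
  simp only [hf, hg, sub_self, abs_zero, max_self, zero_mul, add_zero] at this
  exact sub_eq_zero.1 (abs_nonpos_iff.1 ((le_max_left _ _).trans this))

/-- If a bounded solution on `[0, ∞)` and its derivative vanish at a point, the solution vanishes. -/
lemma eq_zero_of_eq_zero (hp : 2 < p) (h : ∀ b, IsSolOn p a ρ b f g) (hM : ∀ y, 0 ≤ y → f y ≤ M)
    {y₀ : ℝ} (hy₀ : 0 ≤ y₀) (hf : f y₀ = 0) (hg : g y₀ = 0) {y : ℝ} (hy : 0 ≤ y) :
    f y = 0 := by
  rcases le_total y y₀ with hyy | hyy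
  · simpa using (((h y₀).reflect le_rfl).eq_zero hp (M := M)
      (fun z hz => hM _ (by linarith [hz.2])) (by simpa using hf) (by simpa using hg)
      (y := y₀ - y) ⟨by linarith, by linarith⟩).1
  · simpa using (((h y).shift hy₀).eq_zero hp (M := M)
      (fun z hz => hM _ (by linarith [hz.1])) (by simpa using hf) (by simpa using hg)
      (y := y - y₀) ⟨by linarith, by linarith⟩).1

/-- Since `f ≥ 0`, an interior zero is a local minimum. -/
lemma deriv_eq_zero_of_eq_zero (h : ∀ b, IsSolOn p a ρ b f g) {y₀ : ℝ} (hy₀ : 0 < y₀)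
    (hf : f y₀ = 0) : g y₀ = 0 := by
  have hn : Icc 0 (y₀ + 1) ∈ 𝓝 y₀ := Icc_mem_nhds hy₀ (by linarith)
  refine IsLocalMin.hasDerivAt_eq_zero (f := f) ?_
    (((h (y₀ + 1)).deriv y₀ ⟨hy₀.le, by linarith⟩).hasDerivAt hn)
  filter_upwards [hn] with z hz
  rw [hf]
  exact (h (y₀ + 1)).nonneg z hz

/-- A nonnegative solution of `f'' = - ρ f ^ (p - 1)` on `[0, ∞)` is nondecreasing. -/
lemma deriv_nonneg (hρ : 0 ≤ ρ) (h : ∀ b, IsSolOn p 0 ρ b f g) {y₀ : ℝ} (hy₀ : 0 ≤ y₀) :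
    0 ≤ g y₀ := by
  by_contra! hg
  -- For `a = 0` the solution is concave, so a negative slope stays at least as negative.
  have hanti : ∀ y, y₀ ≤ y → g y ≤ g y₀ := by
    intro y hy
    have := sub_le_mul_of_hasDerivWithinAt (C := 0) (h y).deriv2 hy₀ hy le_rfl fun z hz => by
      have := Real.rpow_nonneg ((h y).nonneg z ⟨hy₀.trans hz.1, hz.2⟩) (p - 1)
      nlinarith
    linarith
  have h0 := (h y₀).nonneg y₀ ⟨hy₀, le_rfl⟩
  -- The tangent line at `y₀` reaches the value `-1` at this point, and by concavity `f` lies below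
  -- it.
  set y := y₀ + (f y₀ + 1) / (- g y₀) with hy
  have hyy : y₀ ≤ y := by
    have : 0 ≤ (f y₀ + 1) / (- g y₀) := div_nonneg (by linarith) (by linarith)
    linarith
  have h1 := sub_le_mul_of_hasDerivWithinAt (C := g y₀) (h y).deriv hy₀ hyy le_rfl
    fun z hz => hanti z hz.1
  have h2 : g y₀ * (y - y₀) = - (f y₀ + 1) := by rw [hy]; field_simp [hg.ne]; ring
  have := (h y).nonneg y ⟨hy₀.trans hyy, le_rfl⟩
  linarith

/-- The slope is nonincreasing by concavity, starts at 0, and is nonnegative by `deriv_nonneg`;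
hence it vanishes identically, so the second derivative `-ρ f^(p-1)` vanishes as well. -/
lemma eq_zero_of_deriv_zero (hp : 2 < p) (hρ : 0 < ρ) (h : ∀ b, IsSolOn p 0 ρ b f g) (hg : g 0 = 0)
    {y : ℝ} (hy : 0 ≤ y) : f y = 0 := by
  have hg0 : ∀ z, 0 ≤ z → g z = 0 := by
    intro z hz
    refine le_antisymm ?_ (deriv_nonneg hρ.le h hz)
    have := sub_le_mul_of_hasDerivWithinAt (C := 0) (h z).deriv2 le_rfl hz le_rfl fun t ht => by
      have := Real.rpow_nonneg ((h z).nonneg t ht) (p - 1)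
      nlinarith
    linarith
  have hI : y ∈ Icc 0 (y + 1) := ⟨hy, by linarith⟩
  have h1 := (h (y + 1)).deriv2 y hI
  have h2 : HasDerivWithinAt g 0 (Icc 0 (y + 1)) y :=
    (hasDerivWithinAt_const y _ (0 : ℝ)).congr (fun z hz => hg0 z hz.1) (hg0 y hy)
  have h3 := (uniqueDiffOn_Icc (by linarith : (0 : ℝ) < y + 1) y hI).eq_deriv _ h1 h2
  have h4 : f y ^ (p - 1) = 0 := by
    rcases mul_eq_zero.1 (show ρ * f y ^ (p - 1) = 0 by linarith) with h | h
    exacts [absurd h hρ.ne', h]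
  exact ((Real.rpow_eq_zero ((h y).nonneg y ⟨hy, le_rfl⟩) (by linarith)).1 h4)

end IsSolOn

end MetricGraph

/-! ### Cutoff functions, and bounded Morse index implies a finite `L^p` norm -/

namespace MetricGraph

lemma exists_abs_deriv_smoothTransition_le :
    ∃ C : ℝ, 0 < C ∧ ∀ y, |deriv Real.smoothTransition y| ≤ C := by
  have hc : Continuous (deriv Real.smoothTransition) :=
    (Real.smoothTransition.contDiff (n := 1)).continuous_deriv le_rfl
  obtain ⟨C, hC⟩ := isCompact_Icc.exists_bound_of_continuousOn (s := Icc (0 : ℝ) 1) hc.continuousOn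
  refine ⟨max C 1, by positivity, fun y => ?_⟩
  by_cases hy : y ∈ Icc (0 : ℝ) 1
  · exact (hC y hy).trans (le_max_left _ _)
  · have : deriv Real.smoothTransition y = 0 := by
      rcases lt_or_ge y 0 with h | h
      · have : Real.smoothTransition =ᶠ[𝓝 y] fun _ => 0 := by
          filter_upwards [gt_mem_nhds h] with z hz
          exact Real.smoothTransition.zero_of_nonpos hz.le
        rw [this.deriv_eq, deriv_const]
      · have h1 : 1 < y := by by_contra! h'; exact hy ⟨h, h'⟩
        have : Real.smoothTransition =ᶠ[𝓝 y] fun _ => 1 := by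
          filter_upwards [lt_mem_nhds h1] with z hz
          exact Real.smoothTransition.one_of_one_le hz.le
        rw [this.deriv_eq, deriv_const]
    simp [this]

/-- A bound for the derivative of `Real.smoothTransition`. -/
noncomputable def transitionBound : ℝ := exists_abs_deriv_smoothTransition_le.choose

lemma transitionBound_pos : 0 < transitionBound := exists_abs_deriv_smoothTransition_le.choose_spec.1

lemma abs_deriv_smoothTransition_le (y : ℝ) : |deriv Real.smoothTransition y| ≤ transitionBound :=
  exists_abs_deriv_smoothTransition_le.choose_spec.2 y

/-- A smooth function with values in `[0, 1]` that vanishes outside of `[a, b]` and is equal to `1` on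
`[a + w, b - w]`. -/
noncomputable def cutoff (a b w y : ℝ) : ℝ :=
  Real.smoothTransition ((y - a) / w) * Real.smoothTransition ((b - y) / w)

section cutoff

variable {a b w y : ℝ}

lemma cutoff_contDiff : ContDiff ℝ ∞ (cutoff a b w) := by
  unfold cutoff
  exact (Real.smoothTransition.contDiff.comp (by fun_prop)).mul
    (Real.smoothTransition.contDiff.comp (by fun_prop))

lemma cutoff_eq_zero (hw : 0 < w) (hy : y ∉ Ioo a b) : cutoff a b w y = 0 := by
  unfold cutoff
  by_cases h : y ≤ a
  · rw [Real.smoothTransition.zero_of_nonpos (div_nonpos_of_nonpos_of_nonneg (by linarith) hw.le),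
      zero_mul]
  · have : b ≤ y := by by_contra! h'; exact hy ⟨by linarith, h'⟩
    rw [Real.smoothTransition.zero_of_nonpos (x := (b - y) / w)
      (div_nonpos_of_nonpos_of_nonneg (by linarith) hw.le), mul_zero]

lemma cutoff_eq_one (hw : 0 < w) (hy : y ∈ Icc (a + w) (b - w)) : cutoff a b w y = 1 := by
  unfold cutoff
  rw [Real.smoothTransition.one_of_one_le ((one_le_div hw).2 (by linarith [hy.1])),
    Real.smoothTransition.one_of_one_le ((one_le_div hw).2 (by linarith [hy.2])), one_mul]

lemma abs_deriv_cutoff_le (hw : 0 < w) : |deriv (cutoff a b w) y| ≤ 2 * transitionBound / w := by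
  have hd : ∀ x, HasDerivAt Real.smoothTransition (deriv Real.smoothTransition x) x := fun x =>
    ((Real.smoothTransition.contDiff (n := 1)).differentiable (by simp) x).hasDerivAt
  have h1 : HasDerivAt (fun y => Real.smoothTransition ((y - a) / w))
      (deriv Real.smoothTransition ((y - a) / w) * (1 / w)) y :=
    (hd _).comp y (((hasDerivAt_id y).sub_const a).div_const w)
  have h2 : HasDerivAt (fun y => Real.smoothTransition ((b - y) / w))
      (deriv Real.smoothTransition ((b - y) / w) * (-1 / w)) y :=
    (hd _).comp y (((hasDerivAt_id y).const_sub b).div_const w)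
  rw [show cutoff a b w = fun y => Real.smoothTransition ((y - a) / w) *
    Real.smoothTransition ((b - y) / w) from rfl, (h1.fun_mul h2).deriv]
  have e1 := abs_deriv_smoothTransition_le ((y - a) / w)
  have e2 := abs_deriv_smoothTransition_le ((b - y) / w)
  have e3 := Real.smoothTransition.le_one ((y - a) / w)
  have e4 := Real.smoothTransition.le_one ((b - y) / w)
  have e5 := Real.smoothTransition.nonneg ((y - a) / w)
  have e6 := Real.smoothTransition.nonneg ((b - y) / w)
  have hC := transitionBound_pos
  refine (abs_add_le _ _).trans ?_
  rw [abs_mul, abs_mul, abs_mul, abs_mul, abs_of_nonneg e5, abs_of_nonneg e6, abs_div, abs_div,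
    abs_neg, abs_one, abs_of_pos hw]
  calc _ ≤ transitionBound * (1 / w) * 1 + 1 * (transitionBound * (1 / w)) := by gcongr
    _ = _ := by ring

lemma sq_deriv_cutoff_le (hw : 0 < w) :
    deriv (cutoff a b w) y ^ 2 ≤ 4 * transitionBound ^ 2 / w ^ 2 := by
  rw [← sq_abs]
  calc _ ≤ (2 * transitionBound / w) ^ 2 := by gcongr; exact abs_deriv_cutoff_le hw
    _ = _ := by ring

lemma deriv_cutoff_eq_zero (hw : 0 < w) (hy : y ∈ Ioo (a + w) (b - w)) :
    deriv (cutoff a b w) y = 0 := by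
  have : cutoff a b w =ᶠ[𝓝 y] fun _ => 1 := by
    filter_upwards [Ioo_mem_nhds hy.1 hy.2] with z hz
    exact cutoff_eq_one hw (Ioo_subset_Icc_self hz)
  rw [this.deriv_eq, deriv_const]

lemma continuous_deriv_cutoff : Continuous (deriv (cutoff a b w)) :=
  cutoff_contDiff.continuous_deriv (by simp)

end cutoff

lemma tendstoUniformlyOn_rpow {M q : ℝ} (hq : 0 ≤ q) {f : ℕ → ℝ → ℝ} {V : ℝ → ℝ} {S : Set ℝ}
    (hf : TendstoUniformlyOn f V atTop S) (hfM : ∀ᶠ n in atTop, ∀ y ∈ S, f n y ∈ Icc 0 M)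
    (hVM : ∀ y ∈ S, V y ∈ Icc 0 M) :
    TendstoUniformlyOn (fun n y => f n y ^ q) (fun y => V y ^ q) atTop S :=
  UniformContinuousOn.comp_tendstoUniformlyOn_eventually hfM hVM
    (isCompact_Icc.uniformContinuousOn_of_continuous
      (continuousOn_id.rpow_const fun _ _ => Or.inr hq)) hf

/-- For `k + 1` disjoint intervals in `(0, L)`, and functions supported in them, the quadratic form
of the equation cannot be negative at all the products of `f` with these functions. -/
def NoWindows (k : ℕ) (p ρ L : ℝ) (f : ℝ → ℝ) : Prop :=
  ∀ (a b : Fin (k + 1) → ℝ), (∀ j, 0 < a j ∧ a j < b j ∧ b j < L) →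
    (Pairwise fun i j => Disjoint (Icc (a i) (b i)) (Icc (a j) (b j))) →
    ∀ χ : Fin (k + 1) → ℝ → ℝ, (∀ j, ContDiff ℝ ∞ (χ j)) →
      (∀ j, ∀ y ∉ Ioo (a j) (b j), χ j y = 0) →
      ∃ j, 0 ≤ ∫ y in (a j)..(b j),
        (f y ^ 2 * deriv (χ j) y ^ 2 - (p - 2) * ρ * (f y ^ p * χ j y ^ 2))

/-- The cutoff changes only on the two unit intervals at the ends of the window. The gradient term
is therefore at most `8 * transitionBound ^ 2 * M ^ 2` whatever the length of the window, while the
middle part, where the cutoff is 1, contributes more than `C` to the power term. -/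
lemma integral_cutoff_lt {p ρ a b M C : ℝ} {f : ℝ → ℝ} (hp : 2 < p) (hρ : 1 / 2 ≤ ρ)
    (hab : a + 2 ≤ b) (hf : ContinuousOn f (Icc a b)) (hM : ∀ y ∈ Icc a b, f y ∈ Icc 0 M)
    (hC : 8 * transitionBound ^ 2 * M ^ 2 < (p - 2) * (1 / 2) * C)
    (hint : C < ∫ y in (a + 1)..(b - 1), f y ^ p) :
    ∫ y in a..b, (f y ^ 2 * deriv (cutoff a b 1) y ^ 2
      - (p - 2) * ρ * (f y ^ p * cutoff a b 1 y ^ 2)) < 0 := by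
  have hfp : ContinuousOn (fun y => f y ^ p) (Icc a b) :=
    hf.rpow_const fun _ _ => Or.inr (by linarith)
  have hc1 : ContinuousOn (fun y => f y ^ 2 * deriv (cutoff a b 1) y ^ 2) (Icc a b) :=
    (hf.pow 2).mul (continuous_deriv_cutoff.continuousOn.pow 2)
  have hc2 : ContinuousOn (fun y => f y ^ p * cutoff a b 1 y ^ 2) (Icc a b) :=
    hfp.mul (cutoff_contDiff.continuous.continuousOn.pow 2)
  have ii : ∀ {F : ℝ → ℝ}, ContinuousOn F (Icc a b) → ∀ {x y}, a ≤ x → x ≤ y → y ≤ b →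
      IntervalIntegrable F volume x y := fun hF x y hx hxy hy =>
    (hF.mono (by rw [uIcc_of_le hxy]; exact Icc_subset_Icc hx hy)).intervalIntegrable
  have hM2 : ∀ y ∈ Icc a b, f y ^ 2 * deriv (cutoff a b 1) y ^ 2 ≤
      M ^ 2 * (4 * transitionBound ^ 2) := by
    intro y hy
    have h1 := sq_deriv_cutoff_le (a := a) (b := b) (y := y) one_pos
    have h2 : f y ^ 2 ≤ M ^ 2 := pow_le_pow_left₀ (hM y hy).1 (hM y hy).2 2
    simp only [one_pow, div_one] at h1
    gcongr
  have I1 : ∫ y in a..b, f y ^ 2 * deriv (cutoff a b 1) y ^ 2 ≤ 8 * transitionBound ^ 2 * M ^ 2 := by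
    rw [← intervalIntegral.integral_add_adjacent_intervals (b := a + 1)
      (ii hc1 le_rfl (by linarith) (by linarith)) (ii hc1 (by linarith) (by linarith) le_rfl),
      ← intervalIntegral.integral_add_adjacent_intervals (a := a + 1) (b := b - 1)
      (ii hc1 (by linarith) (by linarith) (by linarith))
      (ii hc1 (by linarith) (by linarith) (by linarith))]
    have e1 := intervalIntegral.integral_mono_on (a := a) (b := a + 1) (by linarith)
      (ii hc1 le_rfl (by linarith) (by linarith)) (intervalIntegrable_const (μ := volume))
      fun y hy => hM2 y ⟨hy.1, by linarith [hy.2]⟩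
    have e3 := intervalIntegral.integral_mono_on (a := b - 1) (b := b) (by linarith)
      (ii hc1 (by linarith) (by linarith) le_rfl) (intervalIntegrable_const (μ := volume))
      fun y hy => hM2 y ⟨by linarith [hy.1], hy.2⟩
    have e2 : ∫ y in (a + 1)..(b - 1), f y ^ 2 * deriv (cutoff a b 1) y ^ 2 = 0 := by
      rw [intervalIntegral.integral_of_le (by linarith), integral_Ioc_eq_integral_Ioo]
      refine setIntegral_eq_zero_of_forall_eq_zero fun y hy => ?_
      rw [deriv_cutoff_eq_zero one_pos hy]; ring
    rw [e2]
    simp only [intervalIntegral.integral_const, smul_eq_mul] at e1 e3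
    linarith
  have I2 : ∫ y in (a + 1)..(b - 1), f y ^ p ≤ ∫ y in a..b, f y ^ p * cutoff a b 1 y ^ 2 := by
    have h0 : ∀ y ∈ Icc a b, 0 ≤ f y ^ p * cutoff a b 1 y ^ 2 := fun y hy =>
      mul_nonneg (Real.rpow_nonneg (hM y hy).1 _) (sq_nonneg _)
    have e : ∫ y in (a + 1)..(b - 1), f y ^ p =
        ∫ y in (a + 1)..(b - 1), f y ^ p * cutoff a b 1 y ^ 2 := by
      refine intervalIntegral.integral_congr fun y hy => ?_
      rw [uIcc_of_le (by linarith)] at hy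
      simp [cutoff_eq_one one_pos hy]
    rw [e]
    refine intervalIntegral.integral_mono_interval (by linarith) (by linarith) (by linarith) ?_
      (ii hc2 le_rfl (by linarith) le_rfl)
    exact (ae_restrict_iff' measurableSet_Ioc).2 (ae_of_all _ fun y hy =>
      h0 y (Ioc_subset_Icc_self hy))
  rw [intervalIntegral.integral_sub (ii hc1 le_rfl (by linarith) le_rfl)
    ((ii hc2 le_rfl (by linarith) le_rfl).const_mul _), intervalIntegral.integral_const_mul]
  have hC0 : 0 < C := by
    have : 0 ≤ 8 * transitionBound ^ 2 * M ^ 2 := by positivity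
    have h2 : 0 < (p - 2) * (1 / 2) := by linarith
    exact (mul_pos_iff_of_pos_left h2).1 (this.trans_lt hC)
  have h3 : (p - 2) * (1 / 2) * C ≤ (p - 2) * ρ * ∫ y in a..b, f y ^ p * cutoff a b 1 y ^ 2 := by
    have : 0 ≤ p - 2 := by linarith
    gcongr
    linarith
  linarith

/-- A locally uniform limit of bounded solutions of bounded Morse index has finite `L ^ p` norm. -/
lemma exists_integral_rpow_le {k : ℕ} {p M : ℝ} (hp : 2 < p) {ρ L : ℕ → ℝ} {f : ℕ → ℝ → ℝ}
    {V : ℝ → ℝ} (hL : Tendsto L atTop atTop) (hρ : Tendsto ρ atTop (𝓝 1))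
    (hc : ∀ n, ContinuousOn (f n) (Icc 0 (L n)))
    (hM : ∀ n, ∀ y ∈ Icc 0 (L n), f n y ∈ Icc 0 M) (hV : ∀ y, 0 ≤ y → V y ∈ Icc 0 M)
    (hf : ∀ b, TendstoUniformlyOn f V atTop (Icc 0 b))
    (hW : ∀ n, NoWindows k p (ρ n) (L n) (f n)) :
    ∃ K, ∀ T, 0 ≤ T → ∫ y in (0 : ℝ)..T, V y ^ p ≤ K := by
  by_contra! hcon
  have hVc : ∀ b, ContinuousOn (fun y => V y ^ p) (Icc 0 b) := fun b =>
    ((hf b).continuousOn ((hL.eventually_ge_atTop b).mono fun n hn =>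
      (hc n).mono (Icc_subset_Icc_right hn)).frequently).rpow_const
      fun _ _ => Or.inr (by linarith)
  have ii : ∀ {x y}, 0 ≤ x → x ≤ y → IntervalIntegrable (fun y => V y ^ p) volume x y :=
    fun {x y} hx hxy => ((hVc y).mono (by
      rw [uIcc_of_le hxy]; exact Icc_subset_Icc_left hx)).intervalIntegrable
  -- The mass that a window must carry in order to beat its gradient cost, with `ρ n` bounded below
  -- by `1 / 2`.
  obtain ⟨C, hC⟩ : ∃ C, 8 * transitionBound ^ 2 * M ^ 2 < (p - 2) * (1 / 2) * C := by
    refine ⟨(8 * transitionBound ^ 2 * M ^ 2 + 1) / ((p - 2) * (1 / 2)), ?_⟩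
    rw [mul_div_cancel₀ _ (by linarith : (p - 2) * (1 / 2) ≠ 0) ]
    linarith
  -- A window with left end `s`: as the integrals of `V^p` over `[0, T]` are unbounded, so are those
  -- over the part beyond `s + 1`, and a far enough right end collects mass `C`.
  have step : ∀ s, ∃ t, 0 ≤ s → s + 2 ≤ t ∧ C < ∫ y in (s + 1)..(t - 1), V y ^ p := by
    intro s
    by_cases hs : 0 ≤ s
    · obtain ⟨T, hT, hT'⟩ := hcon ((∫ y in (0 : ℝ)..(s + 1), V y ^ p) + C)
      have h1 : s + 1 ≤ max T (s + 1) := le_max_right _ _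
      refine ⟨max T (s + 1) + 1, fun _ => ⟨by linarith, ?_⟩⟩
      rw [add_sub_cancel_right]
      have e1 := intervalIntegral.integral_add_adjacent_intervals (ii le_rfl (by linarith))
        (ii (x := s + 1) (by linarith) h1)
      have e2 := intervalIntegral.integral_add_adjacent_intervals (ii le_rfl hT)
        (ii hT (le_max_left T (s + 1)))
      have e3 : 0 ≤ ∫ y in T..(max T (s + 1)), V y ^ p :=
        intervalIntegral.integral_nonneg (le_max_left _ _) fun y hy =>
          Real.rpow_nonneg (hV y (hT.trans hy.1)).1 _
      linarith
    · exact ⟨0, fun h => absurd h hs⟩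
  choose N hN using step
  -- Left ends of successive windows. Starting at 1 keeps them away from 0, and the gap 1 between
  -- the right end of a window and the next left end makes them disjoint.
  set T : ℕ → ℝ := fun j => (fun s => N s + 1)^[j] 1 with hTdef
  have hTs : ∀ j, T (j + 1) = N (T j) + 1 := fun j => Function.iterate_succ_apply' _ _ _
  have hT0 : ∀ j, 0 < T j := by
    intro j
    induction j with
    | zero => simp [hTdef]
    | succ j ih => rw [hTs]; linarith [(hN _ ih.le).1]
  have hTm : Monotone T := monotone_nat_of_le_succ fun j => by
    rw [hTs]; linarith [(hN _ (hT0 j).le).1]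
  have hdisj : ∀ {i j : ℕ}, i < j → N (T i) < T j := fun {i j} hij => by
    have := hTm (Nat.succ_le_of_lt hij)
    rw [hTs] at this
    linarith
  have hconv : ∀ j : ℕ, ∀ᶠ n in atTop, C < ∫ y in (T j + 1)..(N (T j) - 1), f n y ^ p := by
    intro j
    have h2 := hN _ (hT0 j).le
    have hsub : Icc (T j + 1) (N (T j) - 1) ⊆ Icc 0 (N (T j)) :=
      Icc_subset_Icc (by linarith [hT0 j]) (by linarith)
    refine Tendsto.eventually_const_lt h2.2
      (TendstoUniformlyOn.tendsto_intervalIntegral_of_continuousOn ?_ ?_)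
    all_goals rw [uIcc_of_le (by linarith)]
    · filter_upwards [hL.eventually_ge_atTop (N (T j))] with n hn
      exact ((hc n).mono (hsub.trans (Icc_subset_Icc_right hn))).rpow_const
        fun _ _ => Or.inr (by linarith)
    · refine tendstoUniformlyOn_rpow (M := M) (by linarith) ((hf _).mono hsub) ?_
        fun y hy => hV y (hsub hy).1
      filter_upwards [hL.eventually_ge_atTop (N (T j))] with n hn y hy
      exact hM n y ⟨(hsub hy).1, (hsub hy).2.trans hn⟩
  -- Only `k + 1` windows are needed, so one large `n` serves all of them, and `f n` inherits the
  -- mass of `V` in each.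
  have hall : ∀ᶠ n in atTop, (∀ j : Fin (k + 1), C < ∫ y in (T j + 1)..(N (T j) - 1), f n y ^ p) ∧
      1 / 2 < ρ n ∧ N (T k) < L n :=
    ((eventually_all.2 fun j : Fin (k + 1) => hconv j)).and
      ((hρ.eventually (lt_mem_nhds (by norm_num))).and (hL.eventually_gt_atTop _))
  obtain ⟨n, hn1, hn2, hn3⟩ := hall.exists
  have hNL : ∀ j : Fin (k + 1), N (T j) < L n := by
    intro j
    rcases (Nat.lt_succ_iff.1 j.2).lt_or_eq with h | h
    · have := hdisj h
      have := (hN _ (hT0 k).le).1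
      linarith
    · rw [h]; exact hn3
  have hd' : ∀ i j : Fin (k + 1), i < j →
      Disjoint (Icc (T i) (N (T i))) (Icc (T j) (N (T j))) := fun i j hij =>
    Set.disjoint_left.2 fun y hy hy' => by
      have := hdisj (Fin.lt_def.1 hij)
      linarith [hy.2, hy'.1]
  obtain ⟨j, hj⟩ := hW n (fun j => T j) (fun j => N (T j))
    (fun j => ⟨hT0 j, by linarith [(hN _ (hT0 j).le).1], hNL j⟩)
    (fun i j hij => by
      rcases lt_or_gt_of_ne hij with h | h
      exacts [hd' i j h, (hd' j i h).symm])
    (fun j => cutoff (T j) (N (T j)) 1) (fun j => cutoff_contDiff)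
    (fun j y hy => cutoff_eq_zero one_pos hy)
  have hsub : Icc (T j) (N (T j)) ⊆ Icc 0 (L n) := Icc_subset_Icc (hT0 j).le (hNL j).le
  exact absurd hj (not_le.2 (integral_cutoff_lt hp hn2.le (hN _ (hT0 j).le).1
    ((hc n).mono hsub) (fun y hy => hM n y (hsub hy)) hC (hn1 j)))

end MetricGraph

/-! ### Decay and finite energy of the limit on a half-line -/

namespace MetricGraph

namespace IsSolOn

variable {p a ρ M C K : ℝ} {V W : ℝ → ℝ}

lemma Icc_mem_nhdsGE {y : ℝ} : Icc 0 (y + 1) ∈ 𝓝[Ici 0] y := by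
  rw [← Ici_inter_Iic]
  exact inter_mem_nhdsWithin _ (Iic_mem_nhds (by linarith))

lemma hasDerivWithinAt_Ici (h : ∀ b, IsSolOn p a ρ b V W) {y : ℝ} (hy : 0 ≤ y) :
    HasDerivWithinAt V (W y) (Ici 0) y :=
  ((h (y + 1)).deriv y ⟨hy, by linarith⟩).mono_of_mem_nhdsWithin Icc_mem_nhdsGE

lemma hasDerivWithinAt_Ici' (h : ∀ b, IsSolOn p a ρ b V W) {y : ℝ} (hy : 0 ≤ y) :
    HasDerivWithinAt W (a * V y - ρ * V y ^ (p - 1)) (Ici 0) y :=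
  ((h (y + 1)).deriv2 y ⟨hy, by linarith⟩).mono_of_mem_nhdsWithin Icc_mem_nhdsGE

lemma continuousOn_Ici (h : ∀ b, IsSolOn p a ρ b V W) : ContinuousOn V (Ici 0) :=
  fun _ hy => (hasDerivWithinAt_Ici h hy).continuousWithinAt

lemma continuousOn_Ici' (h : ∀ b, IsSolOn p a ρ b V W) : ContinuousOn W (Ici 0) :=
  fun _ hy => (hasDerivWithinAt_Ici' h hy).continuousWithinAt

lemma nonneg_Ici (h : ∀ b, IsSolOn p a ρ b V W) {y : ℝ} (hy : 0 ≤ y) : 0 ≤ V y :=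
  (h y).nonneg y ⟨hy, le_rfl⟩

lemma integrableOn_Ioi_of_integral_le {F : ℝ → ℝ} (hF : ContinuousOn F (Ici 0))
    (h0 : ∀ y, 0 ≤ y → 0 ≤ F y) {K : ℝ} (hK : ∀ T, 0 ≤ T → ∫ y in (0 : ℝ)..T, F y ≤ K) :
    IntegrableOn F (Ioi 0) := by
  refine integrableOn_Ioi_of_intervalIntegral_norm_bounded (l := atTop) (b := id) K 0
    (fun T => ?_) tendsto_id ?_
  · exact ((hF.mono Icc_subset_Ici_self).integrableOn_Icc (μ := volume)).mono_set
      Ioc_subset_Icc_self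
  · filter_upwards [eventually_ge_atTop 0] with T hT
    refine le_of_eq_of_le (intervalIntegral.integral_congr fun y hy => ?_) (hK T hT)
    simp only [id, uIcc_of_le hT] at hy
    exact Real.norm_of_nonneg (h0 y hy.1)

lemma integrableOn_rpow (hp : 2 < p) (h : ∀ b, IsSolOn p a ρ b V W)
    (hK : ∀ T, 0 ≤ T → ∫ y in (0 : ℝ)..T, V y ^ p ≤ K) :
    IntegrableOn (fun y => V y ^ p) (Ioi 0) :=
  integrableOn_Ioi_of_integral_le ((continuousOn_Ici h).rpow_const fun _ _ => Or.inr (by linarith))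
    (fun _ hy => Real.rpow_nonneg (nonneg_Ici h hy) _) hK

/-- A bounded solution with finite `L ^ p` norm vanishes at infinity. -/
lemma tendsto_zero (hp : 2 < p) (h : ∀ b, IsSolOn p a ρ b V W) (hM : ∀ y, 0 ≤ y → V y ≤ M)
    (hC : ∀ y, 0 ≤ y → |W y| ≤ C) (hK : ∀ T, 0 ≤ T → ∫ y in (0 : ℝ)..T, V y ^ p ≤ K) :
    Tendsto V atTop (𝓝 0) := by
  have hint := integrableOn_rpow hp h hK
  have hVc := (continuousOn_Ici h).mono Ioi_subset_Ici_self
  have hWc := (continuousOn_Ici' h).mono Ioi_subset_Ici_self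
  have hpos : ∀ y ∈ Ioi (0 : ℝ), 0 ≤ V y := fun y hy => nonneg_Ici h (le_of_lt hy)
  -- The power `V^(p+1)` is chosen because both it and its derivative `(p+1) V^p V'` are dominated
  -- by multiples of the integrable function `V^p`, as `V` and `V'` are bounded.
  have key := tendsto_zero_of_hasDerivAt_of_integrableOn_Ioi (a := 0)
    (f := fun y => V y ^ (p + 1)) (f' := fun y => W y * (p + 1) * V y ^ (p + 1 - 1)) ?_ ?_ ?_
  · have h1 : Tendsto (fun y => (V y ^ (p + 1)) ^ (1 / (p + 1))) atTop (𝓝 0) := by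
      have := key.rpow_const (p := 1 / (p + 1)) (Or.inr (by
        have : 0 < p + 1 := by linarith
        positivity))
      rwa [Real.zero_rpow (by have : 0 < p + 1 := by linarith
                              positivity)] at this
    refine h1.congr' ?_
    filter_upwards [eventually_gt_atTop 0] with y hy
    rw [← Real.rpow_mul (hpos y hy), mul_one_div_cancel (by linarith), Real.rpow_one]
  · intro y hy
    exact ((hasDerivWithinAt_Ici h (le_of_lt hy)).hasDerivAt (Ici_mem_nhds hy)).rpow_const
      (Or.inr (by linarith))
  · refine Integrable.mono' (hint.const_mul (C * (p + 1))) ?_ ?_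
    · exact ((hWc.mul continuousOn_const).mul
        (hVc.rpow_const fun _ _ => Or.inr (by linarith))).aestronglyMeasurable measurableSet_Ioi
    · refine (ae_restrict_iff' measurableSet_Ioi).2 (ae_of_all _ fun y hy => ?_)
      have hp1 : 0 < p + 1 := by linarith
      rw [add_sub_cancel_right, norm_mul, norm_mul, Real.norm_of_nonneg hp1.le,
        Real.norm_of_nonneg (Real.rpow_nonneg (hpos y hy) _)]
      have := hC y (le_of_lt hy)
      have := Real.rpow_nonneg (hpos y hy) p
      gcongr
      assumption
  · refine Integrable.mono' (hint.const_mul M) ?_ ?_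
    · exact (hVc.rpow_const fun _ _ => Or.inr (by linarith)).aestronglyMeasurable measurableSet_Ioi
    · refine (ae_restrict_iff' measurableSet_Ioi).2 (ae_of_all _ fun y hy => ?_)
      have h0 := hpos y hy
      rw [Real.norm_of_nonneg (Real.rpow_nonneg h0 _), Real.rpow_add_one' h0 (by linarith), mul_comm]
      have := hM y (le_of_lt hy)
      have := Real.rpow_nonneg h0 p
      gcongr

/-- A bounded solution of `V'' = V - V ^ (p - 1)` with finite `L ^ p` norm is in `H¹(0, ∞)`. -/
lemma integrableOn_sq (hp : 2 < p) (h : ∀ b, IsSolOn p 1 1 b V W) (hM : ∀ y, 0 ≤ y → V y ≤ M)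
    (hC : ∀ y, 0 ≤ y → |W y| ≤ C) (hK : ∀ T, 0 ≤ T → ∫ y in (0 : ℝ)..T, V y ^ p ≤ K) :
    IntegrableOn (fun y => V y ^ 2) (Ioi 0) ∧ IntegrableOn (fun y => W y ^ 2) (Ioi 0) := by
  have hVc := continuousOn_Ici h
  have hWc := continuousOn_Ici' h
  have hV2 : ContinuousOn (fun y => V y ^ 2) (Ici 0) := hVc.pow 2
  have hW2 : ContinuousOn (fun y => W y ^ 2) (Ici 0) := hWc.pow 2
  have hpc : ContinuousOn (fun y => V y ^ p) (Ici 0) :=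
    hVc.rpow_const fun _ _ => Or.inr (by linarith)
  have ii : ∀ {F : ℝ → ℝ}, ContinuousOn F (Ici 0) → ∀ {T}, 0 ≤ T →
      IntervalIntegrable F volume 0 T := fun hF T hT =>
    (hF.mono (by rw [uIcc_of_le hT]; exact Icc_subset_Ici_self)).intervalIntegrable
  have hVW : ∀ y, 0 ≤ y → |V y * W y| ≤ M * C := by
    intro y hy
    have h0 := nonneg_Ici h hy
    rw [abs_mul, abs_of_nonneg h0]
    exact mul_le_mul (hM y hy) (hC y hy) (abs_nonneg _) (h0.trans (hM y hy))
  -- Integration of `(V V')' = V'² + V² - V^p`. The boundary terms are at most `M * C` each and the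
  -- last term is controlled by `K`, so both squares have bounded integrals.
  have total : ∀ T, 0 ≤ T → (∫ y in (0 : ℝ)..T, V y ^ 2) + ∫ y in (0 : ℝ)..T, W y ^ 2 ≤
      2 * (M * C) + K := by
    intro T hT
    have e := intervalIntegral.integral_eq_sub_of_hasDeriv_right_of_le (a := 0) (b := T)
      (f := fun y => V y * W y) (f' := fun y => W y ^ 2 + V y ^ 2 - V y ^ p) hT
      ((hVc.mul hWc).mono Icc_subset_Ici_self) (fun y hy => ?_)
      (((ii hW2 hT).add (ii hV2 hT)).sub (ii hpc hT))
    · rw [intervalIntegral.integral_sub ((ii hW2 hT).add (ii hV2 hT)) (ii hpc hT),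
        intervalIntegral.integral_add (ii hW2 hT) (ii hV2 hT)] at e
      have := hK T hT
      have := abs_le.1 (hVW T hT)
      have := abs_le.1 (hVW 0 le_rfl)
      linarith
    · have hn : Ici (0 : ℝ) ∈ 𝓝 y := Ici_mem_nhds hy.1
      have h1 := (hasDerivWithinAt_Ici h hy.1.le).hasDerivAt hn
      have h2 := (hasDerivWithinAt_Ici' h hy.1.le).hasDerivAt hn
      refine (h1.mul h2).hasDerivWithinAt.congr_deriv ?_
      have h3 : V y ^ p = V y ^ (p - 1) * V y := by
        rw [← Real.rpow_add_one' (nonneg_Ici h hy.1.le) (by linarith)]; ring_nf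
      rw [h3]; ring
  have nn : ∀ F : ℝ → ℝ, ∀ T, 0 ≤ T → 0 ≤ ∫ y in (0 : ℝ)..T, F y ^ 2 := fun F T hT =>
    intervalIntegral.integral_nonneg hT fun _ _ => sq_nonneg _
  exact ⟨integrableOn_Ioi_of_integral_le (K := 2 * (M * C) + K) (hVc.pow 2) (fun _ _ => sq_nonneg _) fun T hT => by
      linarith [total T hT, nn W T hT],
    integrableOn_Ioi_of_integral_le (K := 2 * (M * C) + K) (hWc.pow 2) (fun _ _ => sq_nonneg _) fun T hT => by
      linarith [total T hT, nn V T hT]⟩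

lemma integral_deriv_eq (h : ∀ b, IsSolOn p a ρ b V W) {x y : ℝ} (hx : 0 ≤ x) (hy : 0 ≤ y) :
    V y - V x = ∫ z in x..y, W z := by
  have key : ∀ {x y}, 0 ≤ x → x ≤ y → V y - V x = ∫ z in x..y, W z := by
    intro x y hx hxy
    have hs : Icc x y ⊆ Ici 0 := Icc_subset_Ici_self.trans (Ici_subset_Ici.2 hx)
    refine (intervalIntegral.integral_eq_sub_of_hasDeriv_right_of_le hxy
      ((continuousOn_Ici h).mono hs) (fun z hz => ?_) ?_).symm
    · have hz0 : 0 < z := hx.trans_lt hz.1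
      exact ((hasDerivWithinAt_Ici h hz0.le).hasDerivAt (Ici_mem_nhds hz0)).hasDerivWithinAt
    · exact ((continuousOn_Ici' h).mono (by rw [uIcc_of_le hxy]; exact hs)).intervalIntegrable
  rcases le_total x y with hxy | hxy
  · exact key hx hxy
  · rw [intervalIntegral.integral_symm, ← key hy hxy]; ring

end IsSolOn

/-! ### Tools for the convergence of integrals and for convergence in `C²_loc` -/

lemma memLp_two_of_integrableOn_sq {F : ℝ → ℝ} {S : Set ℝ} (hS : MeasurableSet S)
    (hF : ContinuousOn F S) (h : IntegrableOn (fun y => F y ^ 2) S) :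
    MemLp F 2 (volume.restrict S) :=
  (memLp_two_iff_integrable_sq (hF.aestronglyMeasurable hS)).2 h

/-- Bounded convergence for powers, on bounded sets cut by variable intervals. -/
lemma tendsto_integral_rpow_inter_Ioo {M q α β : ℝ} (hq : 0 < q) {f : ℕ → ℝ → ℝ} {V : ℝ → ℝ}
    {T : Set ℝ} {a b : ℕ → ℝ} (hT : MeasurableSet T) (hTf : volume T ≠ ⊤)
    (hc : ∀ᶠ n in atTop, ContinuousOn (f n) T) (hM : ∀ᶠ n in atTop, ∀ y ∈ T, f n y ∈ Icc 0 M)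
    (hf : ∀ y ∈ T, Tendsto (fun n => f n y) atTop (𝓝 (V y)))
    (ha : Tendsto a atTop (𝓝 α)) (hb : Tendsto b atTop (𝓝 β)) :
    Tendsto (fun n => ∫ y in T ∩ Ioo (a n) (b n), f n y ^ q) atTop
      (𝓝 (∫ y in T ∩ Ioo α β, V y ^ q)) := by
  have hconv : ∀ (g : ℝ → ℝ) (s t : ℝ), ∫ y in T ∩ Ioo s t, g y =
      ∫ y in T, (Ioo s t).indicator g y := fun g s t => (setIntegral_indicator measurableSet_Ioo).symm
  simp only [hconv]
  refine tendsto_integral_filter_of_dominated_convergence (fun _ => M ^ q) ?_ ?_ ?_ ?_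
  · filter_upwards [hc] with n hn
    exact ((hn.rpow_const fun _ _ => Or.inr hq.le).aestronglyMeasurable hT).indicator
      measurableSet_Ioo
  · filter_upwards [hM] with n hn
    refine (ae_restrict_iff' hT).2 (ae_of_all _ fun y hy => ?_)
    have h1 := hn y hy
    have h2 : (0 : ℝ) ≤ f n y ^ q := Real.rpow_nonneg h1.1 _
    have h3 : f n y ^ q ≤ M ^ q := Real.rpow_le_rpow h1.1 h1.2 hq.le
    by_cases hy' : y ∈ Ioo (a n) (b n)
    · rw [indicator_of_mem hy', Real.norm_of_nonneg h2]; exact h3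
    · rw [indicator_of_notMem hy', norm_zero]; exact h2.trans h3
  · exact integrableOn_const (hs := hTf)
  -- Away from the two limiting endpoints, membership in the moving interval is eventually constant.
  · have hne : ∀ᵐ y ∂(volume.restrict T), y ≠ α ∧ y ≠ β := by
      refine ae_restrict_of_ae ?_
      have h1 : ∀ c : ℝ, ∀ᵐ y ∂(volume : Measure ℝ), y ≠ c := fun c =>
        compl_mem_ae_iff.2 (measure_singleton c)
      exact (h1 α).and (h1 β)
    filter_upwards [hne, (ae_restrict_iff' hT).2 (ae_of_all _ hf)] with y hy hy'
    by_cases hyI : y ∈ Ioo α β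
    · rw [indicator_of_mem hyI]
      refine (hy'.rpow_const (Or.inr hq.le)).congr' ?_
      filter_upwards [ha.eventually (gt_mem_nhds hyI.1), hb.eventually (lt_mem_nhds hyI.2)]
        with n h1 h2
      rw [indicator_of_mem (show y ∈ Ioo (a n) (b n) from ⟨h1, h2⟩)]
    · rw [indicator_of_notMem hyI]
      refine tendsto_const_nhds.congr' ?_
      rcases lt_or_gt_of_ne hy.1 with h | h
      · filter_upwards [ha.eventually (lt_mem_nhds h)] with n hn
        rw [indicator_of_notMem fun h' => lt_asymm hn h'.1]
      · have hβ : β < y := lt_of_le_of_ne (not_lt.1 fun h' => hyI ⟨h, h'⟩) hy.2.symm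
        filter_upwards [hb.eventually (gt_mem_nhds hβ)] with n hn
        rw [indicator_of_notMem fun h' => lt_asymm hn h'.2]

/-- Convergence in `C²_loc` from the uniform convergence of the functions and of their first and second
derivatives. -/
lemma tendstoC2Loc_of_tendstoUniformlyOn {S : Set ℝ} (hS : UniqueDiffOn ℝ S)
    (hSI : ∀ a > 0, UniqueDiffOn ℝ (S ∩ Icc (-a) a)) {D : ℕ → Set ℝ} {v v₁ v₂ : ℕ → ℝ → ℝ}
    {V V₁ V₂ : ℝ → ℝ}
    (hD : ∀ a > 0, ∀ᶠ n in atTop, S ∩ Icc (-a) a ⊆ D n)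
    (h1 : ∀ a > 0, ∀ᶠ n in atTop, ∀ y ∈ S ∩ Icc (-a) a, HasDerivWithinAt (v n) (v₁ n y) S y)
    (h2 : ∀ a > 0, ∀ᶠ n in atTop, ∀ y ∈ S ∩ Icc (-a) a, HasDerivWithinAt (v₁ n) (v₂ n y) S y)
    (h3 : ∀ a > 0, ∀ᶠ n in atTop, ContinuousOn (v₂ n) (S ∩ Icc (-a) a))
    (H1 : ∀ y ∈ S, HasDerivWithinAt V (V₁ y) S y) (H2 : ∀ y ∈ S, HasDerivWithinAt V₁ (V₂ y) S y)
    (H3 : ContinuousOn V₂ S)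
    (u0 : ∀ a > 0, TendstoUniformlyOn v V atTop (S ∩ Icc (-a) a))
    (u1 : ∀ a > 0, TendstoUniformlyOn v₁ V₁ atTop (S ∩ Icc (-a) a))
    (u2 : ∀ a > 0, TendstoUniformlyOn v₂ V₂ atTop (S ∩ Icc (-a) a)) :
    TendstoC2Loc S D v V := by
  have cd : ∀ {T : Set ℝ} {f f₁ f₂ : ℝ → ℝ}, UniqueDiffOn ℝ T →
      (∀ y ∈ T, HasDerivWithinAt f (f₁ y) T y) → (∀ y ∈ T, HasDerivWithinAt f₁ (f₂ y) T y) →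
      ContinuousOn f₂ T → ContDiffOn ℝ 2 f T := by
    intro T f f₁ f₂ hT hf hf₁ hf₂
    have e1 : EqOn (derivWithin f T) f₁ T := fun y hy => (hf y hy).derivWithin (hT y hy)
    have e2 : EqOn (derivWithin f₁ T) f₂ T := fun y hy => (hf₁ y hy).derivWithin (hT y hy)
    have c1 : ContDiffOn ℝ 1 f₁ T := by
      rw [show (1 : WithTop ℕ∞) = 0 + 1 from rfl, contDiffOn_succ_iff_derivWithin hT]
      exact ⟨fun y hy => (hf₁ y hy).differentiableWithinAt, by simp,
        contDiffOn_zero.2 (hf₂.congr e2)⟩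
    rw [show (2 : WithTop ℕ∞) = 1 + 1 from rfl, contDiffOn_succ_iff_derivWithin hT]
    exact ⟨fun y hy => (hf y hy).differentiableWithinAt, by simp, c1.congr e1⟩
  refine ⟨cd hS H1 H2 H3, fun a ha => ⟨?_, fun k hk => ?_⟩⟩
  · filter_upwards [hD a ha, h1 a ha, h2 a ha, h3 a ha] with n e0 e1 e2 e3
    exact ⟨e0, cd (hSI a ha) (fun y hy => (e1 y hy).mono inter_subset_left)
      (fun y hy => (e2 y hy).mono inter_subset_left) e3⟩
  · have E1 : EqOn (iteratedDerivWithin 1 V S) V₁ S := fun y hy => by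
      rw [iteratedDerivWithin_one]; exact (H1 y hy).derivWithin (hS y hy)
    have E2 : EqOn (iteratedDerivWithin 2 V S) V₂ S := fun y hy => by
      rw [iteratedDerivWithin_succ]
      exact (H2 y hy |>.congr (fun z hz => E1 hz) (E1 hy)).derivWithin (hS y hy)
    have e1 : ∀ᶠ n in atTop, EqOn (iteratedDerivWithin 1 (v n) S) (v₁ n) (S ∩ Icc (-a) a) := by
      filter_upwards [h1 a ha] with n hn y hy
      rw [iteratedDerivWithin_one]; exact (hn y hy).derivWithin (hS y hy.1)
    have e2 : ∀ᶠ n in atTop, EqOn (iteratedDerivWithin 2 (v n) S) (v₂ n) (S ∩ Icc (-a) a) := by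
      -- The larger interval is needed since the second derivative at `y` requires the formula for
      -- the first derivative in a neighbourhood of `y`, also when `y` is an endpoint of `[-a, a]`.
      filter_upwards [h1 (a + 1) (by linarith), h2 a ha] with n hn hn' y hy
      rw [iteratedDerivWithin_succ]
      refine ((hn' y hy).congr_of_eventuallyEq ?_ ?_).derivWithin (hS y hy.1)
      · filter_upwards [inter_mem_nhdsWithin S (Icc_mem_nhds (show -(a + 1) < y by linarith [hy.2.1])
          (show y < a + 1 by linarith [hy.2.2]))] with z hz
        rw [iteratedDerivWithin_one]
        exact (hn z hz).derivWithin (hS z hz.1)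
      · rw [iteratedDerivWithin_one]
        exact (hn y ⟨hy.1, by linarith [hy.2.1], by linarith [hy.2.2]⟩).derivWithin (hS y hy.1)
    interval_cases k
    · simpa using u0 a ha
    · exact ((u1 a ha).congr (e1.mono fun n h => h.symm)).congr_right
        fun y hy => (E1 hy.1).symm
    · exact ((u2 a ha).congr (e2.mono fun n h => h.symm)).congr_right
        fun y hy => (E2 hy.1).symm

end MetricGraph

/-! ### Solutions on stars: limits, Liouville property, positivity, negative directions -/

namespace MetricGraph

/-- Sequences of solutions on the half-lines of a star, with a common maximum at a point of the branch
`i₁` with bounded coordinate, converge along a subsequence to a solution on the infinite star. -/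
lemma exists_star_limit {ι : Type*} [Fintype ι] {p M m B a₀ : ℝ} (hp : 2 < p) {a ρ L z : ℕ → ℝ}
    {f g : ι → ℕ → ℝ → ℝ} (i₁ : ι) (hL : Tendsto L atTop atTop)
    (hsol : ∀ i n, IsSolOn p (a n) (ρ n) (L n) (f i n) (g i n))
    (ha : Tendsto a atTop (𝓝 a₀)) (hρ : Tendsto ρ atTop (𝓝 1))
    (hz : ∀ n, z n ∈ Icc 0 B)
    (hmax : ∀ i n, ∀ y ∈ Icc 0 (L n), f i n y ≤ f i₁ n (z n)) (hM : ∀ n, f i₁ n (z n) ≤ M)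
    (hm : Tendsto (fun n => f i₁ n (z n)) atTop (𝓝 m))
    (h0 : ∀ i j n, f i n 0 = f j n 0) (hK : ∀ n, ∑ i, g i n 0 = 0) :
    ∃ σ : ℕ → ℕ, StrictMono σ ∧ ∃ (z₀ : ℝ) (V W : ι → ℝ → ℝ), 0 ≤ z₀ ∧
      Tendsto (fun n => z (σ n)) atTop (𝓝 z₀) ∧
      (∀ i b, TendstoUniformlyOn (fun n => f i (σ n)) (V i) atTop (Icc 0 b)) ∧
      (∀ i b, TendstoUniformlyOn (fun n => g i (σ n)) (W i) atTop (Icc 0 b)) ∧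
      (∀ i b, IsSolOn p a₀ 1 b (V i) (W i)) ∧ (∀ i y, 0 ≤ y → V i y ≤ m) ∧
      (∀ i j, V i 0 = V j 0) ∧ ∑ i, W i 0 = 0 ∧ V i₁ z₀ = m := by
  set A := |a₀| + 2 with hA
  set G := M + (A * M + A * M ^ (p - 1)) with hG
  have ha' : ∀ᶠ n in atTop, |a n| ≤ A :=
    (ha.abs.eventually (gt_mem_nhds (show |a₀| < A by linarith))).mono fun _ h => h.le
  have hρ' : ∀ᶠ n in atTop, |ρ n| ≤ A :=
    (hρ.abs.eventually (gt_mem_nhds (show |(1 : ℝ)| < A by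
      have := abs_nonneg a₀; rw [abs_one]; linarith))).mono fun _ h => h.le
  -- The position of the maximum and the values and slopes at the centre stay in a compact box;
  -- finitely many convergent numbers are all that is needed to extract a limit.
  have hbd : ∀ᶠ n in atTop, (z n, (fun i => f i n 0), fun i => g i n 0) ∈
      Icc 0 B ×ˢ (univ.pi fun _ : ι => Icc 0 M) ×ˢ (univ.pi fun _ : ι => Icc (-G) G) := by
    filter_upwards [ha', hρ', hL.eventually_ge_atTop 1] with n h1 h2 h3
    have hn0 : (0 : ℝ) ∈ Icc 0 (L n) := ⟨le_rfl, by linarith⟩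
    refine ⟨hz n, fun i _ => ⟨(hsol i n).nonneg 0 hn0, (hmax i n 0 hn0).trans (hM n)⟩,
      fun i _ => abs_le.1 ?_⟩
    exact (hsol i n).abs_deriv_le hp (fun y hy => (hmax i n y hy).trans (hM n)) h1 h2 le_rfl
      (by linarith)
  have hcpt : IsCompact (Icc 0 B ×ˢ (univ.pi fun _ : ι => Icc 0 M) ×ˢ
      (univ.pi fun _ : ι => Icc (-G) G)) :=
    isCompact_Icc.prod ((isCompact_univ_pi fun _ => isCompact_Icc).prod
      (isCompact_univ_pi fun _ => isCompact_Icc))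
  obtain ⟨⟨z₀, α, β⟩, hmem, σ, hσ, hlim⟩ := hcpt.tendsto_subseq' hbd.frequently
  have hσt := hσ.tendsto_atTop
  have hzl : Tendsto (fun n => z (σ n)) atTop (𝓝 z₀) := (continuous_fst.tendsto _).comp hlim
  have hαl : ∀ i, Tendsto (fun n => f i (σ n) 0) atTop (𝓝 (α i)) := fun i =>
    (((continuous_apply i).comp (continuous_fst.comp continuous_snd)).tendsto _).comp hlim
  have hβl : ∀ i, Tendsto (fun n => g i (σ n) 0) atTop (𝓝 (β i)) := fun i =>
    (((continuous_apply i).comp (continuous_snd.comp continuous_snd)).tendsto _).comp hlim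
  choose V W hV hW hVW hVM using fun i => exists_limit_of_isSolOn hp (hL.comp hσt)
    (fun n => hsol i (σ n)) (fun n y hy => (hmax i (σ n) y hy).trans (hM (σ n))) (ha.comp hσt)
    (hρ.comp hσt) (hαl i) (hβl i)
  have hpt : ∀ i y, 0 ≤ y → Tendsto (fun n => f i (σ n) y) atTop (𝓝 (V i y)) := fun i y hy =>
    (hV i y).tendsto_at ⟨hy, le_rfl⟩
  have hpt' : ∀ i, Tendsto (fun n => g i (σ n) 0) atTop (𝓝 (W i 0)) := fun i =>
    (hW i 0).tendsto_at ⟨le_rfl, le_rfl⟩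
  have hz₀ : 0 ≤ z₀ := hmem.1.1
  refine ⟨σ, hσ, z₀, V, W, hz₀, hzl, hV, hW, hVW, fun i y hy => ?_, fun i j => ?_, ?_, ?_⟩
  · refine le_of_tendsto_of_tendsto (hpt i y hy) (hm.comp hσt) ?_
    filter_upwards [(hL.comp hσt).eventually_ge_atTop y] with n hn using hmax i (σ n) y ⟨hy, hn⟩
  · exact tendsto_nhds_unique (hpt i 0 le_rfl) ((hpt j 0 le_rfl).congr fun n => h0 j i (σ n))
  · refine tendsto_nhds_unique (tendsto_finsetSum _ fun i _ => hpt' i) ?_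
    simp [hK]
  · refine tendsto_nhds_unique ?_ (hm.comp hσt)
    have hzI : z₀ ∈ Icc 0 B := hmem.1
    -- The maximum is taken at moving points `z (σ n)`; uniform convergence and continuity of the
    -- limit give convergence of these values to `V i₁ z₀`.
    refine TendstoLocallyUniformlyOn.tendsto_comp (s := Icc 0 B)
      (hV i₁ B).tendstoLocallyUniformlyOn ((hVW i₁ B).continuousOn z₀ hzI) hzI ?_
    exact tendsto_nhdsWithin_iff.2 ⟨hzl, Eventually.of_forall fun n => hz _⟩

section star

variable {ι : Type*} [Fintype ι] {p M : ℝ} {V W : ι → ℝ → ℝ}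

/-- There is no bounded positive solution of `V'' = - V ^ (p - 1)` on a star graph. -/
lemma star_eq_zero (hp : 2 < p) (h : ∀ i b, IsSolOn p 0 1 b (V i) (W i)) (hK : ∑ i, W i 0 = 0)
    (i : ι) {y : ℝ} (hy : 0 ≤ y) : V i y = 0 := by
  -- With zero linear coefficient every branch is nondecreasing; nonnegative outward slopes with sum
  -- zero all vanish.
  have hW : ∀ i ∈ Finset.univ, 0 ≤ W i 0 := fun i _ =>
    IsSolOn.deriv_nonneg zero_le_one (h i) le_rfl
  exact IsSolOn.eq_zero_of_deriv_zero hp one_pos (h i)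
    ((Finset.sum_eq_zero_iff_of_nonneg hW).1 hK i (Finset.mem_univ i)) hy

/-- If the value at the centre were 0, all outward slopes would be nonnegative, hence 0 by
Kirchhoff, and uniqueness would annihilate the branch `i₁`. A zero elsewhere has zero slope, so
uniqueness annihilates its branch and with it the value at the centre. -/
lemma star_pos {a : ℝ} (hp : 2 < p) (h : ∀ i b, IsSolOn p a 1 b (V i) (W i))
    (hM : ∀ i y, 0 ≤ y → V i y ≤ M) (h0 : ∀ i j, V i 0 = V j 0) (hK : ∑ i, W i 0 = 0)
    {i₁ : ι} {z : ℝ} (hz : 0 ≤ z) (hVz : 0 < V i₁ z) (i : ι) {y : ℝ} (hy : 0 ≤ y) : 0 < V i y := by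
  have hnn : ∀ j x, 0 ≤ x → 0 ≤ V j x := fun j x hx => IsSolOn.nonneg_Ici (h j) hx
  have hv : 0 < V i₁ 0 := by
    refine (hnn i₁ 0 le_rfl).lt_of_ne fun he => ?_
    have hW : ∀ j ∈ Finset.univ, 0 ≤ W j 0 := by
      intro j _
      by_contra! hneg
      have hev := ((h j 1).continuousOn' 0 ⟨le_rfl, zero_le_one⟩).eventually (gt_mem_nhds hneg)
      rw [nhdsWithin_Icc_eq_nhdsGE one_pos] at hev
      obtain ⟨d, hd, hd'⟩ := mem_nhdsGE_iff_exists_Icc_subset.1 hev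
      have hlt := strictAntiOn_of_deriv_neg (convex_Icc 0 d)
        ((IsSolOn.continuousOn_Ici (h j)).mono Icc_subset_Ici_self) (fun x hx => by
          rw [interior_Icc] at hx
          rw [((IsSolOn.hasDerivWithinAt_Ici (h j) hx.1.le).hasDerivAt (Ici_mem_nhds hx.1)).deriv]
          exact hd' (Ioo_subset_Icc_self hx)) (left_mem_Icc.2 (le_of_lt hd))
          (right_mem_Icc.2 (le_of_lt hd)) hd
      have := hnn j d (le_of_lt hd)
      rw [h0 j i₁, ← he] at hlt
      linarith
    have hW0 := (Finset.sum_eq_zero_iff_of_nonneg hW).1 hK i₁ (Finset.mem_univ _)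
    have := IsSolOn.eq_zero_of_eq_zero hp (h i₁) (hM i₁) le_rfl he.symm hW0 hz
    linarith
  refine (hnn i y hy).lt_of_ne fun he => ?_
  rcases hy.eq_or_lt with rfl | hy'
  · rw [h0 i i₁] at he; linarith
  · have := IsSolOn.eq_zero_of_eq_zero hp (h i) (hM i) hy he.symm
      (IsSolOn.deriv_eq_zero_of_eq_zero (h i) hy' he.symm) le_rfl
    rw [h0 i i₁] at this
    linarith

/-- At a maximum at the centre all outward slopes are nonpositive with sum zero, so each is 0; the
second derivative is then nonpositive. It serves vertices and, with two branches, interior points of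
edges. -/
lemma star_max_le {a ρ L : ℝ} {f g : ι → ℝ → ℝ} (hp : 2 < p) (hL : 0 < L)
    (h : ∀ i, IsSolOn p a ρ L (f i) (g i)) (hmax : ∀ i, ∀ y ∈ Icc 0 L, f i y ≤ f i 0)
    (hK : ∑ i, g i 0 = 0) (i : ι) : a * f i 0 ≤ ρ * f i 0 ^ (p - 1) := by
  have hg : ∀ i ∈ Finset.univ, g i 0 ≤ 0 := fun i _ =>
    (h i).deriv_zero_nonpos_of_le hL (hmax i)
  have := (h i).deriv2_zero_nonpos_of_le hL (hmax i)
    ((Finset.sum_eq_zero_iff_of_nonpos hg).1 hK i (Finset.mem_univ i)) hp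
  linarith

/-- The quadratic form is negative at the product of the solution with a wide cutoff function. -/
lemma exists_sum_integral_cutoff_neg (hp : 2 < p) {ρ L : ℕ → ℝ} {f : ι → ℕ → ℝ → ℝ}
    (i₁ : ι) (hL : Tendsto L atTop atTop) (hρ : Tendsto ρ atTop (𝓝 1))
    (hc : ∀ i n, ContinuousOn (f i n) (Icc 0 (L n)))
    (hM : ∀ i n, ∀ y ∈ Icc 0 (L n), f i n y ∈ Icc 0 M) (hV : ∀ y, 0 ≤ y → V i₁ y ∈ Ioc 0 M)
    (hf : ∀ b, TendstoUniformlyOn (f i₁) (V i₁) atTop (Icc 0 b)) :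
    ∃ R : ℝ, 0 < R ∧ ∀ᶠ n in atTop, ∑ i, ∫ y in (0 : ℝ)..(2 * R),
      (f i n y ^ 2 * deriv (cutoff (-(2 * R)) (2 * R) R) y ^ 2
        - (p - 2) * ρ n * (f i n y ^ p * cutoff (-(2 * R)) (2 * R) R y ^ 2)) < 0 := by
  have hVc : ContinuousOn (fun y => V i₁ y ^ p) (Icc 0 1) :=
    ((hf 1).continuousOn ((hL.eventually_ge_atTop 1).mono fun n hn =>
      (hc i₁ n).mono (Icc_subset_Icc_right hn)).frequently).rpow_const
      fun _ _ => Or.inr (by linarith)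
  set c := ∫ y in (0 : ℝ)..1, V i₁ y ^ p with hcdef
  have hcpos : 0 < c := intervalIntegral.intervalIntegral_pos_of_pos_on
    ((hVc.mono (by rw [uIcc_of_le zero_le_one])).intervalIntegrable)
    (fun y hy => Real.rpow_pos_of_pos (hV y hy.1.le).1 _) one_pos
  -- The mass of the limit on the unit interval of the branch `i₁` is the fixed gain to be set
  -- against the gradient cost.
  have hconv : ∀ᶠ n in atTop, c / 2 < ∫ y in (0 : ℝ)..1, f i₁ n y ^ p := by
    refine Tendsto.eventually_const_lt (show c / 2 < c by linarith)
      (TendstoUniformlyOn.tendsto_intervalIntegral_of_continuousOn ?_ ?_)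
    all_goals rw [uIcc_of_le zero_le_one]
    · filter_upwards [hL.eventually_ge_atTop 1] with n hn
      exact ((hc i₁ n).mono (Icc_subset_Icc_right hn)).rpow_const
        fun _ _ => Or.inr (by linarith)
    · refine tendstoUniformlyOn_rpow (M := M) (by linarith) (hf 1) ?_
        fun y hy => Ioc_subset_Icc_self (hV y hy.1)
      filter_upwards [hL.eventually_ge_atTop 1] with n hn y hy
      exact hM i₁ n y ⟨hy.1, hy.2.trans hn⟩
  set N : ℝ := (Fintype.card ι : ℝ) * (8 * transitionBound ^ 2 * M ^ 2) with hN
  have hN0 : 0 ≤ N := by positivity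
  have hd : 0 < (p - 2) * (1 / 2) * (c / 2) := by
    have : 0 < p - 2 := by linarith
    positivity
  -- The derivative of the cutoff is `O(1/R)` on an interval of length `2 * R`, so all branches
  -- together cost at most `N / R`; this `R` makes that smaller than the gain. Also `R ≥ 1`, so the
  -- cutoff is 1 where the mass `c / 2` was found.
  set R : ℝ := N / ((p - 2) * (1 / 2) * (c / 2)) + 1 with hR
  have hR1 : 1 ≤ R := by
    have : 0 ≤ N / ((p - 2) * (1 / 2) * (c / 2)) := by positivity
    linarith
  have hR0 : 0 < R := by linarith
  have hNR : N / R < (p - 2) * (1 / 2) * (c / 2) := by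
    rw [div_lt_iff₀ hR0, hR, mul_add, mul_div_cancel₀ _ hd.ne']
    linarith
  refine ⟨R, hR0, ?_⟩
  filter_upwards [hconv, hρ.eventually (lt_mem_nhds (show (1 / 2 : ℝ) < 1 by norm_num)),
    hL.eventually_ge_atTop (2 * R)] with n h1 h2 h3
  set χ := cutoff (-(2 * R)) (2 * R) R with hχ
  have hsub : Icc 0 (2 * R) ⊆ Icc 0 (L n) := Icc_subset_Icc_right h3
  have hc1 : ∀ i, ContinuousOn (fun y => f i n y ^ 2 * deriv χ y ^ 2) (Icc 0 (2 * R)) := fun i =>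
    (((hc i n).mono hsub).pow 2).mul (continuous_deriv_cutoff.continuousOn.pow 2)
  have hc2 : ∀ i, ContinuousOn (fun y => f i n y ^ p * χ y ^ 2) (Icc 0 (2 * R)) := fun i =>
    (((hc i n).mono hsub).rpow_const fun _ _ => Or.inr (by linarith)).mul
      (cutoff_contDiff.continuous.continuousOn.pow 2)
  have ii : ∀ {F : ℝ → ℝ}, ContinuousOn F (Icc 0 (2 * R)) →
      IntervalIntegrable F volume 0 (2 * R) := fun hF =>
    (hF.mono (by rw [uIcc_of_le (by linarith)])).intervalIntegrable
  have I1 : ∀ i, ∫ y in (0 : ℝ)..(2 * R), f i n y ^ 2 * deriv χ y ^ 2 ≤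
      8 * transitionBound ^ 2 * M ^ 2 / R := by
    intro i
    have := intervalIntegral.integral_mono_on (a := 0) (b := 2 * R) (by linarith)
      (ii (hc1 i)) (intervalIntegrable_const (μ := volume)
        (c := M ^ 2 * (4 * transitionBound ^ 2 / R ^ 2))) fun y hy => by
        have e1 := sq_deriv_cutoff_le (a := -(2 * R)) (b := 2 * R) (y := y) hR0
        have e2 : f i n y ^ 2 ≤ M ^ 2 :=
          pow_le_pow_left₀ (hM i n y (hsub hy)).1 (hM i n y (hsub hy)).2 2
        gcongr
    refine this.trans (le_of_eq ?_)
    rw [intervalIntegral.integral_const, smul_eq_mul]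
    field_simp
    ring
  have I2 : ∀ i, 0 ≤ ∫ y in (0 : ℝ)..(2 * R), f i n y ^ p * χ y ^ 2 := fun i =>
    intervalIntegral.integral_nonneg (by linarith) fun y hy =>
      mul_nonneg (Real.rpow_nonneg (hM i n y (hsub hy)).1 _) (sq_nonneg _)
  have I3 : c / 2 ≤ ∫ y in (0 : ℝ)..(2 * R), f i₁ n y ^ p * χ y ^ 2 := by
    have e : ∫ y in (0 : ℝ)..1, f i₁ n y ^ p = ∫ y in (0 : ℝ)..1, f i₁ n y ^ p * χ y ^ 2 := by
      refine intervalIntegral.integral_congr fun y hy => ?_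
      rw [uIcc_of_le zero_le_one] at hy
      simp [hχ, cutoff_eq_one hR0 (show y ∈ Icc (-(2 * R) + R) (2 * R - R) from
        ⟨by linarith [hy.1], by linarith [hy.2]⟩)]
    refine h1.le.trans (e.trans_le ?_)
    refine intervalIntegral.integral_mono_interval le_rfl zero_le_one (by linarith) ?_ (ii (hc2 i₁))
    exact (ae_restrict_iff' measurableSet_Ioc).2 (ae_of_all _ fun y hy =>
      mul_nonneg (Real.rpow_nonneg (hM i₁ n y (hsub (Ioc_subset_Icc_self hy))).1 _) (sq_nonneg _))
  have e : ∀ i, ∫ y in (0 : ℝ)..(2 * R), (f i n y ^ 2 * deriv χ y ^ 2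
      - (p - 2) * ρ n * (f i n y ^ p * χ y ^ 2)) =
      (∫ y in (0 : ℝ)..(2 * R), f i n y ^ 2 * deriv χ y ^ 2) -
        (p - 2) * ρ n * ∫ y in (0 : ℝ)..(2 * R), f i n y ^ p * χ y ^ 2 := fun i => by
    rw [intervalIntegral.integral_sub (ii (hc1 i)) ((ii (hc2 i)).const_mul _),
      intervalIntegral.integral_const_mul]
  simp only [e]
  rw [Finset.sum_sub_distrib, ← Finset.mul_sum]
  have S1 : ∑ i, ∫ y in (0 : ℝ)..(2 * R), f i n y ^ 2 * deriv χ y ^ 2 ≤ N / R := by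
    refine (Finset.sum_le_sum fun i _ => I1 i).trans (le_of_eq ?_)
    rw [Finset.sum_const, Finset.card_univ, nsmul_eq_mul, hN]
    ring
  have S2 : c / 2 ≤ ∑ i, ∫ y in (0 : ℝ)..(2 * R), f i n y ^ p * χ y ^ 2 :=
    I3.trans (Finset.single_le_sum (f := fun i => ∫ y in (0 : ℝ)..(2 * R), f i n y ^ p * χ y ^ 2)
      (fun i _ => I2 i) (Finset.mem_univ i₁))
  have S3 : (p - 2) * (1 / 2) * (c / 2) ≤
      (p - 2) * ρ n * ∑ i, ∫ y in (0 : ℝ)..(2 * R), f i n y ^ p * χ y ^ 2 := by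
    have : 0 ≤ p - 2 := by linarith
    gcongr
  linarith

end star

end MetricGraph

/-! ### Distance, balls and integrals of a metric graph in edge coordinates -/

namespace MetricGraph

variable {V E : Type*} {G : MetricGraph V E}

/-! ### The distance -/

/-- A function that is `K`-Lipschitz on every edge is `K`-Lipschitz on the graph. -/
lemma abs_sub_le_mul_dist {f : G.Point → ℝ} {K : ℝ} (hK : 0 ≤ K)
    (h : ∀ e, ∀ s ∈ G.I e, ∀ t ∈ G.I e, |f (G.pt e s) - f (G.pt e t)| ≤ K * |s - t|)
    (x y : G.Point) : |f x - f y| ≤ K * dist x y := by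
  have key : ∀ {y r}, G.PathLen x y r → |f x - f y| ≤ K * r := by
    intro y r hr
    induction hr with
    | nil => simp
    | @cons e s t r hs ht _ ih =>
      have h1 := h e s hs t ht
      calc |f x - f (G.pt e t)| ≤ |f x - f (G.pt e s)| + |f (G.pt e s) - f (G.pt e t)| :=
            abs_sub_le _ _ _
        _ ≤ K * (r + |s - t|) := by linarith
  rcases hK.eq_or_lt with rfl | hK
  · obtain ⟨r, hr⟩ := exists_pathLen x y
    simpa using key hr
  · rw [← div_le_iff₀' hK]
    exact le_csInf (exists_pathLen x y) fun r hr => (div_le_iff₀' hK).2 (key hr)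

lemma dist_pt_le {e : E} {s t : ℝ} (hs : s ∈ G.I e) (ht : t ∈ G.I e) :
    dist (G.pt e s) (G.pt e t) ≤ |s - t| :=
  csInf_le (bddBelow_pathLen _ _) (PathLen.step hs ht)

lemma continuousOn_pt (e : E) : ContinuousOn (G.pt e) (G.I e) := by
  refine LipschitzOnWith.continuousOn (K := 1) (LipschitzOnWith.of_dist_le_mul fun s hs t ht => ?_)
  rw [NNReal.coe_one, one_mul, Real.dist_eq]
  exact dist_pt_le hs ht

lemma I_eq_Ici {e : E} (h : G.len e = ⊤) : G.I e = Ici 0 := by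
  ext x; simp [I, h]

lemma I_eq_Icc {e : E} (h : G.len e ≠ ⊤) : G.I e = Icc 0 (G.len e).toReal := by
  ext x; exact and_congr_right fun _ => ENNReal.ofReal_le_iff_le_toReal h

lemma len_toReal_pos {e : E} (h : G.len e ≠ ⊤) : 0 < (G.len e).toReal :=
  ENNReal.toReal_pos (G.len_pos e).ne' h

lemma isClosed_I (e : E) : IsClosed (G.I e) := by
  by_cases h : G.len e = ⊤
  · rw [I_eq_Ici h]; exact isClosed_Ici
  · rw [I_eq_Icc h]; exact isClosed_Icc

lemma uniqueDiffOn_I (e : E) : UniqueDiffOn ℝ (G.I e) := by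
  by_cases h : G.len e = ⊤
  · rw [I_eq_Ici h]; exact uniqueDiffOn_Ici 0
  · rw [I_eq_Icc h]; exact uniqueDiffOn_Icc (len_toReal_pos h)

lemma mem_I_of_le {e : E} {s t : ℝ} (hs : s ∈ G.I e) (h0 : 0 ≤ t) (h : t ≤ s) : t ∈ G.I e :=
  ⟨h0, (ENNReal.ofReal_le_ofReal h).trans hs.2⟩

/-- The function on `G` with the given values at the vertices and the given restrictions to the
edges. -/
def glue (G : MetricGraph V E) (c : V → ℝ) (ψ : E → ℝ → ℝ) : G.Point → ℝ
  | .vertex v => c v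
  | .interior e s _ _ => ψ e s

/-- Only the endpoints need an argument: there the point of the graph is a vertex, and the two
hypotheses say that the edge function agrees with the vertex value. -/
lemma glue_pt {c : V → ℝ} {ψ : E → ℝ → ℝ} {e : E} (h0 : ψ e 0 = c (G.src e))
    (h1 : ∀ h, ψ e (G.len e).toReal = c (G.tgt e h)) {s : ℝ} (hs : s ∈ G.I e) :
    G.glue c ψ (G.pt e s) = ψ e s := by
  rcases hs.1.eq_or_lt with rfl | hs0
  · rw [pt_zero, h0]; rfl
  · rcases hs.2.eq_or_lt with h | h
    · have ht : G.len e ≠ ⊤ := by rw [← h]; exact ENNReal.ofReal_ne_top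
      have : s = (G.len e).toReal := by rw [← h, ENNReal.toReal_ofReal hs0.le]
      rw [this, pt_len e ht, h1 ht]; rfl
    · rw [pt_interior e s hs0 h]; rfl

lemma abs_min_sub_min_le {a b c d r : ℝ} (h1 : |a - c| ≤ r) (h2 : |b - d| ≤ r) :
    |min a b - min c d| ≤ r :=
  (abs_min_sub_min_le_max a b c d).trans (max_le h1 h2)

lemma one_mul_abs_min_sub_min_le {a b c d r : ℝ} (h1 : |a - c| ≤ r) (h2 : |b - d| ≤ r) :
    |min a b - min c d| ≤ 1 * r := by
  rw [one_mul]; exact abs_min_sub_min_le h1 h2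

open Classical in
/-- The distance from the point with coordinate `s` on `e` to the nearest end of `e`. -/
noncomputable def depth (G : MetricGraph V E) (e : E) (s : ℝ) : ℝ :=
  if G.len e = ⊤ then s else min s ((G.len e).toReal - s)

lemma depth_le {e : E} {s : ℝ} : G.depth e s ≤ s := by
  unfold depth; split_ifs
  exacts [le_rfl, min_le_left _ _]

lemma depth_le_len_sub {e : E} {s : ℝ} (h : G.len e ≠ ⊤) : G.depth e s ≤ (G.len e).toReal - s := by
  rw [depth, if_neg h]; exact min_le_right _ _

lemma infDist_pt {e : E} {s : ℝ} (hs : s ∈ G.I e) :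
    Metric.infDist (G.pt e s) G.vertices = G.depth e s := by
  have hne : G.vertices.Nonempty := ⟨_, G.src e, rfl⟩
  apply le_antisymm
  · have h1 : Metric.infDist (G.pt e s) G.vertices ≤ s := by
      refine (Metric.infDist_le_dist_of_mem (y := G.pt e 0)
        (show G.pt e 0 ∈ Set.range _ from ⟨_, (pt_zero e).symm⟩)).trans ?_
      simpa [abs_of_nonneg hs.1] using dist_pt_le hs (zero_mem_I e)
    unfold depth
    split_ifs with h
    · exact h1
    · refine le_min h1 ((Metric.infDist_le_dist_of_mem
        (y := G.pt e (G.len e).toReal)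
        (show G.pt e (G.len e).toReal ∈ Set.range _ from ⟨_, (pt_len e h).symm⟩)).trans ?_)
      refine (dist_pt_le hs (len_mem_I e h)).trans (le_of_eq ?_)
      rw [abs_sub_comm, abs_of_nonneg]
      rw [I_eq_Icc h] at hs
      linarith [hs.2]
  · rw [Metric.le_infDist hne]
    rintro _ ⟨v, rfl⟩
    -- The lower bound for the distance: `depth` vanishes at the ends of every edge, so it glues to
    -- a function that is 1-Lipschitz on the graph and zero at all vertices.
    have hg : ∀ e, ∀ s ∈ G.I e, G.glue (fun _ => 0) G.depth (G.pt e s) = G.depth e s := by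
      intro e s hs
      refine glue_pt ?_ (fun h => ?_) hs
      · unfold depth; split_ifs
        · rfl
        · simp
      · simp [depth, h]
    have h := abs_sub_le_mul_dist (f := G.glue (fun _ => 0) G.depth) zero_le_one
      (fun e s hs t ht => by
        rw [hg e s hs, hg e t ht]
        unfold depth; split_ifs
        · simp
        · refine one_mul_abs_min_sub_min_le le_rfl ?_
          rw [abs_sub_comm]; exact le_of_eq (by ring_nf)) (G.pt e s) (.vertex v)
    rw [hg e s hs, one_mul] at h
    have h0 : G.glue (fun _ => 0) G.depth (.vertex v) = 0 := rfl
    rw [h0, sub_zero] at h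
    exact (le_abs_self _).trans h

/-- Balls that do not reach the vertices are intervals. -/
lemma pt_mem_ball_iff {e e' : E} {s t r : ℝ} (hs : s ∈ G.I e) (ht : t ∈ G.I e')
    (hr : r ≤ G.depth e s) : G.pt e' t ∈ Metric.ball (G.pt e s) r ↔ e' = e ∧ |t - s| < r := by
  classical
  constructor
  · intro hmem
    have hr0 : 0 < r := Metric.nonempty_ball.1 ⟨_, hmem⟩
    -- The distance to `s` along `e`, truncated at `r`, and the constant `r` off `e`. As `r ≤
    -- depth`, its value at the ends of `e` is `r`, so it glues to a 1-Lipschitz function, which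
    -- bounds the graph distance from below.
    set ψ : E → ℝ → ℝ := fun e' t => if e' = e then min r |t - s| else r with hψ
    have hg : ∀ e', ∀ t ∈ G.I e', G.glue (fun _ => r) ψ (G.pt e' t) = ψ e' t := by
      intro e' t ht
      refine glue_pt ?_ (fun h => ?_) ht
      · simp only [hψ]; split_ifs with h
        · rw [zero_sub, abs_neg, abs_of_nonneg hs.1, min_eq_left (hr.trans depth_le)]
        · rfl
      · simp only [hψ]; split_ifs with h'
        · subst h'
          exact min_eq_left ((hr.trans (depth_le_len_sub h)).trans (le_abs_self _))
        · rfl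
    have h := abs_sub_le_mul_dist (f := G.glue (fun _ => r) ψ) zero_le_one
      (fun e s' hs t ht => by
        rw [hg e s' hs, hg e t ht]
        simp only [hψ]; split_ifs
        · refine one_mul_abs_min_sub_min_le (by simp) ?_
          refine (abs_abs_sub_abs_le_abs_sub _ _).trans (le_of_eq (by ring_nf))
        · simp) (G.pt e' t) (G.pt e s)
    rw [hg e' t ht, hg e s hs, one_mul] at h
    have h0 : ψ e s = 0 := by simp [hψ, hr0.le]
    rw [h0, sub_zero] at h
    have h1 := ((le_abs_self _).trans h).trans_lt (Metric.mem_ball.1 hmem)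
    simp only [hψ] at h1
    split_ifs at h1 with h2
    · exact ⟨h2, by rcases min_lt_iff.1 h1 with h | h; exacts [absurd h (lt_irrefl _), h]⟩
    · exact absurd h1 (lt_irrefl _)
  · rintro ⟨rfl, h⟩
    exact Metric.mem_ball.2 ((dist_pt_le ht hs).trans_lt h)

/-! ### Ends of edges -/

namespace HalfEdge

/-- The change of coordinate between the edge and the edge seen from one of its ends. -/
noncomputable def coord : G.HalfEdge → ℝ → ℝ
  | .initial _, t => t
  | .terminal e _, t => (G.len e).toReal - t

lemma pt_eq (h : G.HalfEdge) (t : ℝ) : h.pt t = G.pt h.edge (h.coord t) := by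
  cases h <;> rfl

lemma coord_coord (h : G.HalfEdge) (t : ℝ) : h.coord (h.coord t) = t := by
  cases h <;> simp [coord]

lemma coord_mem_I {h : G.HalfEdge} {t : ℝ} (ht : t ∈ G.I h.edge) : h.coord t ∈ G.I h.edge := by
  cases h with
  | initial e => exact ht
  | terminal e hl =>
    simp only [edge, I_eq_Icc hl] at ht ⊢
    exact ⟨sub_nonneg.2 ht.2, by simpa [coord] using ht.1⟩

lemma pt_zero (h : G.HalfEdge) : h.pt 0 = .vertex h.base := by
  cases h with
  | initial e => exact MetricGraph.pt_zero e
  | terminal e hl => simp [HalfEdge.pt, pt_len e hl, base]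

/-- The sign in the change of coordinate. -/
noncomputable def sign : G.HalfEdge → ℝ
  | .initial _ => 1
  | .terminal _ _ => -1

lemma sign_sq (h : G.HalfEdge) : h.sign ^ 2 = 1 := by cases h <;> simp [sign]

lemma coord_eq (h : G.HalfEdge) (t : ℝ) : h.coord t = h.coord 0 + h.sign * t := by
  cases h <;> simp [coord, sign, sub_eq_add_neg]

lemma abs_coord_sub_coord (h : G.HalfEdge) (s t : ℝ) : |h.coord s - h.coord t| = |s - t| := by
  cases h
  · rfl
  · simp only [coord]; rw [abs_sub_comm]; ring_nf

lemma dist_pt_le {h : G.HalfEdge} {s t : ℝ} (hs : s ∈ G.I h.edge) (ht : t ∈ G.I h.edge) :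
    dist (h.pt s) (h.pt t) ≤ |s - t| := by
  rw [pt_eq, pt_eq, ← h.abs_coord_sub_coord]
  exact MetricGraph.dist_pt_le (coord_mem_I hs) (coord_mem_I ht)

/-- Ends of edges are the initial ends and the terminal ends of bounded edges. -/
def equivSum (G : MetricGraph V E) : E ⊕ {e // G.len e ≠ ⊤} ≃ G.HalfEdge where
  toFun x := Sum.elim .initial (fun e => .terminal e.1 e.2) x
  invFun h := match h with
    | .initial e => .inl e
    | .terminal e h => .inr ⟨e, h⟩
  left_inv := by rintro (e | e) <;> rfl
  right_inv := by rintro (e | ⟨e, h⟩) <;> rfl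

noncomputable instance [Finite E] : Fintype G.HalfEdge := Fintype.ofFinite _

open Classical in
lemma sum_eq [Fintype E] (F : G.HalfEdge → ℝ) :
    ∑ h, F h = ∑ e, (F (.initial e) + if h : G.len e ≠ ⊤ then F (.terminal e h) else 0) := by
  rw [← (equivSum G).sum_comp, Fintype.sum_sum_type, Finset.sum_add_distrib]
  congr 1
  rw [← Fintype.sum_subtype_add_sum_subtype (fun e => G.len e ≠ ⊤)]
  rw [Finset.sum_eq_zero (s := (Finset.univ : Finset {e // ¬ G.len e ≠ ⊤}))
    fun e _ => dif_neg e.2, add_zero]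
  exact Finset.sum_congr rfl fun e _ => by rw [dif_pos e.2]; rfl

lemma sum_ends [Fintype E] (w : V) (F : G.HalfEdge → ℝ) (hF : ∀ h : G.HalfEdge, h.base ≠ w → F h = 0) :
    ∑ h : G.Ends w, F h.1 = ∑ h, F h := by
  classical
  rw [← Finset.sum_filter_of_ne (s := Finset.univ) (p := fun h : G.HalfEdge => h.base = w)
    fun h _ hne => by_contra fun hb => hne (hF h hb)]
  exact (Finset.sum_subtype (p := fun h : G.HalfEdge => h.base = w) _ (by simp) F).symm

/-- A vertex without an edge end could be joined to no other vertex; since the graph is connected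
and has an edge, there is none. -/
lemma exists_base [Nonempty E] (v : V) : ∃ h : G.HalfEdge, h.base = v := by
  have key : ∀ a b, Relation.EqvGen (fun a b => ∃ e, ∃ h : G.len e ≠ ⊤, G.src e = a ∧ G.tgt e h = b)
      a b → a = b ∨ (∃ h : G.HalfEdge, h.base = a) ∧ ∃ h : G.HalfEdge, h.base = b := by
    intro a b hab
    induction hab with
    | rel a b h =>
      obtain ⟨e, h, h1, h2⟩ := h
      exact Or.inr ⟨⟨.initial e, h1⟩, ⟨.terminal e h, h2⟩⟩
    | refl a => exact Or.inl rfl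
    | symm a b _ ih => exact ih.imp Eq.symm And.symm
    | trans a b c _ _ ih ih' =>
      rcases ih with rfl | ih
      · exact ih'
      · rcases ih' with rfl | ih'
        exacts [Or.inr ih, Or.inr ⟨ih.1, ih'.2⟩]
  obtain ⟨e⟩ := ‹Nonempty E›
  rcases key v (G.src e) (G.connected _ _) with rfl | h
  exacts [⟨.initial e, rfl⟩, h.1]

end HalfEdge

/-! ### Balls near a vertex -/

open Classical in
/-- The distance, truncated at `r`, between the point at arclength `t` from the end `h` and the point
at arclength `y₀` from the end `h₀` (for points near the vertex of `h₀`). -/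
noncomputable def endDist (h₀ : G.HalfEdge) (y₀ r : ℝ) (h : G.HalfEdge) (t : ℝ) : ℝ :=
  min r (if h = h₀ then |t - y₀| else if h.base = h₀.base then t + y₀ else r)

section endDist

variable {h₀ h : G.HalfEdge} {y₀ r : ℝ}

lemma endDist_le {t : ℝ} : endDist h₀ y₀ r h t ≤ r := min_le_left _ _

lemma abs_endDist_sub_le (s t : ℝ) : |endDist h₀ y₀ r h s - endDist h₀ y₀ r h t| ≤ |s - t| := by
  unfold endDist
  refine abs_min_sub_min_le (by simp) ?_
  split_ifs
  · exact (abs_abs_sub_abs_le_abs_sub _ _).trans (le_of_eq (by ring_nf))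
  · exact le_of_eq (by ring_nf)
  · simp

lemma endDist_of_le {t : ℝ} (hy₀ : 0 ≤ y₀) (ht : r + y₀ ≤ t) : endDist h₀ y₀ r h t = r := by
  unfold endDist
  refine min_eq_left ?_
  split_ifs
  · exact le_trans (by linarith) (le_abs_self _)
  · linarith
  · exact le_rfl

open Classical in
lemma endDist_zero (hy₀ : 0 ≤ y₀) :
    endDist h₀ y₀ r h 0 = if h.base = h₀.base then min r y₀ else r := by
  unfold endDist
  split_ifs with h1 h2 h2
  · rw [zero_sub, abs_neg, abs_of_nonneg hy₀]
  · exact absurd (by rw [h1]) h2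
  · rw [zero_add]
  · rw [min_self]

end endDist

/-- Small balls near a vertex, in the coordinates of the ends of edges. -/
lemma halfEdge_pt_mem_ball_iff {h₀ h : G.HalfEdge} {y₀ t r : ℝ} (hr : 0 < r) (hy₀ : 0 ≤ y₀)
    (hℓ : ∀ e, ENNReal.ofReal (2 * (r + y₀)) ≤ G.len e) (ht : 0 ≤ t)
    (ht' : ENNReal.ofReal (2 * t) ≤ G.len h.edge) :
    h.pt t ∈ Metric.ball (h₀.pt y₀) r ↔
      (h = h₀ ∧ |t - y₀| < r) ∨ (h ≠ h₀ ∧ h.base = h₀.base ∧ t + y₀ < r) := by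
  classical
  have hyI : ∀ e, y₀ ∈ G.I e := fun e =>
    ⟨hy₀, (ENNReal.ofReal_le_ofReal (by linarith)).trans (hℓ e)⟩
  have htI : t ∈ G.I h.edge := ⟨ht, (ENNReal.ofReal_le_ofReal (by linarith)).trans ht'⟩
  constructor
  · intro hmem
    set c : V → ℝ := fun v => if v = h₀.base then min r y₀ else r with hc
    -- A candidate for the truncated distance to `h₀.pt y₀`: on each edge the smaller of the values
    -- seen from its ends. Edges have length at least `2 * (r + y₀)`, so near one end the
    -- contribution of the other has already reached the cap `r` and the gluing conditions hold.
    set ψ : E → ℝ → ℝ := fun e s => min (endDist h₀ y₀ r (.initial e) s)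
      (if hl : G.len e ≠ ⊤ then endDist h₀ y₀ r (.terminal e hl) ((G.len e).toReal - s) else r)
      with hψ
    have hlen : ∀ e, G.len e ≠ ⊤ → 2 * (r + y₀) ≤ (G.len e).toReal := fun e he =>
      (ENNReal.ofReal_le_iff_le_toReal he).1 (hℓ e)
    have hcr : ∀ v, c v ≤ r := fun v => by
      simp only [hc]; split_ifs
      exacts [min_le_left _ _, le_rfl]
    have hg : ∀ e, ∀ s ∈ G.I e, G.glue c ψ (G.pt e s) = ψ e s := by
      intro e s hs
      refine glue_pt ?_ (fun hl => ?_) hs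
      · simp only [hψ]
        rw [endDist_zero hy₀]
        change min (c (G.src e)) _ = _
        split_ifs with hl
        · rw [endDist_of_le hy₀ (by linarith [hlen e hl]), min_eq_left (hcr _)]
        · exact min_eq_left (hcr _)
      · simp only [hψ, dif_pos hl, sub_self]
        rw [endDist_zero hy₀, endDist_of_le hy₀ (by linarith [hlen e hl])]
        exact min_eq_right (hcr (G.tgt e hl))
    have hψle : ∀ h : G.HalfEdge, ∀ s, ψ h.edge (h.coord s) ≤ endDist h₀ y₀ r h s := by
      rintro (e | ⟨e, hl⟩) s
      · exact min_le_left _ _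
      · simp only [hψ, HalfEdge.edge, HalfEdge.coord, dif_pos hl, sub_sub_cancel]
        exact min_le_right _ _
    -- The point is in the half of its edge nearer to `h`, so the opposite end contributes `r` and
    -- the minimum is the value seen from `h`.
    have hleψ : endDist h₀ y₀ r h t ≤ ψ h.edge (h.coord t) := by
      cases h with
      | initial e =>
        refine le_min le_rfl ?_
        change endDist h₀ y₀ r (.initial e) t ≤ if hl : G.len e ≠ ⊤ then
          endDist h₀ y₀ r (.terminal e hl) ((G.len e).toReal - t) else r
        split_ifs with hl
        · have h2 := (ENNReal.ofReal_le_iff_le_toReal hl).1 ht'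
          rw [endDist_of_le hy₀ (t := (G.len e).toReal - t) (by linarith [hlen e hl])]
          exact endDist_le
        · exact endDist_le
      | terminal e hl =>
        simp only [hψ, HalfEdge.edge, HalfEdge.coord, dif_pos hl, sub_sub_cancel]
        have h2 := (ENNReal.ofReal_le_iff_le_toReal hl).1 ht'
        rw [endDist_of_le hy₀ (t := (G.len e).toReal - t) (by linarith [hlen e hl])]
        exact le_min endDist_le le_rfl
    have hlip := abs_sub_le_mul_dist (f := G.glue c ψ) zero_le_one
      (fun e s hs t ht => by
        rw [hg e s hs, hg e t ht]
        refine one_mul_abs_min_sub_min_le (abs_endDist_sub_le s t) ?_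
        split_ifs
        · refine (abs_endDist_sub_le _ _).trans (le_of_eq ?_)
          rw [abs_sub_comm]; ring_nf
        · simp) (h.pt t) (h₀.pt y₀)
    rw [HalfEdge.pt_eq, HalfEdge.pt_eq, hg _ _ (HalfEdge.coord_mem_I htI),
      hg _ _ (HalfEdge.coord_mem_I (hyI _)), one_mul, ← HalfEdge.pt_eq, ← HalfEdge.pt_eq] at hlip
    have h1 : ψ h₀.edge (h₀.coord y₀) ≤ 0 := (hψle h₀ y₀).trans (by simp [endDist, hr.le])
    have h2 : endDist h₀ y₀ r h t < r := by
      have := (le_abs_self _).trans hlip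
      have := Metric.mem_ball.1 hmem
      linarith
    unfold endDist at h2
    have h3 := (min_lt_iff.1 h2).resolve_left (lt_irrefl _)
    split_ifs at h3 with h4 h5
    · exact Or.inl ⟨h4, h3⟩
    · exact Or.inr ⟨h4, h5, h3⟩
    · exact absurd h3 (lt_irrefl _)
  · rw [Metric.mem_ball]
    rintro (⟨rfl, h1⟩ | ⟨-, h1, h2⟩)
    · exact (HalfEdge.dist_pt_le htI (hyI _)).trans_lt h1
    · refine lt_of_le_of_lt ?_ h2
      calc dist (h.pt t) (h₀.pt y₀) ≤ dist (h.pt t) (h.pt 0) + dist (h₀.pt 0) (h₀.pt y₀) := by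
            rw [HalfEdge.pt_zero h, h1, ← HalfEdge.pt_zero h₀]; exact dist_triangle _ _ _
        _ ≤ |t - 0| + |0 - y₀| := add_le_add
            (HalfEdge.dist_pt_le htI (zero_mem_I _)) (HalfEdge.dist_pt_le (zero_mem_I _) (hyI _))
        _ = t + y₀ := by rw [sub_zero, zero_sub, abs_neg, abs_of_nonneg ht, abs_of_nonneg hy₀]

/-! ### Integrals -/

lemma setIntegral_eq_abs_mul (f : ℝ → ℝ) {S : Set ℝ} (hS : MeasurableSet S) (s₀ : ℝ) {c : ℝ}
    (hc : c ≠ 0) : ∫ x in S, f x = |c| * ∫ y in {y | s₀ + c * y ∈ S}, f (s₀ + c * y) := by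
  have hm : MeasurableSet {y | s₀ + c * y ∈ S} :=
    hS.preimage (by fun_prop : Measurable fun y : ℝ => s₀ + c * y)
  rw [← integral_indicator hS, ← integral_indicator hm]
  have h1 : (fun y => ({y | s₀ + c * y ∈ S}).indicator (fun y => f (s₀ + c * y)) y) =
      fun y => (fun z => S.indicator f (s₀ + z)) (c * y) := by
    funext y
    simp only [indicator, mem_ofPred_eq]
  rw [h1, Measure.integral_comp_mul_left (fun z => S.indicator f (s₀ + z)) c,
    integral_add_left_eq_self (μ := volume) (S.indicator f) s₀, smul_eq_mul, abs_inv,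
    mul_inv_cancel_left₀ (abs_pos.2 hc).ne']

lemma measurableSet_pt_mem {S : Set G.Point} (hS : IsOpen S) (e : E) :
    MeasurableSet {x | x ∈ G.I e ∧ G.pt e x ∈ S} := by
  obtain ⟨u, hu, hu'⟩ := continuousOn_iff'.1 (continuousOn_pt e) S hS
  have : {x | x ∈ G.I e ∧ G.pt e x ∈ S} = u ∩ G.I e := by
    rw [← hu']; ext x; exact and_comm
  rw [this]
  exact hu.measurableSet.inter (isClosed_I e).measurableSet

variable [Fintype E]

/-- The integral of a continuous function as a sum over the ends of edges: every bounded edge is cut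
at its midpoint. -/
lemma integral_eq_sum_halfEdge {S : Set G.Point} (hS : IsOpen S) {f : G.Point → ℝ}
    (hf : ∀ e, ContinuousOn (fun x => f (G.pt e x)) (G.I e)) :
    G.integral S f = ∑ h : G.HalfEdge, ∫ t in {t | 0 ≤ t ∧
      ENNReal.ofReal (2 * t) ≤ G.len h.edge ∧ h.pt t ∈ S}, f (h.pt t) := by
  classical
  rw [HalfEdge.sum_eq, integral]
  refine Finset.sum_congr rfl fun e _ => ?_
  split_ifs with hl
  · set ℓ := (G.len e).toReal with hℓ
    have hℓ0 : 0 < ℓ := len_toReal_pos hl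
    set A := {x | x ∈ G.I e ∧ G.pt e x ∈ S} with hA
    have hAm : MeasurableSet A := measurableSet_pt_mem hS e
    have hint : IntegrableOn (fun x => f (G.pt e x)) A := by
      have : IntegrableOn (fun x => f (G.pt e x)) (G.I e) := by
        rw [I_eq_Icc hl]
        exact ContinuousOn.integrableOn_Icc (by simpa only [I_eq_Icc hl] using hf e)
      exact this.mono_set fun x hx => hx.1
    rw [← integral_inter_add_sdiff (s := A) (t := Iic (ℓ / 2)) measurableSet_Iic hint]
    congr 1
    · refine setIntegral_congr_set (ae_of_all _ fun t => propext ?_)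
      have h2 : ENNReal.ofReal (2 * t) ≤ G.len e ↔ 2 * t ≤ ℓ := ENNReal.ofReal_le_iff_le_toReal hl
      simp only [hA, I_eq_Icc hl]
      change ((0 ≤ t ∧ t ≤ ℓ) ∧ _) ∧ t ≤ ℓ / 2 ↔ 0 ≤ t ∧ ENNReal.ofReal (2 * t) ≤ G.len e ∧ _
      rw [h2]
      constructor
      · rintro ⟨⟨⟨h1, -⟩, h3⟩, h4⟩; exact ⟨h1, by linarith, h3⟩
      · rintro ⟨h1, h3, h4⟩; exact ⟨⟨⟨h1, by linarith⟩, h4⟩, by linarith⟩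
    · rw [setIntegral_eq_abs_mul _ (hAm.diff measurableSet_Iic) ℓ (c := -1) (by norm_num), abs_neg,
        abs_one, one_mul]
      -- The two half-edges overlap in the midpoint, a null set.
      have hne : ∀ᵐ t : ℝ ∂volume, t ≠ ℓ / 2 := compl_mem_ae_iff.2 (measure_singleton _)
      have e1 : ∀ t : ℝ, ℓ + -1 * t = ℓ - t := fun t => by ring
      simp only [e1]
      refine setIntegral_congr_set ?_
      filter_upwards [hne] with t ht
      refine propext ?_
      have h2 : ENNReal.ofReal (2 * t) ≤ G.len e ↔ 2 * t ≤ ℓ := ENNReal.ofReal_le_iff_le_toReal hl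
      simp only [hA, I_eq_Icc hl]
      change ((0 ≤ ℓ - t ∧ ℓ - t ≤ ℓ) ∧ _) ∧ ¬ ℓ - t ≤ ℓ / 2 ↔
        0 ≤ t ∧ ENNReal.ofReal (2 * t) ≤ G.len e ∧ _
      rw [h2]
      constructor
      · rintro ⟨⟨⟨-, h1⟩, h3⟩, h4⟩; exact ⟨by linarith, by linarith, h3⟩
      · rintro ⟨h1, h3, h4⟩
        exact ⟨⟨⟨by linarith, by linarith⟩, h4⟩, fun h => ht (by linarith)⟩
  · have hl' : G.len e = ⊤ := not_ne_iff.1 hl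
    rw [add_zero]
    refine setIntegral_congr_set (ae_of_all _ fun t => propext ?_)
    simp only [I_eq_Ici hl']
    change (0 ≤ t ∧ _) ↔ 0 ≤ t ∧ ENNReal.ofReal (2 * t) ≤ G.len e ∧ _
    rw [hl']
    exact and_congr_right fun _ => (and_iff_right le_top).symm

open Classical in
/-- The integral over a small ball near a vertex. -/
lemma integral_ball_eq_sum {h₀ : G.HalfEdge} {y₀ r : ℝ} (hr : 0 < r) (hy₀ : 0 ≤ y₀)
    (hℓ : ∀ e, ENNReal.ofReal (2 * (r + y₀)) ≤ G.len e) {f : G.Point → ℝ}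
    (hf : ∀ e, ContinuousOn (fun x => f (G.pt e x)) (G.I e)) :
    G.integral (Metric.ball (h₀.pt y₀) r) f =
      ∑ h : G.HalfEdge, if h.base = h₀.base then
        ∫ t in Ici 0 ∩ Ioo (if h = h₀ then y₀ - r else -1) (if h = h₀ then y₀ + r else r - y₀),
          f (h.pt t) else 0 := by
  rw [integral_eq_sum_halfEdge Metric.isOpen_ball hf]
  refine Finset.sum_congr rfl fun h _ => ?_
  -- On the end `h₀` the ball is an interval around `y₀`; on the other ends at the same vertex it is
  -- `t < r - y₀`. The lower endpoint `-1` there is inert, because `t ≥ 0`.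
  have hset : {t | 0 ≤ t ∧ ENNReal.ofReal (2 * t) ≤ G.len h.edge ∧
      h.pt t ∈ Metric.ball (h₀.pt y₀) r} = if h.base = h₀.base then
        Ici 0 ∩ Ioo (if h = h₀ then y₀ - r else -1) (if h = h₀ then y₀ + r else r - y₀) else ∅ := by
    ext t
    have key : ∀ ht : 0 ≤ t, t < r + y₀ → ENNReal.ofReal (2 * t) ≤ G.len h.edge := fun _ h1 =>
      (ENNReal.ofReal_le_ofReal (by linarith)).trans (hℓ _)
    constructor
    · rintro ⟨h1, h2, h3⟩
      rw [halfEdge_pt_mem_ball_iff hr hy₀ hℓ h1 h2] at h3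
      rcases h3 with ⟨h4, h5⟩ | ⟨h4, h5, h6⟩
      · rw [abs_lt] at h5
        rw [if_pos (by rw [h4]), if_pos h4, if_pos h4]
        exact ⟨h1, by linarith, by linarith⟩
      · rw [if_pos h5, if_neg h4, if_neg h4]
        exact ⟨h1, by linarith, by linarith⟩
    · intro h1
      split_ifs at h1 with h2 h3
      · obtain ⟨h4, h5, h6⟩ := h1
        refine ⟨h4, key h4 (by linarith), (halfEdge_pt_mem_ball_iff hr hy₀ hℓ h4
          (key h4 (by linarith))).2 (Or.inl ⟨h3, ?_⟩)⟩
        rw [abs_lt]; constructor <;> linarith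
      · obtain ⟨h4, h5, h6⟩ := h1
        exact ⟨h4, key h4 (by linarith), (halfEdge_pt_mem_ball_iff hr hy₀ hℓ h4
          (key h4 (by linarith))).2 (Or.inr ⟨h3, h2, by linarith⟩)⟩
      · exact absurd h1 (notMem_empty t)
  rw [hset]
  by_cases h1 : h.base = h₀.base
  · rw [if_pos h1, if_pos h1]
  · rw [if_neg h1, if_neg h1]
    exact setIntegral_empty

end MetricGraph

/-! ### Regularity of solutions, and the quadratic form at solution times cutoff -/

namespace MetricGraph

variable {V E : Type*} {G : MetricGraph V E}

lemma ordConnected_I (e : E) : (G.I e).OrdConnected := by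
  by_cases h : G.len e = ⊤
  · rw [I_eq_Ici h]; infer_instance
  · rw [I_eq_Icc h]; infer_instance

lemma integral_eq_sub_of_ordConnected {S : Set ℝ} (hS : S.OrdConnected) {f g : ℝ → ℝ}
    (hf : ∀ s ∈ S, HasDerivWithinAt f (g s) S s) (hg : ContinuousOn g S) {a b : ℝ} (ha : a ∈ S)
    (hb : b ∈ S) : ∫ x in a..b, g x = f b - f a := by
  have key : ∀ {a b}, a ∈ S → b ∈ S → a ≤ b → ∫ x in a..b, g x = f b - f a := by
    intro a b ha hb hab
    have hs : Icc a b ⊆ S := hS.out ha hb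
    refine intervalIntegral.integral_eq_sub_of_hasDeriv_right_of_le hab
      (fun x hx => ((hf x (hs hx)).continuousWithinAt).mono hs) (fun x hx => ?_)
      (hg.mono (by rwa [uIcc_of_le hab])).intervalIntegrable
    exact ((hf x (hs (Ioo_subset_Icc_self hx))).hasDerivAt
      (mem_of_superset (Icc_mem_nhds hx.1 hx.2) hs)).hasDerivWithinAt
  rcases le_total a b with hab | hab
  · exact key ha hb hab
  · rw [intervalIntegral.integral_symm, key hb ha hab]; ring

lemma integrableOn_I {e : E} {f : ℝ → ℝ} (hf : ContinuousOn f (G.I e)) {B : ℝ}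
    (hB : G.len e = ⊤ → ∀ s, B ≤ s → f s = 0) : IntegrableOn f (G.I e) := by
  by_cases h : G.len e = ⊤
  · rw [I_eq_Ici h] at hf ⊢
    have h1 : IntegrableOn f (Icc 0 B) := (hf.mono Icc_subset_Ici_self).integrableOn_Icc
    have h2 : IntegrableOn f (Ioi B) :=
      integrableOn_zero.congr_fun (fun s hs => (hB h s (le_of_lt hs)).symm) measurableSet_Ioi
    refine (h1.union h2).mono_set fun s hs => ?_
    rcases le_or_gt s B with h | h
    exacts [Or.inl ⟨hs, h⟩, Or.inr h]
  · rw [I_eq_Icc h] at hf ⊢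
    exact hf.integrableOn_Icc

/-- `Q` is defined with the two-sided derivative, whereas the regularity statements are relative to
the closed edge; at interior points the two agree, and the endpoints are a null set. -/
lemma ae_I_interior (e : E) : ∀ᵐ x ∂volume.restrict (G.I e), x ∈ G.I e ∧ G.I e ∈ 𝓝 x := by
  have h1 : ∀ c : ℝ, ∀ᵐ y ∂(volume : Measure ℝ), y ≠ c := fun c =>
    compl_mem_ae_iff.2 (measure_singleton c)
  rw [ae_restrict_iff' (isClosed_I e).measurableSet]
  by_cases h : G.len e = ⊤
  · filter_upwards [h1 0] with x hx hxI
    refine ⟨hxI, ?_⟩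
    rw [I_eq_Ici h] at hxI ⊢
    exact Ici_mem_nhds (lt_of_le_of_ne hxI hx.symm)
  · filter_upwards [h1 0, h1 (G.len e).toReal] with x hx hx' hxI
    refine ⟨hxI, ?_⟩
    rw [I_eq_Icc h] at hxI ⊢
    exact Icc_mem_nhds (lt_of_le_of_ne hxI.1 hx.symm) (lt_of_le_of_ne hxI.2 hx')

/-! ### Regularity of the solutions -/

/-- The derivative along the edge `e`. -/
noncomputable def edgeDeriv (u : G.Point → ℝ) (e : E) : ℝ → ℝ :=
  derivWithin (fun x => u (G.pt e x)) (G.I e)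

namespace IsPositiveSolution

variable [Fintype E] {p lam ρ : ℝ} {u : G.Point → ℝ}

lemma hasDerivWithinAt (hu : G.IsPositiveSolution p lam ρ u) {e : E} {s : ℝ} (hs : s ∈ G.I e) :
    HasDerivWithinAt (fun x => u (G.pt e x)) (edgeDeriv u e s) (G.I e) s :=
  ((hu.contDiffOn e).differentiableOn (by simp) s hs).hasDerivWithinAt

lemma hasDerivWithinAt_edgeDeriv (hu : G.IsPositiveSolution p lam ρ u) {e : E} {s : ℝ}
    (hs : s ∈ G.I e) : HasDerivWithinAt (edgeDeriv u e)
      (lam * u (G.pt e s) - ρ * u (G.pt e s) ^ (p - 1)) (G.I e) s := by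
  have h1 := hu.contDiffOn e
  rw [show (2 : WithTop ℕ∞) = 1 + 1 from rfl, contDiffOn_succ_iff_derivWithin (uniqueDiffOn_I e)]
    at h1
  have h2 := (h1.2.2.differentiableOn (by simp) s hs).hasDerivWithinAt
  have h3 := hu.equation e s hs
  rw [show (2 : ℕ) = 1 + 1 from rfl, iteratedDerivWithin_succ, iteratedDerivWithin_one] at h3
  exact h2.congr_deriv (by linarith)

lemma continuousOn (hu : G.IsPositiveSolution p lam ρ u) (e : E) :
    ContinuousOn (fun x => u (G.pt e x)) (G.I e) :=
  fun _ hs => (hu.hasDerivWithinAt hs).continuousWithinAt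

lemma continuousOn_edgeDeriv (hu : G.IsPositiveSolution p lam ρ u) (e : E) :
    ContinuousOn (edgeDeriv u e) (G.I e) :=
  fun _ hs => (hu.hasDerivWithinAt_edgeDeriv hs).continuousWithinAt

/-- Bootstrapping: as `u > 0`, the power `u^(p-1)` is as smooth as `u`, so the equation gains two
derivatives each time. Smoothness is needed because the test functions are products of `u` with
cutoffs. -/
lemma contDiffOn_infty (hu : G.IsPositiveSolution p lam ρ u) (e : E) :
    ContDiffOn ℝ ∞ (fun x => u (G.pt e x)) (G.I e) := by
  have hU := uniqueDiffOn_I (G := G) e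
  rw [_root_.contDiffOn_infty]
  intro n
  induction n with
  | zero => exact contDiffOn_zero.2 (hu.continuousOn e)
  | succ n ih =>
    have h1 : ContDiffOn ℝ n (derivWithin (edgeDeriv u e) (G.I e)) (G.I e) := by
      have h2 : ContDiffOn ℝ n (fun s => lam * u (G.pt e s) - ρ * u (G.pt e s) ^ (p - 1)) (G.I e) :=
        (contDiffOn_const.mul ih).sub
          (contDiffOn_const.mul (ih.rpow_const_of_ne fun s _ => (hu.pos _).ne'))
      exact h2.congr fun s hs => (hu.hasDerivWithinAt_edgeDeriv hs).derivWithin (hU s hs)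
    have h2 : ContDiffOn ℝ n (edgeDeriv u e) (G.I e) := by
      refine ContDiffOn.of_le (n := (n : WithTop ℕ∞) + 1) ?_ le_self_add
      rw [contDiffOn_succ_iff_derivWithin hU]
      exact ⟨fun s hs => (hu.hasDerivWithinAt_edgeDeriv hs).differentiableWithinAt, by simp, h1⟩
    rw [Nat.cast_add, Nat.cast_one, contDiffOn_succ_iff_derivWithin hU]
    exact ⟨fun s hs => (hu.hasDerivWithinAt hs).differentiableWithinAt, by simp, h2⟩

/-- The Kirchhoff condition differentiates in the direction leaving the vertex, which on a terminal
end is opposite to the edge coordinate. The derivative is local, so it does not matter that `h.pt t`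
leaves the parametrization beyond a bounded edge. -/
lemma derivWithin_halfEdge (hu : G.IsPositiveSolution p lam ρ u) (h : G.HalfEdge) :
    derivWithin (fun t => u (h.pt t)) (Ici 0) 0 = h.sign * edgeDeriv u h.edge (h.coord 0) := by
  have hI : G.I h.edge ∈ 𝓝[Ici 0] 0 := by
    by_cases hl : G.len h.edge = ⊤
    · rw [I_eq_Ici hl]; exact self_mem_nhdsWithin
    · rw [I_eq_Icc hl]; exact Icc_mem_nhdsGE (len_toReal_pos hl)
  have hd : HasDerivWithinAt h.coord h.sign (G.I h.edge) 0 := by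
    have : h.coord = fun t => h.coord 0 + h.sign * t := funext h.coord_eq
    rw [this]
    simpa using ((hasDerivWithinAt_id (0 : ℝ) (G.I h.edge)).const_mul h.sign).const_add (h.coord 0)
  have h1 := (hu.hasDerivWithinAt (HalfEdge.coord_mem_I (zero_mem_I h.edge))).scomp (0 : ℝ) hd
    fun t ht => HalfEdge.coord_mem_I ht
  have h2 : HasDerivWithinAt (fun t => u (h.pt t)) (h.sign * edgeDeriv u h.edge (h.coord 0))
      (G.I h.edge) 0 := by
    simpa only [Function.comp_def, smul_eq_mul, HalfEdge.pt_eq] using h1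
  exact (h2.mono_of_mem_nhdsWithin hI).derivWithin (uniqueDiffOn_Ici 0 0 self_mem_Ici)

end IsPositiveSolution

/-! ### Products of a solution with a cutoff function -/

/-- `c` and `ψ` are the values at the vertices and the restrictions to the edges of a smooth function
with compact support. -/
structure IsCutoff (G : MetricGraph V E) (c : V → ℝ) (ψ : E → ℝ → ℝ) (B : ℝ) : Prop where
  smooth : ∀ e, ContDiff ℝ ∞ (ψ e)
  src : ∀ e, ψ e 0 = c (G.src e)
  tgt : ∀ e h, ψ e (G.len e).toReal = c (G.tgt e h)
  supp : ∀ e, G.len e = ⊤ → ∀ s, B ≤ s → ψ e s = 0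

namespace IsCutoff

variable {c : V → ℝ} {ψ : E → ℝ → ℝ} {B : ℝ}

lemma glue_pt (hψ : G.IsCutoff c ψ B) {e : E} {s : ℝ} (hs : s ∈ G.I e) :
    G.glue c ψ (G.pt e s) = ψ e s := MetricGraph.glue_pt (hψ.src e) (hψ.tgt e) hs

lemma deriv_eq_zero (hψ : G.IsCutoff c ψ B) {e : E} (he : G.len e = ⊤) {s : ℝ} (hs : B + 1 ≤ s) :
    deriv (ψ e) s = 0 := by
  have : ψ e =ᶠ[𝓝 s] fun _ => 0 := by
    filter_upwards [lt_mem_nhds (show B < s by linarith)] with z hz using hψ.supp e he z hz.le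
  rw [this.deriv_eq, deriv_const]

lemma continuous_deriv (hψ : G.IsCutoff c ψ B) (e : E) : Continuous (deriv (ψ e)) :=
  (hψ.smooth e).continuous_deriv (by simp)

/-- The derivative of `ψ e` is bounded on each edge, by compactness or because it vanishes beyond `B
+ 1`; with finitely many edges there is one Lipschitz constant for the whole graph. -/
lemma continuous_glue [Finite E] (hψ : G.IsCutoff c ψ B) : Continuous (G.glue c ψ) := by
  have hd : ∀ e, ∃ K : ℝ, ∀ s ∈ G.I e, |deriv (ψ e) s| ≤ K := by
    intro e
    by_cases h : G.len e = ⊤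
    · obtain ⟨K, hK⟩ := (isCompact_Icc (a := (0 : ℝ)) (b := B + 1)).exists_bound_of_continuousOn
        (hψ.continuous_deriv e).continuousOn
      refine ⟨max K 0, fun s hs => ?_⟩
      rcases le_total s (B + 1) with h' | h'
      · exact (hK s ⟨hs.1, h'⟩).trans (le_max_left _ _)
      · rw [hψ.deriv_eq_zero h h', abs_zero]; exact le_max_right _ _
    · rw [I_eq_Icc h]
      exact isCompact_Icc.exists_bound_of_continuousOn (hψ.continuous_deriv e).continuousOn
  choose K hK using hd
  obtain ⟨M, hM⟩ := (Set.finite_range K).bddAbove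
  have hM' : ∀ e, K e ≤ max M 0 := fun e => (hM (mem_range_self e)).trans (le_max_left _ _)
  have hlip := abs_sub_le_mul_dist (f := G.glue c ψ) (le_max_right M 0) fun e s hs t ht => by
    rw [hψ.glue_pt hs, hψ.glue_pt ht]
    have := Convex.norm_image_sub_le_of_norm_hasDerivWithin_le (f := ψ e) (f' := deriv (ψ e))
      (C := max M 0) (fun x _ => (((hψ.smooth e).differentiable (by simp)) x).hasDerivAt.hasDerivWithinAt)
      (fun x hx => (hK e x hx).trans (hM' e)) (ordConnected_I e).convex ht hs
    simpa [Real.norm_eq_abs] using this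
  refine LipschitzWith.continuous (K := (max M 0).toNNReal) (LipschitzWith.of_dist_le_mul
    fun x y => ?_)
  rw [Real.coe_toNNReal _ (le_max_right _ _), Real.dist_eq]
  exact hlip x y

lemma hasCompactSupport [Finite E] [Nonempty E] (hψ : G.IsCutoff c ψ B) (u : G.Point → ℝ) :
    HasCompactSupport fun x => u x * G.glue c ψ x := by
  -- Bounded edges are kept entirely. On a half-line `toReal` is 0, so the maximum reduces to `max B
  -- 0`, beyond which the cutoff vanishes.
  set b : E → ℝ := fun e => max B (G.len e).toReal with hb
  have hK : IsCompact (⋃ e, G.pt e '' (G.I e ∩ Icc 0 (b e))) := by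
    refine isCompact_iUnion fun e => IsCompact.image_of_continuousOn ?_
      ((continuousOn_pt e).mono inter_subset_left)
    exact isCompact_Icc.inter_left (isClosed_I e)
  refine HasCompactSupport.intro hK fun x hx => ?_
  rcases x with v | ⟨e, s, h0, h1⟩
  · exfalso
    obtain ⟨h, rfl⟩ := HalfEdge.exists_base (G := G) v
    have key : h.coord 0 ∈ G.I h.edge ∩ Icc 0 (b h.edge) := by
      refine ⟨HalfEdge.coord_mem_I (zero_mem_I _), ?_⟩
      refine ⟨(HalfEdge.coord_mem_I (zero_mem_I _)).1, ?_⟩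
      refine le_trans ?_ (le_max_right _ _)
      cases h <;> simp [HalfEdge.coord, HalfEdge.edge]
    refine hx (mem_iUnion.2 ⟨h.edge, ?_⟩)
    rw [← HalfEdge.pt_zero, HalfEdge.pt_eq]
    exact mem_image_of_mem _ key
  · have hs : s ∈ G.I e := ⟨h0.le, h1.le⟩
    by_cases hsb : s ≤ b e
    · exact absurd (mem_iUnion.2 ⟨e, by
        rw [← pt_interior e s h0 h1]; exact mem_image_of_mem _ ⟨hs, h0.le, hsb⟩⟩) hx
    · have hl : G.len e = ⊤ := by
        by_contra hl
        rw [I_eq_Icc hl] at hs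
        exact hsb (hs.2.trans (le_max_right _ _))
      change _ * ψ e s = 0
      rw [hψ.supp e hl s ((le_max_left _ _).trans (not_le.1 hsb).le), mul_zero]

/-- The derivative on the edge `e` of the product of `u` with the cutoff function. -/
noncomputable def prodDeriv (u : G.Point → ℝ) (ψ : E → ℝ → ℝ) (e : E) (s : ℝ) : ℝ :=
  edgeDeriv u e s * ψ e s + u (G.pt e s) * deriv (ψ e) s

lemma prodDeriv_eq_zero {u : G.Point → ℝ} (hψ : G.IsCutoff c ψ B) {e : E} (he : G.len e = ⊤) {s : ℝ}
    (hs : B + 1 ≤ s) : prodDeriv u ψ e s = 0 := by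
  rw [prodDeriv, hψ.supp e he s (by linarith), hψ.deriv_eq_zero he hs]; ring

variable [Fintype E] {p lam ρ : ℝ} {u : G.Point → ℝ}

lemma isTestFunction [Nonempty E] (hψ : G.IsCutoff c ψ B) (hu : G.IsPositiveSolution p lam ρ u) :
    G.IsTestFunction fun x => u x * G.glue c ψ x := by
  refine ⟨hu.continuous.mul hψ.continuous_glue, hψ.hasCompactSupport u, fun e => ?_⟩
  exact ((hu.contDiffOn_infty e).mul (hψ.smooth e).contDiffOn).congr fun s hs => by
    simp only [hψ.glue_pt hs]

lemma hasDerivWithinAt_prod (hψ : G.IsCutoff c ψ B) (hu : G.IsPositiveSolution p lam ρ u) {e : E}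
    {s : ℝ} (hs : s ∈ G.I e) :
    HasDerivWithinAt (fun x => u (G.pt e x) * G.glue c ψ (G.pt e x)) (prodDeriv u ψ e s)
      (G.I e) s := by
  have h1 := (hu.hasDerivWithinAt hs).fun_mul
    (((hψ.smooth e).differentiable (by simp)) s).hasDerivAt.hasDerivWithinAt
  exact h1.congr (fun x hx => by rw [hψ.glue_pt hx]) (by rw [hψ.glue_pt hs])

lemma continuousOn_prodDeriv (hψ : G.IsCutoff c ψ B) (hu : G.IsPositiveSolution p lam ρ u) (e : E) :
    ContinuousOn (prodDeriv u ψ e) (G.I e) :=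
  ((hu.continuousOn_edgeDeriv e).mul (hψ.smooth e).continuous.continuousOn).add
    ((hu.continuousOn e).mul (hψ.continuous_deriv e).continuousOn)

lemma memH1 (hψ : G.IsCutoff c ψ B) (hu : G.IsPositiveSolution p lam ρ u) :
    G.MemH1 fun x => u x * G.glue c ψ x := by
  refine ⟨hu.continuous.mul hψ.continuous_glue, fun e => ⟨?_, prodDeriv u ψ e, ?_, ?_⟩⟩
  · have hc : ContinuousOn (fun x => u (G.pt e x) * ψ e x) (G.I e) :=
      (hu.continuousOn e).mul (hψ.smooth e).continuous.continuousOn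
    refine memLp_two_of_integrableOn_sq (isClosed_I e).measurableSet
      (hc.congr fun x hx => by simp only [hψ.glue_pt hx]) ?_
    refine (integrableOn_I (B := B) (hc.pow 2) fun he s hs => ?_).congr_fun
      (fun x hx => by simp [hψ.glue_pt hx]) (isClosed_I e).measurableSet
    simp [hψ.supp e he s hs]
  · refine memLp_two_of_integrableOn_sq (isClosed_I e).measurableSet
      (hψ.continuousOn_prodDeriv hu e) (integrableOn_I (B := B + 1)
      ((hψ.continuousOn_prodDeriv hu e).pow 2) fun he s hs => ?_)
    simp [hψ.prodDeriv_eq_zero he hs]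
  · intro a ha b hb
    exact (integral_eq_sub_of_ordConnected (ordConnected_I e)
      (fun s hs => hψ.hasDerivWithinAt_prod hu hs) (hψ.continuousOn_prodDeriv hu e) ha hb).symm

end IsCutoff

/-- The density of the quadratic form at the product of the solution `f` with `χ`, up to the
derivative of a function. -/
noncomputable def energyDensity (p ρ : ℝ) (f χ : ℝ → ℝ) (s : ℝ) : ℝ :=
  f s ^ 2 * deriv χ s ^ 2 - (p - 2) * ρ * (f s ^ p * χ s ^ 2)

lemma continuousOn_energyDensity {p ρ : ℝ} (hp : 2 < p) {f χ : ℝ → ℝ} {S : Set ℝ}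
    (hf : ContinuousOn f S) (hχ : ContDiff ℝ ∞ χ) : ContinuousOn (energyDensity p ρ f χ) S :=
  ((hf.pow 2).mul ((hχ.continuous_deriv (by simp)).continuousOn.pow 2)).sub
    (continuousOn_const.mul ((hf.rpow_const fun _ _ => Or.inr (by linarith)).mul
      (hχ.continuous.continuousOn.pow 2)))

namespace IsCutoff

variable {c : V → ℝ} {ψ : E → ℝ → ℝ} {B : ℝ} [Fintype E] {p lam ρ : ℝ} {u : G.Point → ℝ}

lemma energyDensity_eq_zero {f χ : ℝ → ℝ} {s : ℝ} (h : χ s = 0) (h' : deriv χ s = 0) :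
    energyDensity p ρ f χ s = 0 := by
  simp [energyDensity, h, h']

lemma integrableOn_energyDensity (hp : 2 < p) (hψ : G.IsCutoff c ψ B)
    (hu : G.IsPositiveSolution p lam ρ u) (e : E) :
    IntegrableOn (energyDensity p ρ (fun x => u (G.pt e x)) (ψ e)) (G.I e) :=
  integrableOn_I (B := B + 1) (continuousOn_energyDensity hp (hu.continuousOn e) (hψ.smooth e))
    fun he s hs => energyDensity_eq_zero (hψ.supp e he s (by linarith)) (hψ.deriv_eq_zero he hs)

/-- The boundary term at an end of an edge. -/
noncomputable def boundaryTerm (u : G.Point → ℝ) (c : V → ℝ) (h : G.HalfEdge) : ℝ :=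
  u (.vertex h.base) * c h.base ^ 2 * derivWithin (fun t => u (h.pt t)) (Ici 0) 0

-- With `P = u u' ψ²`, the equation for `u''` turns the integrand of `Q` at `u ψ` into `u² ψ'² -
-- (p-2) ρ u^p ψ² + P'`. The linear coefficient `lam` cancels, and the integral of `P'` leaves one
-- boundary term at each end of the edge.
open Classical in
lemma edge_form_eq (hp : 2 < p) (hψ : G.IsCutoff c ψ B) (hu : G.IsPositiveSolution p lam ρ u)
    (e : E) :
    ∫ x in G.I e, ((deriv (fun x => u (G.pt e x) * G.glue c ψ (G.pt e x)) x) ^ 2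
      + (lam - (p - 1) * ρ * |u (G.pt e x)| ^ (p - 2)) * (u (G.pt e x) * G.glue c ψ (G.pt e x)) ^ 2)
    = (∫ x in G.I e, energyDensity p ρ (fun x => u (G.pt e x)) (ψ e) x)
      - (boundaryTerm u c (.initial e) +
        if h : G.len e ≠ ⊤ then boundaryTerm u c (.terminal e h) else 0) := by
  set F : ℝ → ℝ := fun x => u (G.pt e x) with hF
  set D : ℝ → ℝ := edgeDeriv u e with hD
  set P : ℝ → ℝ := fun x => F x * D x * ψ e x ^ 2 with hP
  set P' : ℝ → ℝ := fun x => (D x * D x + F x * (lam * F x - ρ * F x ^ (p - 1))) * ψ e x ^ 2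
    + F x * D x * (2 * ψ e x * deriv (ψ e) x) with hP'
  have hFc : ContinuousOn F (G.I e) := hu.continuousOn e
  have hDc : ContinuousOn D (G.I e) := hu.continuousOn_edgeDeriv e
  have hψc : Continuous (ψ e) := (hψ.smooth e).continuous
  have hPd : ∀ s ∈ G.I e, HasDerivWithinAt P (P' s) (G.I e) s := by
    intro s hs
    have h1 := ((hu.hasDerivWithinAt hs).fun_mul (hu.hasDerivWithinAt_edgeDeriv hs)).fun_mul
      ((((hψ.smooth e).differentiable (by simp)) s).hasDerivAt.hasDerivWithinAt.fun_pow 2)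
    refine h1.congr_deriv ?_
    simp only [hP', hF, hD]
    push_cast
    ring
  have hP'c : ContinuousOn P' (G.I e) :=
    (((hDc.mul hDc).add (hFc.mul ((continuousOn_const.mul hFc).sub (continuousOn_const.mul
      (hFc.rpow_const fun _ _ => Or.inr (by linarith)))))).mul (hψc.continuousOn.pow 2)).add
      ((hFc.mul hDc).mul ((continuousOn_const.mul hψc.continuousOn).mul
        (hψ.continuous_deriv e).continuousOn))
  have hP'0 : G.len e = ⊤ → ∀ s, B + 1 ≤ s → P' s = 0 := fun he s hs => by
    simp [hP', hψ.supp e he s (by linarith)]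
  have hP'i : IntegrableOn P' (G.I e) := integrableOn_I hP'c hP'0
  have e1 : ∫ x in G.I e, ((deriv (fun x => u (G.pt e x) * G.glue c ψ (G.pt e x)) x) ^ 2
      + (lam - (p - 1) * ρ * |u (G.pt e x)| ^ (p - 2)) * (u (G.pt e x) * G.glue c ψ (G.pt e x)) ^ 2)
      = ∫ x in G.I e, (energyDensity p ρ F (ψ e) x + P' x) := by
    refine integral_congr_ae ?_
    filter_upwards [ae_I_interior e] with x hx
    rw [((hψ.hasDerivWithinAt_prod hu hx.1).hasDerivAt hx.2).deriv, hψ.glue_pt hx.1]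
    have h0 : 0 < F x := hu.pos _
    have h1 : F x ^ (p - 1) = F x ^ (p - 2) * F x := by
      rw [← Real.rpow_add_one h0.ne']; ring_nf
    have h2 : F x ^ p = F x ^ (p - 2) * F x ^ 2 := by
      rw [← Real.rpow_two, ← Real.rpow_add h0]; ring_nf
    simp only [prodDeriv, energyDensity, hP']
    change (D x * ψ e x + F x * deriv (ψ e) x) ^ 2 +
      (lam - (p - 1) * ρ * |F x| ^ (p - 2)) * (F x * ψ e x) ^ 2 = _
    rw [h1, h2, abs_of_pos h0]
    ring
  rw [e1, integral_add (hψ.integrableOn_energyDensity hp hu e) hP'i, sub_eq_add_neg]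
  congr 1
  have b0 : boundaryTerm u c (.initial e) = P 0 := by
    rw [boundaryTerm, hu.derivWithin_halfEdge]
    simp only [HalfEdge.base, HalfEdge.sign, HalfEdge.edge, HalfEdge.coord, hP, hF, hD]
    rw [hψ.src, pt_zero]; ring
  by_cases hl : G.len e = ⊤
  · rw [dif_neg (not_not.2 hl), b0, add_zero, I_eq_Ici hl, integral_Ici_eq_integral_Ioi]
    -- On a half-line the integral of `P'` stops at `b`, where the cutoff is zero, so nothing is
    -- contributed at infinity.
    set b := max (B + 1) 0 with hb
    have hb0 : 0 ≤ b := le_max_right _ _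
    have hbB : B + 1 ≤ b := le_max_left _ _
    have h1 : ∫ x in Ioi 0, P' x = ∫ x in (0 : ℝ)..b, P' x := by
      rw [intervalIntegral.integral_of_le hb0]
      refine setIntegral_eq_of_subset_of_forall_sdiff_eq_zero measurableSet_Ioi
        Ioc_subset_Ioi_self fun x hx => hP'0 hl x ?_
      by_contra! h
      exact hx.2 ⟨hx.1, h.le.trans hbB⟩
    rw [h1, integral_eq_sub_of_ordConnected (ordConnected_I e) hPd hP'c (zero_mem_I e)
      (b := b) (by rw [I_eq_Ici hl]; exact hb0)]
    have : P b = 0 := by simp [hP, hψ.supp e hl b (by linarith)]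
    rw [this]; ring
  · have b1 : boundaryTerm u c (.terminal e hl) = - P (G.len e).toReal := by
      rw [boundaryTerm, hu.derivWithin_halfEdge]
      simp only [HalfEdge.base, HalfEdge.sign, HalfEdge.edge, HalfEdge.coord, hP, hF, hD, sub_zero]
      rw [hψ.tgt e hl, pt_len e hl]; ring
    rw [dif_pos hl, b0, b1, I_eq_Icc hl, integral_Icc_eq_integral_Ioc,
      ← intervalIntegral.integral_of_le (len_toReal_pos hl).le,
      integral_eq_sub_of_ordConnected (ordConnected_I e) hPd hP'c (zero_mem_I e) (len_mem_I e hl)]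
    ring

/-- The quadratic form at the product of a solution with a cutoff function. -/
lemma Q_eq [Fintype V] (hp : 2 < p) (hψ : G.IsCutoff c ψ B)
    (hu : G.IsPositiveSolution p lam ρ u) :
    G.Q p lam ρ u (fun x => u x * G.glue c ψ x) =
      ∑ e, ∫ x in G.I e, energyDensity p ρ (fun x => u (G.pt e x)) (ψ e) x := by
  classical
  rw [Q, Finset.sum_congr rfl fun e _ => hψ.edge_form_eq hp hu e, Finset.sum_sub_distrib,
    ← HalfEdge.sum_eq]
  have h0 : ∑ h : G.HalfEdge, boundaryTerm u c h = 0 := by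
    -- The boundary terms are grouped by vertex. At each vertex the factor `u c²` is common, and the
    -- outward derivatives add up to zero.
    have h1 : ∀ h : G.HalfEdge, boundaryTerm u c h =
        ∑ v, if h.base = v then boundaryTerm u c h else 0 := fun h => by simp
    rw [Finset.sum_congr rfl fun h _ => h1 h, Finset.sum_comm]
    refine Finset.sum_eq_zero fun v _ => ?_
    rw [← HalfEdge.sum_ends v (fun h => if h.base = v then boundaryTerm u c h else 0)
      fun h hh => if_neg hh]
    have h2 : ∀ h : G.Ends v, (if h.1.base = v then boundaryTerm u c h.1 else 0) =
        u (.vertex v) * c v ^ 2 * derivWithin (fun t => u (h.1.pt t)) (Ici 0) 0 := fun h => by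
      rw [if_pos h.2, boundaryTerm, h.2]
    rw [Finset.sum_congr rfl fun h _ => h2 h, ← Finset.mul_sum, hu.kirchhoff, mul_zero]
  rw [h0, sub_zero]

end IsCutoff

end MetricGraph

/-! ### The Morse index bound on an edge, and rescaled profiles -/

namespace MetricGraph

variable {V E : Type*} {G : MetricGraph V E}

lemma sq_sum_eq_sum_sq {ι : Type*} [Fintype ι] {x : ι → ℝ} (h : ∀ i j, i ≠ j → x i * x j = 0) :
    (∑ i, x i) ^ 2 = ∑ i, x i ^ 2 := by
  rw [sq, Finset.sum_mul_sum]
  refine Finset.sum_congr rfl fun i _ => ?_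
  rw [Finset.sum_eq_single i (fun j _ hj => h i j hj.symm) (by simp), sq]

open Classical in
/-- A function that is supported in one edge, as a cutoff function. -/
lemma isCutoff_single [Finite E] {e : E} {a b : ℝ} (ha : 0 < a) (hb : ENNReal.ofReal b < G.len e)
    {χ : ℝ → ℝ} (hχ : ContDiff ℝ ∞ χ) (h0 : ∀ s, s ∉ Ioo a b → χ s = 0) :
    G.IsCutoff (fun _ => 0) (fun e' => if e' = e then χ else fun _ => 0) b where
  smooth e' := by split_ifs; exacts [hχ, contDiff_const]
  src e' := by split_ifs; exacts [h0 0 fun h => lt_asymm ha h.1, rfl]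
  tgt e' h := by
    split_ifs with he
    · subst he
      refine h0 _ fun h' => ?_
      rw [ENNReal.ofReal_lt_iff_lt_toReal (ha.le.trans (h'.1.trans h'.2).le) h] at hb
      exact lt_asymm hb h'.2
    · rfl
  supp e' _ s hs := by
    split_ifs
    exacts [h0 _ fun h' => not_lt.2 hs h'.2, rfl]

lemma deriv_eq_zero_of_notMem_Icc {χ : ℝ → ℝ} {a b : ℝ} (h0 : ∀ s, s ∉ Ioo a b → χ s = 0) {s : ℝ}
    (hs : s ∉ Icc a b) : deriv χ s = 0 := by
  have : χ =ᶠ[𝓝 s] fun _ => 0 := by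
    filter_upwards [isClosed_Icc.isOpen_compl.mem_nhds hs] with z hz
    exact h0 z fun h => hz (Ioo_subset_Icc_self h)
  rw [this.deriv_eq, deriv_const]

variable {p lam ρ : ℝ} {u : G.Point → ℝ}

/-- The profile of `u` along the ray that starts at the coordinate `s₀` of the edge `e`, in the
direction `ς = ±1`, rescaled by `δ`. -/
noncomputable def profile (p : ℝ) (u : G.Point → ℝ) (e : E) (s₀ ς δ : ℝ) (y : ℝ) : ℝ :=
  δ ^ (2 / (p - 2)) * u (G.pt e (s₀ + ς * δ * y))

/-- The derivative of the profile. -/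
noncomputable def profileDeriv (p : ℝ) (u : G.Point → ℝ) (e : E) (s₀ ς δ : ℝ) (y : ℝ) : ℝ :=
  δ ^ (2 / (p - 2)) * (ς * δ * edgeDeriv u e (s₀ + ς * δ * y))

/-- The quadratic form in the rescaled coordinate. -/
lemma integral_energyDensity_profile (hp : 2 < p) (hu : ∀ x, 0 < u x) {e : E} {s₀ ς δ : ℝ}
    (hς : ς ^ 2 = 1) (hδ : 0 < δ) {S : Set ℝ} (hS : MeasurableSet S) {χ : ℝ → ℝ} :
    ∫ x in S, energyDensity p ρ (fun x => u (G.pt e x)) (fun s => χ (ς / δ * (s - s₀))) x =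
      δ ^ (1 - 2 / (p - 2) * p) *
        ∫ y in {y | s₀ + ς * δ * y ∈ S}, energyDensity p ρ (profile p u e s₀ ς δ) χ y := by
  have hςδ : ς * δ ≠ 0 := mul_ne_zero (by rintro rfl; norm_num at hς) hδ.ne'
  rw [setIntegral_eq_abs_mul _ hS s₀ hςδ]
  have habs : |ς * δ| = δ := by
    have : |ς| = 1 := by
      rw [← sq_eq_sq₀ (abs_nonneg ς) zero_le_one, sq_abs, hς, one_pow]
    rw [abs_mul, abs_of_pos hδ, this, one_mul]
  rw [habs, show δ ^ (1 - 2 / (p - 2) * p) = δ * δ ^ (-(2 / (p - 2) * p)) by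
    rw [← Real.rpow_one_add' hδ.le ?_]
    · ring_nf
    · have : p - 2 ≠ 0 := by linarith
      field_simp
      intro h
      rcases div_eq_zero_iff.1 h with h | h <;> linarith, mul_assoc, ← integral_const_mul (δ ^ _)]
  congr 2
  funext y
  have hy : ς / δ * (s₀ + ς * δ * y - s₀) = y := by
    rw [show ς / δ * (s₀ + ς * δ * y - s₀) = ς ^ 2 * y by field_simp; ring, hς, one_mul]
  have hd : deriv (fun s => χ (ς / δ * (s - s₀))) (s₀ + ς * δ * y) = ς / δ * deriv χ y := by
    have h1 : (fun s => χ (ς / δ * (s - s₀))) = fun s => (fun z => χ (ς / δ * z)) (s - s₀) := rfl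
    rw [h1, deriv_comp_sub_const (f := fun z => χ (ς / δ * z)), deriv_comp_mul_left, smul_eq_mul, hy]
  simp only [energyDensity, hd, hy, profile]
  have hu0 := hu (G.pt e (s₀ + ς * δ * y))
  have e1 : δ ^ (-(2 / (p - 2) * p)) * (δ ^ (2 / (p - 2)) * u (G.pt e (s₀ + ς * δ * y))) ^ p =
      u (G.pt e (s₀ + ς * δ * y)) ^ p := by
    rw [Real.mul_rpow (Real.rpow_nonneg hδ.le _) hu0.le, ← Real.rpow_mul hδ.le, ← mul_assoc,
      ← Real.rpow_add hδ, neg_add_cancel, Real.rpow_zero, one_mul]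
  -- Both terms of the density scale in the same way: the factor `δ^(-2)` from the derivative of the
  -- cutoff matches the gap between squares and `p`-th powers of `δ^(2/(p-2))`.
  have e2 : δ ^ (-(2 / (p - 2) * p)) * (δ ^ (2 / (p - 2))) ^ 2 = 1 / δ ^ 2 := by
    rw [← Real.rpow_natCast, ← Real.rpow_natCast, one_div, ← Real.rpow_neg hδ.le,
      ← Real.rpow_mul hδ.le, ← Real.rpow_add hδ]
    congr 1
    have : p - 2 ≠ 0 := by linarith
    push_cast
    field_simp
    ring
  rw [mul_sub, mul_pow, mul_pow, div_pow, hς]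
  linear_combination (-(u (G.pt e (s₀ + ς * δ * y))) ^ 2 * deriv χ y ^ 2) * e2 +
    (p - 2) * ρ * χ y ^ 2 * e1

variable [Fintype E]

open Classical in
lemma Q_single [Fintype V] (hp : 2 < p) (hu : G.IsPositiveSolution p lam ρ u) {e : E} {a b : ℝ}
    (ha : 0 < a) (hb : ENNReal.ofReal b < G.len e) {χ : ℝ → ℝ} (hχ : ContDiff ℝ ∞ χ)
    (h0 : ∀ s, s ∉ Ioo a b → χ s = 0) :
    G.Q p lam ρ u (fun x => u x *
      G.glue (fun _ => 0) (fun e' => if e' = e then χ else fun _ => 0) x) =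
      ∫ x in G.I e, energyDensity p ρ (fun x => u (G.pt e x)) χ x := by
  rw [(isCutoff_single ha hb hχ h0).Q_eq hp hu, Finset.sum_eq_single e]
  · rw [if_pos rfl]
  · intro e' _ he
    rw [if_neg he]
    refine setIntegral_eq_zero_of_forall_eq_zero fun x _ => ?_
    exact IsCutoff.energyDensity_eq_zero rfl (by simp)
  · simp

/-- Functions with disjoint supports in one edge, at which the quadratic form is negative, give a lower
bound for the Morse index. -/
lemma exists_nonneg_of_morseIndex_le [Fintype V] {k : ℕ} (hp : 2 < p)
    (hu : G.IsPositiveSolution p lam ρ u) (hk : G.morseIndex p lam ρ u ≤ k) {e : E}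
    {a b : Fin (k + 1) → ℝ} (ha : ∀ j, 0 < a j) (hb : ∀ j, ENNReal.ofReal (b j) < G.len e)
    (hab : Pairwise fun i j => Disjoint (Icc (a i) (b i)) (Icc (a j) (b j)))
    {χ : Fin (k + 1) → ℝ → ℝ} (hχ : ∀ j, ContDiff ℝ ∞ (χ j))
    (h0 : ∀ j, ∀ s, s ∉ Ioo (a j) (b j) → χ j s = 0) :
    ∃ j, 0 ≤ ∫ x in G.I e, energyDensity p ρ (fun x => u (G.pt e x)) (χ j) x := by
  classical
  by_contra! hneg
  obtain ⟨e₀⟩ : Nonempty E := ⟨e⟩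
  have : Nonempty E := ⟨e⟩
  -- One interval inside the edge contains all the windows, so that every linear combination is
  -- again a cutoff supported in one edge.
  obtain ⟨A, hA0, hA⟩ : ∃ A, 0 < A ∧ ∀ j, A ≤ a j := by
    obtain ⟨j, hj⟩ := Finite.exists_min a
    exact ⟨a j, ha j, hj⟩
  obtain ⟨B, hBe, hB⟩ : ∃ B, ENNReal.ofReal B < G.len e ∧ ∀ j, b j ≤ B := by
    obtain ⟨j, hj⟩ := Finite.exists_max b
    exact ⟨b j, hb j, hj⟩
  set χs : (Fin (k + 1) → ℝ) → ℝ → ℝ := fun c s => ∑ j, c j * χ j s with hχs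
  set φ : (ℝ → ℝ) → G.Point → ℝ := fun χ x => u x *
    G.glue (fun _ => 0) (fun e' => if e' = e then χ else fun _ => 0) x with hφ
  have hsm : ∀ c, ContDiff ℝ ∞ (χs c) := fun c =>
    ContDiff.sum fun j _ => contDiff_const.mul (hχ j)
  have hs0 : ∀ c, ∀ s, s ∉ Ioo A B → χs c s = 0 := fun c s hs =>
    Finset.sum_eq_zero fun j _ => by
      rw [h0 j s fun h => hs ⟨(hA j).trans_lt h.1, h.2.trans_le (hB j)⟩, mul_zero]
  have hcut := fun c => isCutoff_single hA0 hBe (hsm c) (hs0 c)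
  have hlin : ∀ c, ∑ j, c j • φ (χ j) = φ (χs c) := by
    intro c
    funext x
    simp only [Finset.sum_apply, Pi.smul_apply, smul_eq_mul, hφ]
    rcases x with v | ⟨e', s, h1, h2⟩
    · simp [glue]
    · simp only [glue]
      by_cases he : e' = e
      · simp only [if_pos he, hχs, Finset.mul_sum]
        exact Finset.sum_congr rfl fun j _ => by ring
      · simp [if_neg he]
  have hder : ∀ j s, s ∉ Icc (a j) (b j) → deriv (χ j) s = 0 := fun j s hs =>
    deriv_eq_zero_of_notMem_Icc (h0 j) hs
  -- The supports are disjoint, so no cross terms occur and the form is diagonal in the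
  -- coefficients.
  have hdens : ∀ c s, energyDensity p ρ (fun x => u (G.pt e x)) (χs c) s =
      ∑ j, c j ^ 2 * energyDensity p ρ (fun x => u (G.pt e x)) (χ j) s := by
    intro c s
    have hd : deriv (χs c) s = ∑ j, c j * deriv (χ j) s := by
      refine HasDerivAt.deriv ?_
      exact HasDerivAt.fun_sum fun j _ =>
        ((((hχ j).differentiable (by simp)) s).hasDerivAt.const_mul (c j))
    have hdis : ∀ {i j}, i ≠ j → s ∈ Icc (a i) (b i) → s ∉ Icc (a j) (b j) := fun hij hs hs' =>
      Set.disjoint_left.1 (hab hij) hs hs'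
    have q1 : (∑ j, c j * χ j s) ^ 2 = ∑ j, (c j * χ j s) ^ 2 := by
      refine sq_sum_eq_sum_sq fun i j hij => ?_
      by_cases hs : s ∈ Icc (a i) (b i)
      · rw [h0 j s fun h => hdis hij hs (Ioo_subset_Icc_self h)]; ring
      · rw [h0 i s fun h => hs (Ioo_subset_Icc_self h)]; ring
    have q2 : (∑ j, c j * deriv (χ j) s) ^ 2 = ∑ j, (c j * deriv (χ j) s) ^ 2 := by
      refine sq_sum_eq_sum_sq fun i j hij => ?_
      by_cases hs : s ∈ Icc (a i) (b i)
      · rw [hder j s (hdis hij hs)]; ring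
      · rw [hder i s hs]; ring
    simp only [energyDensity, hd]
    rw [hχs, q1, q2, Finset.mul_sum, Finset.mul_sum, Finset.mul_sum, ← Finset.sum_sub_distrib]
    exact Finset.sum_congr rfl fun j _ => by ring
  have hQ : ∀ c, G.Q p lam ρ u (φ (χs c)) =
      ∑ j, c j ^ 2 * ∫ x in G.I e, energyDensity p ρ (fun x => u (G.pt e x)) (χ j) x := by
    intro c
    rw [hφ, Q_single hp hu hA0 hBe (hsm c) (hs0 c)]
    simp only [hdens]
    rw [integral_finsetSum _ fun j _ => ?_]
    · simp only [integral_const_mul]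
    · refine Integrable.const_mul ?_ _
      have := (isCutoff_single (ha j) (hb j) (hχ j) (h0 j)).integrableOn_energyDensity hp hu e
      rwa [if_pos rfl] at this
  have hQneg : ∀ c : Fin (k + 1) → ℝ, c ≠ 0 → G.Q p lam ρ u (φ (χs c)) < 0 := by
    intro c hc
    obtain ⟨j, hj⟩ := Function.ne_iff.1 hc
    rw [hQ]
    refine Finset.sum_neg' (fun i _ => mul_nonpos_of_nonneg_of_nonpos (sq_nonneg _) (hneg i).le)
      ⟨j, Finset.mem_univ _, mul_neg_of_pos_of_neg (by have : c j ≠ 0 := hj; positivity) (hneg j)⟩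
  have hQ0 : G.Q p lam ρ u 0 = 0 := by simp [Q]
  -- A vanishing nontrivial combination would have `Q = 0`, although `Q` is negative at every
  -- nontrivial combination.
  have hli : LinearIndependent ℝ fun j => φ (χ j) := by
    rw [Fintype.linearIndependent_iff]
    intro c hc
    by_contra! hne
    have := hQneg c fun h => by simp [h] at hne
    rw [← hlin, hc, hQ0] at this
    exact lt_irrefl _ this
  set W := Submodule.span ℝ (Set.range fun j => φ (χ j)) with hW
  have hmem : ∀ f ∈ W, ∃ c, f = φ (χs c) := fun f hf => by
    obtain ⟨c, hc⟩ := (Submodule.mem_span_range_iff_exists_fun ℝ).1 hf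
    exact ⟨c, by rw [← hc, hlin]⟩
  have hle : Cardinal.toENat (Module.rank ℝ W) ≤ G.morseIndex p lam ρ u := by
    unfold morseIndex
    refine le_iSup_of_le W (le_iSup_of_le ?_ (le_iSup_of_le ?_ le_rfl))
    · intro f hf
      obtain ⟨c, rfl⟩ := hmem f hf
      exact ⟨(hcut c).memH1 hu, (hcut c).hasCompactSupport u⟩
    · intro f hf hf0
      obtain ⟨c, rfl⟩ := hmem f hf
      refine hQneg c fun h => hf0 ?_
      rw [← hlin, h]; simp
  have hrank : Cardinal.toENat (Module.rank ℝ W) = ((k + 1 : ℕ) : ℕ∞) := by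
    have : Module.Finite ℝ W := Module.Finite.span_of_finite ℝ (Set.finite_range _)
    rw [← Module.finrank_eq_rank, finrank_span_eq_card hli, Fintype.card_fin]
    simp
  rw [hrank] at hle
  have := hle.trans hk
  rw [Nat.cast_le] at this
  omega

lemma hasDerivWithinAt_profile (hu : G.IsPositiveSolution p lam ρ u) {e : E} {s₀ ς δ : ℝ} {T : Set ℝ}
    (hT : ∀ y ∈ T, s₀ + ς * δ * y ∈ G.I e) {y : ℝ} (hy : y ∈ T) :
    HasDerivWithinAt (profile p u e s₀ ς δ) (profileDeriv p u e s₀ ς δ y) T y := by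
  have hd : HasDerivWithinAt (fun y => s₀ + ς * δ * y) (ς * δ) T y := by
    simpa using ((hasDerivWithinAt_id y T).const_mul (ς * δ)).const_add s₀
  have h1 := ((hu.hasDerivWithinAt (hT y hy)).scomp y hd hT).const_mul (δ ^ (2 / (p - 2)))
  exact h1.congr_deriv (by simp [profileDeriv])

lemma hasDerivWithinAt_profileDeriv (hp : 2 < p) (hu : G.IsPositiveSolution p lam ρ u) {e : E}
    {s₀ ς δ : ℝ} {T : Set ℝ} (hς : ς ^ 2 = 1) (hδ : 0 < δ)
    (hT : ∀ y ∈ T, s₀ + ς * δ * y ∈ G.I e) {y : ℝ} (hy : y ∈ T) :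
    HasDerivWithinAt (profileDeriv p u e s₀ ς δ) (δ ^ 2 * lam * profile p u e s₀ ς δ y -
      ρ * profile p u e s₀ ς δ y ^ (p - 1)) T y := by
  have hd : HasDerivWithinAt (fun y => s₀ + ς * δ * y) (ς * δ) T y := by
    simpa using ((hasDerivWithinAt_id y T).const_mul (ς * δ)).const_add s₀
  have h1 := (((hu.hasDerivWithinAt_edgeDeriv (hT y hy)).scomp y hd hT).const_mul
    (ς * δ)).const_mul (δ ^ (2 / (p - 2)))
  refine h1.congr_deriv ?_
  have hu0 := hu.pos (G.pt e (s₀ + ς * δ * y))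
  have e1 : (δ ^ (2 / (p - 2)) * u (G.pt e (s₀ + ς * δ * y))) ^ (p - 1) =
      δ ^ (2 / (p - 2)) * δ ^ 2 * u (G.pt e (s₀ + ς * δ * y)) ^ (p - 1) := by
    rw [Real.mul_rpow (Real.rpow_nonneg hδ.le _) hu0.le, ← Real.rpow_mul hδ.le,
      ← Real.rpow_two, ← Real.rpow_add hδ]
    congr 2
    have : p - 2 ≠ 0 := by linarith
    field_simp
    ring
  simp only [profile, smul_eq_mul]
  rw [e1]
  linear_combination (δ ^ (2 / (p - 2)) * δ ^ 2 * (lam * u (G.pt e (s₀ + ς * δ * y)) -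
    ρ * u (G.pt e (s₀ + ς * δ * y)) ^ (p - 1))) * hς

lemma isSolOn_profile (hp : 2 < p) (hu : G.IsPositiveSolution p lam ρ u) {e : E} {s₀ ς δ L : ℝ}
    (hς : ς ^ 2 = 1) (hδ : 0 < δ) (hI : ∀ y ∈ Icc 0 L, s₀ + ς * δ * y ∈ G.I e) :
    IsSolOn p (δ ^ 2 * lam) ρ L (profile p u e s₀ ς δ) (profileDeriv p u e s₀ ς δ) where
  deriv _ hy := hasDerivWithinAt_profile hu hI hy
  deriv2 _ hy := hasDerivWithinAt_profileDeriv hp hu hς hδ hI hy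
  nonneg _ _ := mul_nonneg (Real.rpow_nonneg hδ.le _) (hu.pos _).le

/-- The rescaling carries windows in `(0, L)` to windows strictly inside the edge, and changes the
quadratic form only by a positive factor; so the Morse index bound passes to the profile with the
same `k`. -/
lemma noWindows_profile [Fintype V] {k : ℕ} (hp : 2 < p) (hu : G.IsPositiveSolution p lam ρ u)
    (hk : G.morseIndex p lam ρ u ≤ k) {e : E} {s₀ ς δ L : ℝ} (hς : ς ^ 2 = 1) (hδ : 0 < δ)
    (hI : ∀ y ∈ Icc 0 L, s₀ + ς * δ * y ∈ G.I e) :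
    NoWindows k p ρ L (profile p u e s₀ ς δ) := by
  intro a b hab hdisj χ hχ h0
  have hmem : ∀ {j y}, y ∈ Icc (a j) (b j) → y ∈ Icc 0 L := fun {j y} hy =>
    ⟨(hab j).1.le.trans hy.1, hy.2.trans (hab j).2.2.le⟩
  have hL : 0 < L := (hab 0).1.trans ((hab 0).2.1.trans (hab 0).2.2)
  have hI0 := hI 0 ⟨le_rfl, hL.le⟩
  have hIL := hI L ⟨hL.le, le_rfl⟩
  have hlt : ∀ {x y}, 0 ≤ x → x < y → ENNReal.ofReal y ≤ G.len e → ENNReal.ofReal x < G.len e :=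
    fun hx hxy hy => ((ENNReal.ofReal_lt_ofReal_iff_of_nonneg hx).2 hxy).trans_le hy
  obtain ⟨a', b', ha', hb', h1, h2⟩ : ∃ a' b' : Fin (k + 1) → ℝ, (∀ j, 0 < a' j) ∧
      (∀ j, ENNReal.ofReal (b' j) < G.len e) ∧
      (∀ j s, s ∈ Icc (a' j) (b' j) → ς / δ * (s - s₀) ∈ Icc (a j) (b j)) ∧
      ∀ j s, s ∉ Ioo (a' j) (b' j) → ς / δ * (s - s₀) ∉ Ioo (a j) (b j) := by
    have hς' : ς = 1 ∨ ς = -1 := by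
      have : (ς - 1) * (ς + 1) = 0 := by linear_combination hς
      rcases mul_eq_zero.1 this with h | h
      exacts [Or.inl (by linarith), Or.inr (by linarith)]
    have hm : ∀ j, 0 < δ * a j ∧ δ * a j < δ * b j ∧ δ * b j < δ * L := fun j =>
      ⟨mul_pos hδ (hab j).1, mul_lt_mul_of_pos_left (hab j).2.1 hδ,
        mul_lt_mul_of_pos_left (hab j).2.2 hδ⟩
    rcases hς' with rfl | rfl
    · simp only [mul_zero, add_zero, one_mul] at hI0 hIL
      refine ⟨fun j => s₀ + δ * a j, fun j => s₀ + δ * b j, fun j => ?_, fun j => ?_,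
        fun j s hs => ?_, fun j s hs hs' => hs ?_⟩
      · have := hm j; have := hI0.1; linarith
      · have := hm j; have := hI0.1
        exact hlt (by linarith) (by linarith) hIL.2
      · rw [one_div, inv_mul_eq_div]
        exact ⟨(le_div_iff₀' hδ).2 (by linarith [hs.1]), (div_le_iff₀' hδ).2 (by linarith [hs.2])⟩
      · rw [one_div, inv_mul_eq_div] at hs'
        have g1 := (lt_div_iff₀' hδ).1 hs'.1
        have g2 := (div_lt_iff₀' hδ).1 hs'.2
        exact ⟨by linarith, by linarith⟩
    -- For `ς = -1` the ray runs against the edge coordinate, so the two ends of each window are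
    -- exchanged.
    · simp only [mul_zero, add_zero, neg_mul, one_mul] at hI0 hIL
      refine ⟨fun j => s₀ - δ * b j, fun j => s₀ - δ * a j, fun j => ?_, fun j => ?_,
        fun j s hs => ?_, fun j s hs hs' => hs ?_⟩
      · have := hm j; have := hIL.1; linarith
      · have := hm j; have := hIL.1
        exact hlt (by linarith) (by linarith) hI0.2
      · rw [show -1 / δ * (s - s₀) = (s₀ - s) / δ by ring]
        exact ⟨(le_div_iff₀' hδ).2 (by linarith [hs.2]), (div_le_iff₀' hδ).2 (by linarith [hs.1])⟩
      · rw [show -1 / δ * (s - s₀) = (s₀ - s) / δ by ring] at hs'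
        have g1 := (lt_div_iff₀' hδ).1 hs'.1
        have g2 := (div_lt_iff₀' hδ).1 hs'.2
        exact ⟨by linarith, by linarith⟩
  obtain ⟨j, hj⟩ := exists_nonneg_of_morseIndex_le hp hu hk (a := a') (b := b')
    (χ := fun j s => χ j (ς / δ * (s - s₀))) ha' hb'
    (fun i j hij => Set.disjoint_left.2 fun s hs hs' =>
      Set.disjoint_left.1 (hdisj hij) (h1 i s hs) (h1 j s hs'))
    (fun j => (hχ j).comp (contDiff_const.mul (contDiff_id.sub contDiff_const)))
    (fun j s hs => h0 j _ (h2 j s hs))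
  refine ⟨j, ?_⟩
  rw [integral_energyDensity_profile hp hu.pos hς hδ (isClosed_I e).measurableSet] at hj
  have hj' := nonneg_of_mul_nonneg_right hj (Real.rpow_pos_of_pos hδ _)
  -- The density vanishes outside the window, so the integral over the rescaled edge reduces to the
  -- window.
  rw [setIntegral_eq_of_subset_of_forall_sdiff_eq_zero (s := Icc (a j) (b j))
    (t := {y | s₀ + ς * δ * y ∈ G.I e}) ?_
    (fun y hy => hI y (hmem hy)) fun y hy => ?_, integral_Icc_eq_integral_Ioc,
    ← intervalIntegral.integral_of_le (hab j).2.1.le] at hj'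
  · exact hj'
  · exact ((isClosed_I e).preimage (by fun_prop)).measurableSet
  · exact IsCutoff.energyDensity_eq_zero (h0 j y fun h => hy.2 (Ioo_subset_Icc_self h))
      (deriv_eq_zero_of_notMem_Icc (h0 j) hy.2)

end MetricGraph

/-! ### The blow-up on finitely many rays -/

namespace MetricGraph

/-- `V` is a positive solution of `-V'' + V = V ^ (p - 1)` on the star graph with branches `ι`, with
derivative `W`, which has finite energy and a maximum at the coordinate `xbar` of the branch `i₁`. -/
structure IsStarSoliton {ι : Type*} [Fintype ι] (p : ℝ) (i₁ : ι) (xbar : ℝ) (V W : ι → ℝ → ℝ) :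
    Prop where
  sol : ∀ i b, IsSolOn p 1 1 b (V i) (W i)
  pos : ∀ i y, 0 ≤ y → 0 < V i y
  nonneg : 0 ≤ xbar
  le : ∀ i y, 0 ≤ y → V i y ≤ V i₁ xbar
  eq_zero : ∀ i j, V i 0 = V j 0
  kirchhoff : ∑ i, W i 0 = 0
  tendsto : ∀ i, Tendsto (V i) atTop (𝓝 0)
  integrable : ∀ i, IntegrableOn (fun y => V i y ^ 2) (Ioi 0)
  integrable' : ∀ i, IntegrableOn (fun y => W i y ^ 2) (Ioi 0)

variable {V E : Type*} {G : MetricGraph V E}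

lemma profile_div {p η : ℝ} {u : G.Point → ℝ} {e : E} {s₀ ς t : ℝ} (hη : 0 < η) :
    profile p u e s₀ ς η (t / η) = η ^ (2 / (p - 2)) * u (G.pt e (s₀ + ς * t)) := by
  rw [profile, mul_assoc, mul_div_cancel₀ _ hη.ne']

variable [Fintype E]

/-- The solutions `u n` are considered on rays with common starting point, along which they attain
their maximum at the coordinate `t n` of the ray `i₁`. -/
structure IsBlowUp {ι : Type*} [Fintype ι] (G : MetricGraph V E) (p : ℝ) (lam ρ : ℕ → ℝ)
    (u : ℕ → G.Point → ℝ) (e : ι → E) (s₀ : ι → ℕ → ℝ) (ς : ι → ℝ) (ℓ : ℕ → ℝ) (i₁ : ι) (t δ : ℕ → ℝ)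
    (B : ℝ) : Prop where
  lam_pos : ∀ n, 0 < lam n
  tendsto_rho : Tendsto ρ atTop (𝓝 1)
  sol : ∀ n, G.IsPositiveSolution p (lam n) (ρ n) (u n)
  sign : ∀ i, ς i ^ 2 = 1
  mem : ∀ i n, ∀ τ ∈ Icc 0 (ℓ n), s₀ i n + ς i * τ ∈ G.I (e i)
  start : ∀ i j n, G.pt (e i) (s₀ i n) = G.pt (e j) (s₀ j n)
  kirchhoff : ∀ n, ∑ i, ς i * edgeDeriv (u n) (e i) (s₀ i n) = 0
  t_mem : ∀ n, t n ∈ Icc 0 (B * δ n)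
  max : ∀ i n, ∀ τ ∈ Icc 0 (ℓ n),
    u n (G.pt (e i) (s₀ i n + ς i * τ)) ≤ u n (G.pt (e i₁) (s₀ i₁ n + ς i₁ * t n))
  delta : ∀ n, δ n = u n (G.pt (e i₁) (s₀ i₁ n + ς i₁ * t n)) ^ (-((p - 2) / 2))
  tendsto_len : Tendsto (fun n => ℓ n / δ n) atTop atTop
  le : ∀ n, δ n ^ 2 * lam n ≤ ρ n

namespace IsBlowUp

variable {ι : Type*} [Fintype ι] {p : ℝ} {lam ρ : ℕ → ℝ} {u : ℕ → G.Point → ℝ} {e : ι → E}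
  {s₀ : ι → ℕ → ℝ} {ς : ι → ℝ} {ℓ : ℕ → ℝ} {i₁ : ι} {t δ : ℕ → ℝ} {B : ℝ}

lemma delta_pos (h : IsBlowUp G p lam ρ u e s₀ ς ℓ i₁ t δ B) (n : ℕ) : 0 < δ n := by
  rw [h.delta]; exact Real.rpow_pos_of_pos ((h.sol n).pos _) _

/-- The normalization behind the choice of `δ`: the rescaled solution has maximum exactly 1, which
cannot be lost in the limit. -/
lemma delta_rpow_mul (hp : 2 < p) (h : IsBlowUp G p lam ρ u e s₀ ς ℓ i₁ t δ B) (n : ℕ) :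
    δ n ^ (2 / (p - 2)) * u n (G.pt (e i₁) (s₀ i₁ n + ς i₁ * t n)) = 1 := by
  have hu := (h.sol n).pos (G.pt (e i₁) (s₀ i₁ n + ς i₁ * t n))
  rw [h.delta, ← Real.rpow_mul hu.le]
  nth_rw 2 [← Real.rpow_one (u n _)]
  rw [← Real.rpow_add hu]
  have : p - 2 ≠ 0 := by linarith
  rw [show -((p - 2) / 2) * (2 / (p - 2)) + 1 = 0 by field_simp; ring, Real.rpow_zero]

section profile

variable {ε : ℕ → ℝ}

lemma isSolOn (hp : 2 < p) (h : IsBlowUp G p lam ρ u e s₀ ς ℓ i₁ t δ B) {η : ℝ} (hη : 0 < η)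
    (i : ι) (n : ℕ) : IsSolOn p (η ^ 2 * lam n) (ρ n) (ℓ n / η)
      (profile p (u n) (e i) (s₀ i n) (ς i) η) (profileDeriv p (u n) (e i) (s₀ i n) (ς i) η) := by
  refine isSolOn_profile hp (h.sol n) (h.sign i) hη fun y hy => ?_
  rw [mul_assoc]
  exact h.mem i n _ ⟨mul_nonneg hη.le hy.1, (le_div_iff₀' hη).1 hy.2⟩

lemma profile_start (h : IsBlowUp G p lam ρ u e s₀ ς ℓ i₁ t δ B) {η : ℝ} (i j : ι) (n : ℕ) :
    profile p (u n) (e i) (s₀ i n) (ς i) η 0 = profile p (u n) (e j) (s₀ j n) (ς j) η 0 := by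
  simp [profile, h.start i j n]

lemma sum_profileDeriv (h : IsBlowUp G p lam ρ u e s₀ ς ℓ i₁ t δ B) {η : ℝ} (n : ℕ) :
    ∑ i, profileDeriv p (u n) (e i) (s₀ i n) (ς i) η 0 = 0 := by
  have := congrArg (fun x => η ^ (2 / (p - 2)) * η * x) (h.kirchhoff n)
  simp only [mul_zero, Finset.mul_sum] at this
  refine Eq.trans (Finset.sum_congr rfl fun i _ => ?_) this
  simp only [profileDeriv, mul_zero, add_zero]
  ring

lemma profile_le (h : IsBlowUp G p lam ρ u e s₀ ς ℓ i₁ t δ B) {η : ℝ} (hη : 0 < η) (i : ι) (n : ℕ)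
    {y : ℝ} (hy : y ∈ Icc 0 (ℓ n / η)) : profile p (u n) (e i) (s₀ i n) (ς i) η y ≤
      profile p (u n) (e i₁) (s₀ i₁ n) (ς i₁) η (t n / η) := by
  rw [profile_div hη, profile, mul_assoc]
  exact mul_le_mul_of_nonneg_left
    (h.max i n _ ⟨mul_nonneg hη.le hy.1, (le_div_iff₀' hη).1 hy.2⟩) (Real.rpow_nonneg hη.le _)

end profile

lemma comp (h : IsBlowUp G p lam ρ u e s₀ ς ℓ i₁ t δ B) {τ : ℕ → ℕ} (hτ : StrictMono τ) :
    IsBlowUp G p (lam ∘ τ) (ρ ∘ τ) (u ∘ τ) e (fun i => s₀ i ∘ τ) ς (ℓ ∘ τ) i₁ (t ∘ τ) (δ ∘ τ) B where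
  lam_pos _ := h.lam_pos _
  tendsto_rho := h.tendsto_rho.comp hτ.tendsto_atTop
  sol _ := h.sol _
  sign := h.sign
  mem i _ := h.mem i _
  start i j _ := h.start i j _
  kirchhoff _ := h.kirchhoff _
  t_mem _ := h.t_mem _
  max i _ := h.max i _
  delta _ := h.delta _
  tendsto_len := h.tendsto_len.comp hτ.tendsto_atTop
  le _ := h.le _

/-- The two length scales are comparable. -/
lemma exists_tendsto_coeff (hp : 2 < p) (h : IsBlowUp G p lam ρ u e s₀ ς ℓ i₁ t δ B) :
    ∃ τ : ℕ → ℕ, StrictMono τ ∧ ∃ a₀, 0 < a₀ ∧ a₀ ≤ 1 ∧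
      Tendsto (fun n => δ (τ n) ^ 2 * lam (τ n)) atTop (𝓝 a₀) := by
  obtain ⟨A, hA⟩ := h.tendsto_rho.bddAbove_range
  have hnn : ∀ n, 0 ≤ δ n ^ 2 * lam n := fun n => by
    have := h.lam_pos n
    positivity
  obtain ⟨a₀, ha₀, τ, hτ, hlim⟩ := isCompact_Icc.tendsto_subseq (x := fun n => δ n ^ 2 * lam n)
    fun n => ⟨hnn n, (h.le n).trans (hA (mem_range_self n))⟩
  -- The case `a₀ = 0` is refuted: the limit would solve the equation without linear term, hence be
  -- zero by `star_eq_zero`, while it takes the value 1 on the branch `i₁`. The Morse index plays no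
  -- role here.
  refine ⟨τ, hτ, a₀, ha₀.1.lt_of_ne fun h0 => ?_, le_of_tendsto_of_tendsto' hlim
    (h.tendsto_rho.comp hτ.tendsto_atTop) fun n => h.le _, hlim⟩
  have h' := h.comp hτ
  have hval : ∀ n, profile p ((u ∘ τ) n) (e i₁) ((s₀ i₁ ∘ τ) n) (ς i₁) ((δ ∘ τ) n)
      ((t ∘ τ) n / (δ ∘ τ) n) = 1 := fun n =>
    (profile_div (h'.delta_pos n)).trans (h'.delta_rpow_mul hp n)
  obtain ⟨σ, -, z₀, V, W, hz, -, -, -, hsol, -, -, hK, hV⟩ := exists_star_limit hp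
    (f := fun i n => profile p ((u ∘ τ) n) (e i) ((s₀ i ∘ τ) n) (ς i) ((δ ∘ τ) n))
    (z := fun n => (t ∘ τ) n / (δ ∘ τ) n) (B := B) (m := 1) (M := 1) i₁ h'.tendsto_len
    (fun i n => h'.isSolOn hp (h'.delta_pos n) i n) hlim h'.tendsto_rho
    (fun n => ⟨div_nonneg (h'.t_mem n).1 (h'.delta_pos n).le,
      (div_le_iff₀ (h'.delta_pos n)).2 (h'.t_mem n).2⟩)
    (fun i n y hy => h'.profile_le (h'.delta_pos n) i n hy) (fun n => (hval n).le)
    (tendsto_const_nhds.congr fun n => (hval n).symm) (fun i j n => h'.profile_start i j n)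
    (fun n => h'.sum_profileDeriv n)
  rw [← h0] at hsol
  rw [star_eq_zero hp hsol hK i₁ hz] at hV
  norm_num at hV

/-- After `exists_tendsto_coeff` the scales `δ` and `ε` are comparable, so rescaling by `ε` keeps
the solutions bounded and makes the linear coefficient 1. The limit along the rays is positive by
`star_pos`, and the Morse index gives its finite energy. -/
theorem exists_limit [Fintype V] {k : ℕ} (hp : 2 < p) (h : IsBlowUp G p lam ρ u e s₀ ς ℓ i₁ t δ B)
    (hk : ∀ n, G.morseIndex p (lam n) (ρ n) (u n) ≤ k) {ε : ℕ → ℝ}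
    (hε : ∀ n, ε n = lam n ^ (-(1 / 2) : ℝ)) :
    ∃ σ : ℕ → ℕ, StrictMono σ ∧
      (∃ c : ℝ, 0 < c ∧ c ≤ 1 ∧ Tendsto (fun n => δ (σ n) / ε (σ n)) atTop (𝓝 c)) ∧
      Tendsto (fun n => ℓ (σ n) / ε (σ n)) atTop atTop ∧
      ∃ (xbar M : ℝ) (V W : ι → ℝ → ℝ), IsStarSoliton p i₁ xbar V W ∧
        Tendsto (fun n => t (σ n) / ε (σ n)) atTop (𝓝 xbar) ∧
        (∀ i y, 0 ≤ y → V i y ≤ M) ∧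
        (∀ i n, ∀ y ∈ Icc 0 (ℓ (σ n) / ε (σ n)),
          profile p (u (σ n)) (e i) (s₀ i (σ n)) (ς i) (ε (σ n)) y ≤ M) ∧
        (∀ i b, TendstoUniformlyOn
          (fun n => profile p (u (σ n)) (e i) (s₀ i (σ n)) (ς i) (ε (σ n))) (V i) atTop (Icc 0 b)) ∧
        (∀ i b, TendstoUniformlyOn
          (fun n => profileDeriv p (u (σ n)) (e i) (s₀ i (σ n)) (ς i) (ε (σ n))) (W i) atTop
            (Icc 0 b)) ∧
        ∃ R : ℝ, 0 < R ∧ ∀ n, 2 * R < ℓ (σ n) / ε (σ n) ∧ ∑ i, ∫ y in (0 : ℝ)..(2 * R),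
          energyDensity p (ρ (σ n)) (profile p (u (σ n)) (e i) (s₀ i (σ n)) (ς i) (ε (σ n)))
            (cutoff (-(2 * R)) (2 * R) R) y < 0 := by
  obtain ⟨τ, hτ, a₀, ha₀, ha₁, hlim⟩ := h.exists_tendsto_coeff hp
  have hε0 : ∀ n, 0 < ε n := fun n => by rw [hε]; exact Real.rpow_pos_of_pos (h.lam_pos n) _
  have hε2 : ∀ n, ε n ^ 2 * lam n = 1 := fun n => by
    have hl := h.lam_pos n
    rw [hε, ← Real.rpow_natCast, ← Real.rpow_mul hl.le]
    nth_rw 2 [← Real.rpow_one (lam n)]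
    rw [← Real.rpow_add hl]
    norm_num
  -- Because `ε² λ = 1`; the convergence of the coefficient is thus that of the ratio of the scales.
  have hquot : ∀ n, δ n / ε n = √(δ n ^ 2 * lam n) := fun n => by
    symm
    rw [Real.sqrt_eq_iff_mul_self_eq (by have := h.lam_pos n; positivity)
      (div_nonneg (h.delta_pos n).le (hε0 n).le)]
    have h1 := hε2 n
    have h2 := (hε0 n).ne'
    field_simp
    linear_combination (δ n ^ 2) * h1
  have hc : Tendsto (fun n => δ (τ n) / ε (τ n)) atTop (𝓝 √a₀) := by
    simp only [hquot]
    exact (Real.continuous_sqrt.tendsto _).comp hlim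
  have hc0 : 0 < √a₀ := Real.sqrt_pos.2 ha₀
  obtain ⟨C, hC⟩ := hc.bddAbove_range
  have hL : Tendsto (fun n => ℓ (τ n) / ε (τ n)) atTop atTop := by
    refine ((h.tendsto_len.comp hτ.tendsto_atTop).atTop_mul_pos hc0 hc).congr fun n => ?_
    have h1 := (h.delta_pos (τ n)).ne'
    have h2 := (hε0 (τ n)).ne'
    simp only [Function.comp_apply]
    field_simp
  -- In the scale `ε` the maximum is no longer 1 but a power of the ratio of the scales, which
  -- converges to a positive number.
  have hval : ∀ n, profile p (u (τ n)) (e i₁) (s₀ i₁ (τ n)) (ς i₁) (ε (τ n)) (t (τ n) / ε (τ n)) =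
      ((δ (τ n) / ε (τ n)) ^ (2 / (p - 2)))⁻¹ := fun n => by
    rw [profile_div (hε0 _), Real.div_rpow (h.delta_pos _).le (hε0 _).le, inv_div,
      eq_div_iff (Real.rpow_pos_of_pos (h.delta_pos _) _).ne', mul_assoc,
      mul_comm (u (τ n) _), h.delta_rpow_mul hp, mul_one]
  have hm : Tendsto (fun n => profile p (u (τ n)) (e i₁) (s₀ i₁ (τ n)) (ς i₁) (ε (τ n))
      (t (τ n) / ε (τ n))) atTop (𝓝 (√a₀ ^ (2 / (p - 2)))⁻¹) := by
    simp only [hval]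
    exact (hc.rpow_const (Or.inl hc0.ne')).inv₀ (Real.rpow_pos_of_pos hc0 _).ne'
  obtain ⟨M, hM⟩ := hm.bddAbove_range
  have hM' : ∀ n, profile p (u (τ n)) (e i₁) (s₀ i₁ (τ n)) (ς i₁) (ε (τ n))
      (t (τ n) / ε (τ n)) ≤ M := fun n => hM (mem_range_self n)
  -- The maximum stays at bounded distance from the centre in the scale `ε` too. `|B|` appears since
  -- the sign of `B` is not recorded in `IsBlowUp`.
  have hz : ∀ n, t (τ n) / ε (τ n) ∈ Icc 0 (|B| * C) := fun n => by
    have h1 := h.t_mem (τ n)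
    have h2 := hε0 (τ n)
    refine ⟨div_nonneg h1.1 h2.le, ?_⟩
    have h3 : δ (τ n) / ε (τ n) ≤ C := hC (mem_range_self n)
    calc t (τ n) / ε (τ n) ≤ |B| * δ (τ n) / ε (τ n) :=
          (div_le_div_iff_of_pos_right h2).2
            (h1.2.trans (mul_le_mul_of_nonneg_right (le_abs_self B) (h.delta_pos _).le))
      _ = |B| * (δ (τ n) / ε (τ n)) := by ring
      _ ≤ |B| * C := mul_le_mul_of_nonneg_left h3 (abs_nonneg B)
  have hsol := fun i n => h.isSolOn hp (hε0 (τ n)) i (τ n)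
  simp only [hε2] at hsol
  obtain ⟨σ, hσ, xbar, V, W, hx, hxl, hV, hW, hVW, hVm, hV0, hK, hVx⟩ := exists_star_limit hp
    (z := fun n => t (τ n) / ε (τ n)) (B := |B| * C) i₁ hL hsol tendsto_const_nhds
    (h.tendsto_rho.comp hτ.tendsto_atTop) hz
    (fun i n y hy => h.profile_le (hε0 _) i _ hy) hM' hm (fun i j n => h.profile_start i j _)
    (fun n => h.sum_profileDeriv _)
  set m := (√a₀ ^ (2 / (p - 2)))⁻¹ with hmdef
  have hm0 : 0 < m := inv_pos.2 (Real.rpow_pos_of_pos hc0 _)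
  have hmM : m ≤ M := le_of_tendsto' hm hM'
  have hpos : ∀ i y, 0 ≤ y → 0 < V i y := fun i y hy =>
    star_pos hp hVW hVm hV0 hK hx (by rwa [hVx]) i hy
  have hVM : ∀ i y, 0 ≤ y → V i y ≤ M := fun i y hy => (hVm i y hy).trans hmM
  have hLσ := hL.comp hσ.tendsto_atTop
  have hρσ := h.tendsto_rho.comp (hτ.comp hσ).tendsto_atTop
  have hfM : ∀ i n, ∀ y ∈ Icc 0 (ℓ (τ n) / ε (τ n)),
      profile p (u (τ n)) (e i) (s₀ i (τ n)) (ς i) (ε (τ n)) y ∈ Icc 0 M := fun i n y hy =>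
    ⟨(hsol i n).nonneg y hy, (h.profile_le (hε0 _) i _ hy).trans (hM' n)⟩
  have hder : ∀ i, ∃ C, ∀ y, 0 ≤ y → |W i y| ≤ C := fun i => ⟨_, fun y hy =>
    (hVW i (y + 1)).abs_deriv_le hp (fun z hz => hVm i z hz.1) (A := 1) (by simp) (by simp) hy le_rfl⟩
  -- The only use of the Morse index: `noWindows_profile` on each ray separately.
  have hint : ∀ i, ∃ K, ∀ T, 0 ≤ T → ∫ y in (0 : ℝ)..T, V i y ^ p ≤ K := fun i =>
    exists_integral_rpow_le hp hLσ hρσ (fun n => (hsol i (σ n)).continuousOn)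
      (fun n => hfM i (σ n)) (fun y hy => ⟨(hpos i y hy).le, hVM i y hy⟩) (hV i)
      fun n => noWindows_profile hp (h.sol _) (hk _) (h.sign i) (hε0 _) fun y hy => by
        rw [mul_assoc]
        exact h.mem i _ _ ⟨mul_nonneg (hε0 _).le hy.1, (le_div_iff₀' (hε0 _)).1 hy.2⟩
  choose Cd hCd using hder
  choose K hKp using hint
  obtain ⟨R, hR, hRn⟩ := exists_sum_integral_cutoff_neg hp i₁ hLσ hρσ
    (fun i n => (hsol i (σ n)).continuousOn) (fun i n => hfM i (σ n))
    (fun y hy => ⟨hpos i₁ y hy, hVM i₁ y hy⟩) (hV i₁)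
  -- The negative direction exists for large `n` only; the subsequence is shifted by `N` so that it
  -- exists for every index.
  obtain ⟨N, hN⟩ := eventually_atTop.1 ((hLσ.eventually_gt_atTop (2 * R)).and hRn)
  have hNt : Tendsto (fun n => n + N) atTop atTop := tendsto_add_atTop_nat N
  refine ⟨fun n => τ (σ (n + N)), fun m n hmn => hτ (hσ (Nat.add_lt_add_right hmn N)),
    ⟨√a₀, hc0, ?_, (hc.comp hσ.tendsto_atTop).comp hNt⟩, hLσ.comp hNt, xbar, M, V, W, ?_,
    hxl.comp hNt, hVM, fun i n y hy => (hfM i (σ (n + N)) y hy).2,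
    fun i b s hs => hNt.eventually (hV i b s hs), fun i b s hs => hNt.eventually (hW i b s hs),
    R, hR, fun n => hN (n + N) (Nat.le_add_left N n)⟩
  · rw [← Real.sqrt_one]; exact Real.sqrt_le_sqrt ha₁
  · exact
      { sol := hVW
        pos := hpos
        nonneg := hx
        le := fun i y hy => by rw [hVx]; exact hVm i y hy
        eq_zero := hV0
        kirchhoff := hK
        tendsto := fun i => IsSolOn.tendsto_zero hp (hVW i) (hVm i) (hCd i) (hKp i)
        integrable := fun i => (IsSolOn.integrableOn_sq hp (hVW i) (hVm i) (hCd i) (hKp i)).1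
        integrable' := fun i => (IsSolOn.integrableOn_sq hp (hVW i) (hVm i) (hCd i) (hKp i)).2 }

end IsBlowUp

end MetricGraph

/-! ### Folding two half-lines into a line, and uniqueness of the soliton -/

namespace MetricGraph

/-- The function on the real line that is given by `f` on `[0, ∞)` and by the reflection of `g` on
`(-∞, 0)`. -/
noncomputable def fold (f g : ℝ → ℝ) (y : ℝ) : ℝ := if 0 ≤ y then f y else g (-y)

section fold

variable {f g f' g' : ℝ → ℝ}

lemma fold_of_nonneg {y : ℝ} (hy : 0 ≤ y) : fold f g y = f y := if_pos hy

lemma fold_of_nonpos (h0 : f 0 = g 0) {y : ℝ} (hy : y ≤ 0) : fold f g y = g (-y) := by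
  rcases hy.eq_or_lt with rfl | hy
  · rw [fold_of_nonneg le_rfl, neg_zero, h0]
  · exact if_neg (not_le.2 hy)

lemma fold_eq_self (h : ∀ y, f (-y) = g y) : fold f g = f := by
  funext y
  rcases le_total 0 y with hy | hy
  · exact fold_of_nonneg hy
  · rw [fold_of_nonpos (by rw [← h, neg_zero]) hy, ← h, neg_neg]

/-- Only the point 0 is delicate: the two one-sided derivatives agree by `h0'`, which for a star
with two branches is the Kirchhoff condition. -/
lemma hasDerivAt_fold (hf : ∀ y, 0 ≤ y → HasDerivWithinAt f (f' y) (Ici 0) y)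
    (hg : ∀ y, 0 ≤ y → HasDerivWithinAt g (g' y) (Ici 0) y) (h0 : f 0 = g 0) (h0' : f' 0 = -g' 0)
    (y : ℝ) : HasDerivAt (fold f g) (fold f' (fun y => -g' y) y) y := by
  have h1 : ∀ y, 0 ≤ y → HasDerivWithinAt (fold f g) (fold f' (fun y => -g' y) y) (Ici 0) y :=
    fun y hy => by
      rw [fold_of_nonneg (f := f') hy]
      exact (hf y hy).congr (fun z hz => fold_of_nonneg hz) (fold_of_nonneg hy)
  have h2 : ∀ y, y ≤ 0 → HasDerivWithinAt (fold f g) (fold f' (fun y => -g' y) y) (Iic 0) y :=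
    fun y hy => by
      rw [fold_of_nonpos (f := f') h0' hy]
      refine HasDerivWithinAt.congr ?_ (fun z hz => fold_of_nonpos h0 hz) (fold_of_nonpos h0 hy)
      have := (hg (-y) (neg_nonneg.2 hy)).scomp y (hasDerivWithinAt_neg y (Iic 0))
        fun z hz => mem_Ici.2 (neg_nonneg.2 (mem_Iic.1 hz))
      exact this.congr_deriv (by simp)
  rcases lt_trichotomy y 0 with hy | rfl | hy
  · exact (h2 y hy.le).hasDerivAt (Iic_mem_nhds hy)
  · have := (h2 0 le_rfl).union (h1 0 le_rfl)
    rwa [Iic_union_Ici, hasDerivWithinAt_univ] at this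
  · exact (h1 y hy.le).hasDerivAt (Ici_mem_nhds hy)

lemma tendstoUniformlyOn_fold {F H : ℕ → ℝ → ℝ} {b : ℝ} (hf : TendstoUniformlyOn F f atTop (Icc 0 b))
    (hg : TendstoUniformlyOn H g atTop (Icc 0 b)) :
    TendstoUniformlyOn (fun n => fold (F n) (H n)) (fold f g) atTop (Icc (-b) b) := by
  rw [Metric.tendstoUniformlyOn_iff] at hf hg ⊢
  intro ε hε
  filter_upwards [hf ε hε, hg ε hε] with n h1 h2 y hy
  unfold fold
  split_ifs with h
  · exact h1 y ⟨h, hy.2⟩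
  · exact h2 (-y) ⟨by linarith, by linarith [hy.1]⟩

lemma integrable_fold (hf : IntegrableOn f (Ioi 0)) (hg : IntegrableOn g (Ioi 0)) :
    Integrable (fold f g) := by
  rw [← integrableOn_univ, ← Iio_union_Ici (a := (0 : ℝ)), integrableOn_union]
  constructor
  · have h1 : IntegrableOn (g ∘ Neg.neg) (Neg.neg ⁻¹' Ioi 0) :=
      ((Measure.measurePreserving_neg volume).integrableOn_comp_preimage
        (Homeomorph.neg ℝ).measurableEmbedding).2 hg
    rw [neg_preimage, neg_Ioi, neg_zero] at h1
    exact h1.congr_fun (fun y hy => (if_neg (not_le.2 hy)).symm) measurableSet_Iio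
  · exact (Iff.mpr integrableOn_Ici_iff_integrableOn_Ioi hf).congr_fun
      (fun y hy => (if_pos hy).symm) measurableSet_Ici

end fold

/-- Solutions on the half-line that vanish at infinity have zero energy. -/
lemma IsSolOn.energy_eq_zero {p : ℝ} {V W : ℝ → ℝ} (hp : 2 < p) (h : ∀ b, IsSolOn p 1 1 b V W)
    (hV : Tendsto V atTop (𝓝 0)) : W 0 ^ 2 / 2 - V 0 ^ 2 / 2 + V 0 ^ p / p = 0 := by
  set F : ℝ → ℝ := fun y => W y ^ 2 / 2 - V y ^ 2 / 2 + V y ^ p / p with hF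
  have hd : ∀ y, 0 ≤ y → HasDerivWithinAt F 0 (Ici 0) y := fun y hy => by
    have h1 := hasDerivWithinAt_Ici h hy
    have h2 := hasDerivWithinAt_Ici' h hy
    refine ((((h2.pow 2).div_const 2).sub ((h1.pow 2).div_const 2)).add
      ((h1.rpow_const (p := p) (Or.inr (by linarith))).div_const p)).congr_deriv ?_
    have : p ≠ 0 := by linarith
    field_simp
    push_cast
    ring
  have hconst : ∀ y, 0 ≤ y → F y = F 0 := fun y hy =>
    constant_of_has_deriv_right_zero
      (fun z hz => ((hd z hz.1).mono Icc_subset_Ici_self).continuousWithinAt)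
      (fun z hz => (hd z hz.1).mono (Ici_subset_Ici.2 hz.1)) y ⟨hy, le_rfl⟩
  -- To evaluate the constant energy at infinity it is enough to have `W → 0` along one sequence;
  -- the mean value theorem on `[n, n + 1]` provides it from `V → 0`.
  have hmvt : ∀ n : ℕ, ∃ ξ : ℝ, (n : ℝ) ≤ ξ ∧ W ξ = V (n + 1) - V n := fun n => by
    have hn : (0 : ℝ) ≤ n := n.cast_nonneg
    obtain ⟨ξ, hξ, hξ'⟩ := exists_hasDerivAt_eq_slope V W (show (n : ℝ) < n + 1 by linarith)
      ((continuousOn_Ici h).mono fun z hz => hn.trans hz.1) fun z hz =>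
        (hasDerivWithinAt_Ici h (hn.trans hz.1.le)).hasDerivAt (Ici_mem_nhds (hn.trans_lt hz.1))
    exact ⟨ξ, hξ.1.le, by rw [hξ']; simp⟩
  choose ξ hξ hWξ using hmvt
  have hξt : Tendsto ξ atTop atTop := tendsto_atTop_mono hξ tendsto_natCast_atTop_atTop
  have hV1 := hV.comp hξt
  have hW1 : Tendsto (W ∘ ξ) atTop (𝓝 0) := by
    have h1 := (hV.comp (tendsto_atTop_add_const_right _ (1 : ℝ) tendsto_natCast_atTop_atTop)).sub
      (hV.comp tendsto_natCast_atTop_atTop)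
    rw [sub_zero] at h1
    exact h1.congr fun n => (hWξ n).symm
  have hlim : Tendsto (F ∘ ξ) atTop (𝓝 (0 ^ 2 / 2 - 0 ^ 2 / 2 + 0 ^ p / p)) :=
    (((hW1.pow 2).div_const 2).sub ((hV1.pow 2).div_const 2)).add
      ((hV1.rpow_const (Or.inr (by linarith))).div_const p)
  rw [Real.zero_rpow (by linarith)] at hlim
  have := tendsto_nhds_unique (hlim.congr fun n => hconst _ (n.cast_nonneg.trans (hξ n)))
    tendsto_const_nhds
  simpa using this.symm

namespace IsSoliton

variable {p : ℝ} {V V' : ℝ → ℝ}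

lemma hasDerivAt (h : IsSoliton p V) (y : ℝ) : HasDerivAt V (deriv V y) y :=
  ((h.contDiff.differentiable (by simp)) y).hasDerivAt

lemma hasDerivAt_deriv (h : IsSoliton p V) (y : ℝ) :
    HasDerivAt (deriv V) (V y - V y ^ (p - 1)) y := by
  have h1 : ContDiff ℝ 1 (deriv V) :=
    (contDiff_succ_iff_deriv (n := 1).1 h.contDiff).2.2
  have h2 := ((h1.differentiable (by simp)) y).hasDerivAt
  have h3 := h.equation y
  rw [iteratedDeriv_succ, iteratedDeriv_one] at h3
  exact h2.congr_deriv (by linarith)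

lemma isSolOn (h : IsSoliton p V) (b : ℝ) : IsSolOn p 1 1 b V (deriv V) where
  deriv y _ := (h.hasDerivAt y).hasDerivWithinAt
  deriv2 y _ := by simpa using (h.hasDerivAt_deriv y).hasDerivWithinAt
  nonneg y _ := (h.pos y).le

lemma deriv_zero (h : IsSoliton p V) : deriv V 0 = 0 :=
  IsLocalMax.deriv_eq_zero (Eventually.of_forall h.max)

lemma reflect (h : IsSoliton p V) : IsSoliton p fun y => V (-y) where
  memH1 := by
    obtain ⟨h1, g, hg, hV⟩ := h.memH1
    rw [Measure.restrict_univ] at h1 hg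
    refine ⟨?_, fun y => -g (-y), ?_, fun a _ b _ => ?_⟩
    · rw [Measure.restrict_univ]
      exact h1.comp_measurePreserving (Measure.measurePreserving_neg volume)
    · rw [Measure.restrict_univ]
      exact (hg.comp_measurePreserving (Measure.measurePreserving_neg volume)).neg
    · rw [hV (-a) trivial (-b) trivial, intervalIntegral.integral_neg,
        intervalIntegral.integral_comp_neg, intervalIntegral.integral_symm]
  contDiff := h.contDiff.comp contDiff_neg
  pos y := h.pos _
  equation y := by
    have := h.equation (-y)
    rw [iteratedDeriv_comp_neg]
    simpa using this
  max y := by simpa using h.max (-y)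
  tendsto := h.tendsto.comp (Homeomorph.neg ℝ).isClosedEmbedding.tendsto_cocompact

/-- The value of a soliton at its maximum. -/
lemma apply_zero (hp : 2 < p) (h : IsSoliton p V) : V 0 = (p / 2) ^ (1 / (p - 2)) := by
  have hE := IsSolOn.energy_eq_zero hp h.isSolOn
    (h.tendsto.mono_left (cocompact_eq_atBot_atTop (α := ℝ) ▸ le_sup_right))
  have h0 := h.pos 0
  have hpow : V 0 ^ p = V 0 ^ (p - 2) * V 0 ^ 2 := by
    rw [← Real.rpow_natCast, ← Real.rpow_add h0]; congr 1; push_cast; ring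
  rw [h.deriv_zero, hpow] at hE
  -- At the maximum `V' = 0`, and zero energy reads `V(0)²/2 = V(0)^p/p`.
  have hV : V 0 ^ (p - 2) = p / 2 := by
    have : V 0 ^ 2 ≠ 0 := by positivity
    have hp0 : p ≠ 0 := by linarith
    field_simp at hE
    field_simp
    refine mul_left_cancel₀ this ?_
    linear_combination hE
  rw [← hV, ← Real.rpow_mul h0.le, mul_one_div_cancel (by linarith), Real.rpow_one]

/-- Both solitons have the same value at 0, by `apply_zero`, and slope 0 there, so uniqueness for
the initial value problem applies; the other half-line follows by reflection. -/
lemma eq_of_nonneg (hp : 2 < p) (h : IsSoliton p V) (h' : IsSoliton p V') {y : ℝ} (hy : 0 ≤ y) :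
    V y = V' y := by
  have h0 : V 0 = V' 0 := by rw [h.apply_zero hp, h'.apply_zero hp]
  exact (h.isSolOn y).eq_of_data hp (h'.isSolOn y) (fun z _ => h.max z)
    (fun z _ => h0 ▸ h'.max z) h0 (by rw [h.deriv_zero, h'.deriv_zero]) ⟨hy, le_rfl⟩

theorem unique (hp : 2 < p) (h : IsSoliton p V) (h' : IsSoliton p V') : V = V' := by
  funext y
  rcases le_total 0 y with hy | hy
  · exact eq_of_nonneg hp h h' hy
  · simpa using eq_of_nonneg hp h.reflect h'.reflect (neg_nonneg.2 hy)

end IsSoliton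

namespace IsStarSoliton

variable {p xbar : ℝ} {i₁ : Bool} {V W : Bool → ℝ → ℝ}

lemma apply_true_zero (h : IsStarSoliton p i₁ xbar V W) : W true 0 = -W false 0 := by
  have := h.kirchhoff
  rw [Fintype.sum_bool] at this
  linarith

lemma hasDerivAt_fold (h : IsStarSoliton p i₁ xbar V W) (y : ℝ) :
    HasDerivAt (fold (V true) (V false)) (fold (W true) (fun y => -W false y) y) y :=
  MetricGraph.hasDerivAt_fold (fun _ hy => IsSolOn.hasDerivWithinAt_Ici (h.sol true) hy)
    (fun _ hy => IsSolOn.hasDerivWithinAt_Ici (h.sol false) hy) (h.eq_zero true false)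
    h.apply_true_zero y

/-- The two halves of a soliton. -/
lemma isSoliton_fold (h : IsStarSoliton p i₁ 0 V W) : IsSoliton p (fold (V true) (V false)) := by
  have hW0 := h.apply_true_zero
  have h0 := h.eq_zero true false
  set U := fold (V true) (V false) with hU
  set U₁ := fold (W true) fun y => -W false y with hU₁
  have d1 : ∀ y, HasDerivAt U (U₁ y) y := h.hasDerivAt_fold
  have d2 : ∀ y, HasDerivAt U₁ (U y - U y ^ (p - 1)) y := fun y => by
    refine (MetricGraph.hasDerivAt_fold
      (fun y hy => IsSolOn.hasDerivWithinAt_Ici' (h.sol true) hy)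
      (fun y hy => (IsSolOn.hasDerivWithinAt_Ici' (h.sol false) hy).neg) hW0 (by simp [h0])
      y).congr_deriv ?_
    unfold U fold
    split_ifs <;> simp
  have hpos : ∀ y, 0 < U y := fun y => by
    unfold U fold
    split_ifs with hy
    exacts [h.pos _ _ hy, h.pos _ _ (by linarith)]
  have e1 : deriv U = U₁ := funext fun y => (d1 y).deriv
  have e2 : deriv U₁ = fun y => U y - U y ^ (p - 1) := funext fun y => (d2 y).deriv
  have cU : Continuous U := continuous_iff_continuousAt.2 fun y => (d1 y).continuousAt
  have cU₁ : Continuous U₁ := continuous_iff_continuousAt.2 fun y => (d2 y).continuousAt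
  have sqU : (fun y => U y ^ 2) = fold (fun y => V true y ^ 2) fun y => V false y ^ 2 := by
    funext y; unfold U fold; split_ifs <;> rfl
  have sqU₁ : (fun y => U₁ y ^ 2) = fold (fun y => W true y ^ 2) fun y => W false y ^ 2 := by
    funext y; unfold U₁ fold; split_ifs <;> simp
  refine ⟨⟨?_, U₁, ?_, fun a _ b _ => ?_⟩, ?_, hpos, fun y => ?_, fun y => ?_, ?_⟩
  · exact memLp_two_of_integrableOn_sq MeasurableSet.univ cU.continuousOn
      (by rw [integrableOn_univ, sqU]; exact integrable_fold (h.integrable _) (h.integrable _))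
  · exact memLp_two_of_integrableOn_sq MeasurableSet.univ cU₁.continuousOn
      (by rw [integrableOn_univ, sqU₁]; exact integrable_fold (h.integrable' _) (h.integrable' _))
  · exact (intervalIntegral.integral_eq_sub_of_hasDerivAt (fun y _ => d1 y)
      (cU₁.intervalIntegrable _ _)).symm
  · rw [show (2 : WithTop ℕ∞) = 1 + 1 from rfl, contDiff_succ_iff_deriv]
    refine ⟨fun y => (d1 y).differentiableAt, by simp, ?_⟩
    rw [e1, contDiff_one_iff_deriv, e2]
    exact ⟨fun y => (d2 y).differentiableAt,
      cU.sub (cU.rpow_const fun y => Or.inl (hpos y).ne')⟩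
  · rw [iteratedDeriv_succ, iteratedDeriv_one, e1, e2]
    ring
  · have hmax : ∀ i, V i₁ 0 = V i 0 := fun i => h.eq_zero _ _
    rw [hU, fold_of_nonneg le_rfl, ← hmax true]
    unfold fold
    split_ifs with hy
    exacts [h.le _ _ hy, h.le _ _ (by linarith)]
  · rw [cocompact_eq_atBot_atTop, tendsto_sup]
    constructor
    · refine ((h.tendsto false).comp tendsto_neg_atBot_atTop).congr' ?_
      filter_upwards [eventually_le_atBot 0] with y hy using (fold_of_nonpos h0 hy).symm
    · refine (h.tendsto true).congr' ?_
      filter_upwards [eventually_ge_atTop 0] with y hy using (fold_of_nonneg hy).symm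

end IsStarSoliton

end MetricGraph

/-! ### The equation at a local maximum, and scaling identities -/

namespace MetricGraph

variable {V E : Type*} {G : MetricGraph V E}

lemma exists_pos_le_len [Finite E] [Nonempty E] (G : MetricGraph V E) :
    ∃ a : ℝ, 0 < a ∧ ∀ e, ENNReal.ofReal a ≤ G.len e := by
  have h : ∀ e, ∃ a : ℝ, 0 < a ∧ ENNReal.ofReal a ≤ G.len e := fun e => by
    by_cases hl : G.len e = ⊤
    · exact ⟨1, one_pos, by rw [hl]; exact le_top⟩
    · exact ⟨(G.len e).toReal, len_toReal_pos hl, (ENNReal.ofReal_toReal hl).le⟩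
  choose a ha ha' using h
  obtain ⟨e₀, he₀⟩ := Finite.exists_min a
  exact ⟨a e₀, ha e₀, fun e => (ENNReal.ofReal_le_ofReal (he₀ e)).trans (ha' e)⟩

lemma depth_pos {e : E} {s : ℝ} (h0 : 0 < s) (h1 : ENNReal.ofReal s < G.len e) :
    0 < G.depth e s := by
  unfold depth
  split_ifs with hl
  · exact h0
  · exact lt_min h0 (sub_pos.2 ((ENNReal.ofReal_lt_iff_lt_toReal h0.le hl).1 h1))

lemma mem_I_of_abs_sub_le_depth {e : E} {s t : ℝ} (h : |t - s| ≤ G.depth e s) : t ∈ G.I e := by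
  obtain ⟨h1, h2⟩ := abs_le.1 h
  have h3 := depth_le (G := G) (e := e) (s := s)
  by_cases hl : G.len e = ⊤
  · rw [I_eq_Ici hl, mem_Ici]; linarith
  · have := depth_le_len_sub (s := s) hl
    rw [I_eq_Icc hl]
    exact ⟨by linarith, by linarith⟩

/-- The two directions on the real line. -/
noncomputable def side : Bool → ℝ
  | true => 1
  | false => -1

lemma side_sq (i : Bool) : side i ^ 2 = 1 := by cases i <;> simp [side]

lemma abs_side (i : Bool) : |side i| = 1 := by cases i <;> simp [side]

lemma sum_side_mul (a : ℝ) : ∑ i, side i * a = 0 := by simp [side]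

lemma HalfEdge.coord_zero_add (h : G.HalfEdge) (t : ℝ) :
    G.pt h.edge (h.coord 0 + h.sign * t) = h.pt t := by rw [← h.coord_eq, ← h.pt_eq]

/-- For `δ = m^(-(p-2)/2)` one has `δ² m^(p-1) = m`; so the inequality at a maximum with value `m`
bounds the linear coefficient of the equation rescaled by `δ`. -/
lemma sq_rpow_mul_le {p lam ρ m : ℝ} (hm : 0 < m) (h : lam * m ≤ ρ * m ^ (p - 1)) :
    (m ^ (-((p - 2) / 2))) ^ 2 * lam ≤ ρ := by
  have h1 : (m ^ (-((p - 2) / 2))) ^ 2 * m ^ (p - 1) = m := by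
    rw [← Real.rpow_natCast, ← Real.rpow_mul hm.le, ← Real.rpow_add hm]
    nth_rw 2 [← Real.rpow_one m]
    congr 1
    push_cast
    ring
  have h2 := mul_le_mul_of_nonneg_left h (sq_nonneg (m ^ (-((p - 2) / 2))))
  refine le_of_mul_le_mul_right ?_ hm
  calc (m ^ (-((p - 2) / 2))) ^ 2 * lam * m = (m ^ (-((p - 2) / 2))) ^ 2 * (lam * m) := by ring
    _ ≤ (m ^ (-((p - 2) / 2))) ^ 2 * (ρ * m ^ (p - 1)) := h2
    _ = ρ * ((m ^ (-((p - 2) / 2))) ^ 2 * m ^ (p - 1)) := by ring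
    _ = ρ * m := by rw [h1]

/-- The scaling of the integrals of powers. -/
lemma mul_setIntegral_rpow_eq {p lam ε q : ℝ} (hlam : 0 < lam)
    (hε : ε = lam ^ (-(1 / 2) : ℝ)) {g : ℝ → ℝ} (hg : ∀ x, 0 < g x) {S : Set ℝ}
    (hS : MeasurableSet S) (s₀ : ℝ) :
    lam ^ (1 / 2 - q / (p - 2)) * ∫ x in S, g x ^ q =
      ∫ y in {y | s₀ + ε * y ∈ S}, (ε ^ (2 / (p - 2)) * g (s₀ + ε * y)) ^ q := by
  have hε0 : 0 < ε := by rw [hε]; exact Real.rpow_pos_of_pos hlam _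
  rw [setIntegral_eq_abs_mul _ hS s₀ hε0.ne', abs_of_pos hε0, ← mul_assoc, ← integral_const_mul]
  congr 1
  funext y
  rw [Real.mul_rpow (Real.rpow_nonneg hε0.le _) (hg _).le]
  congr 1
  rw [hε, ← Real.rpow_add hlam, ← Real.rpow_mul hlam.le, ← Real.rpow_mul hlam.le]
  congr 1
  ring

lemma setIntegral_energyDensity_side {p ρ : ℝ} (hp : 2 < p) {u : G.Point → ℝ} (hu : ∀ x, 0 < u x)
    {e : E} {s₀ ς δ b : ℝ} (hς : ς ^ 2 = 1) (hδ : 0 < δ) (hb : 0 ≤ b) {χ : ℝ → ℝ} :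
    ∫ x in {x | ς / δ * (x - s₀) ∈ Icc 0 b},
      energyDensity p ρ (fun x => u (G.pt e x)) (fun s => χ (ς / δ * (s - s₀))) x =
      δ ^ (1 - 2 / (p - 2) * p) * ∫ y in (0 : ℝ)..b, energyDensity p ρ (profile p u e s₀ ς δ) χ y := by
  have hm : MeasurableSet {x : ℝ | ς / δ * (x - s₀) ∈ Icc 0 b} :=
    measurableSet_Icc.preimage (by fun_prop)
  have hset : {y | s₀ + ς * δ * y ∈ {x : ℝ | ς / δ * (x - s₀) ∈ Icc 0 b}} = Icc 0 b := by
    ext y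
    have : ς / δ * (s₀ + ς * δ * y - s₀) = y := by
      rw [show ς / δ * (s₀ + ς * δ * y - s₀) = ς ^ 2 * y by field_simp; ring, hς, one_mul]
    simp only [mem_ofPred_eq, this]
  rw [integral_energyDensity_profile hp hu hς hδ hm, hset, integral_Icc_eq_integral_Ioc,
    ← intervalIntegral.integral_of_le hb]

lemma cutoff_neg_left {R w y : ℝ} : cutoff (-R) R w (-y) = cutoff (-R) R w y := by
  unfold cutoff
  rw [mul_comm]
  congr 2 <;> ring

variable [Fintype E]

lemma IsPositiveSolution.sum_sign_mul_edgeDeriv {p lam ρ : ℝ} {u : G.Point → ℝ}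
    (hu : G.IsPositiveSolution p lam ρ u) (w : V) :
    ∑ h : G.Ends w, h.1.sign * edgeDeriv u h.1.edge (h.1.coord 0) = 0 := by
  refine Eq.trans ?_ (hu.kirchhoff w)
  exact Finset.sum_congr rfl fun h _ => (hu.derivWithin_halfEdge h.1).symm

/-- The equation at a local maximum. -/
lemma IsPositiveSolution.lam_mul_le [Nonempty E] {p lam ρ r : ℝ} (hp : 2 < p) {u : G.Point → ℝ}
    (hu : G.IsPositiveSolution p lam ρ u) {x : G.Point} (hr : 0 < r)
    (hmax : ∀ y ∈ Metric.ball x r, u y ≤ u x) : lam * u x ≤ ρ * u x ^ (p - 1) := by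
  rcases x with v | ⟨e, s, h0, h1⟩
  -- At a vertex `star_max_le` is applied to the ends of edges, in unscaled profiles (`δ = 1`), on a
  -- length that stays in every edge and in the ball.
  · obtain ⟨h₀, rfl⟩ := HalfEdge.exists_base (G := G) v
    obtain ⟨a, ha, hae⟩ := exists_pos_le_len G
    have hI : ∀ (h : G.Ends h₀.base), ∀ y ∈ Icc 0 (min a (r / 2)),
        h.1.coord 0 + h.1.sign * 1 * y ∈ G.I h.1.edge := fun h y hy => by
      rw [mul_one, ← HalfEdge.coord_eq]
      exact HalfEdge.coord_mem_I ⟨hy.1, (ENNReal.ofReal_le_ofReal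
        (hy.2.trans (min_le_left _ _))).trans (hae _)⟩
    have key := star_max_le hp (L := min a (r / 2)) (lt_min ha (by linarith))
      (fun h : G.Ends h₀.base => isSolOn_profile hp hu h.1.sign_sq one_pos (hI h))
      (fun h y hy => ?_) ?_ ⟨h₀, rfl⟩
    · simpa [profile, HalfEdge.coord_zero_add, ← HalfEdge.pt_eq, HalfEdge.pt_zero] using key
    · simp only [profile, Real.one_rpow, one_mul, mul_one, HalfEdge.coord_zero_add]
      rw [HalfEdge.pt_zero, h.2]
      refine hmax _ (Metric.mem_ball.2 ?_)
      have hy' : y ∈ G.I h.1.edge := ⟨hy.1, (ENNReal.ofReal_le_ofReal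
        (hy.2.trans (min_le_left _ _))).trans (hae _)⟩
      have := HalfEdge.dist_pt_le hy' (zero_mem_I h.1.edge)
      rw [HalfEdge.pt_zero, h.2, sub_zero, abs_of_nonneg hy.1] at this
      have := min_le_right a (r / 2)
      linarith [hy.2]
    · simpa [profileDeriv] using hu.sum_sign_mul_edgeDeriv h₀.base
  -- An interior point is the centre of a star with the two directions of the edge as branches.
  · have hd : 0 < G.depth e s := depth_pos h0 h1
    have hmem : ∀ (i : Bool), ∀ y ∈ Icc 0 (min (G.depth e s) (r / 2)),
        s + side i * 1 * y ∈ G.I e := fun i y hy => by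
      refine mem_I_of_abs_sub_le_depth (s := s) ?_
      rw [add_sub_cancel_left, mul_one, abs_mul, abs_side, one_mul, abs_of_nonneg hy.1]
      exact hy.2.trans (min_le_left _ _)
    rw [← pt_interior e s h0 h1] at hmax ⊢
    have key := star_max_le hp (L := min (G.depth e s) (r / 2)) (lt_min hd (by linarith))
      (fun i : Bool => isSolOn_profile hp hu (side_sq i) one_pos (hmem i))
      (fun i y hy => ?_) ?_ true
    · simpa [profile] using key
    · simp only [profile, Real.one_rpow, one_mul, mul_zero, add_zero]
      refine hmax _ (Metric.mem_ball.2 ?_)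
      refine (dist_pt_le (hmem i y hy) ⟨h0.le, h1.le⟩).trans_lt ?_
      rw [add_sub_cancel_left, mul_one, abs_mul, abs_side, one_mul, abs_of_nonneg hy.1]
      have := min_le_right (G.depth e s) (r / 2)
      linarith [hy.2]
    · simp [profileDeriv, side]

end MetricGraph

/-! ### Case (A): concentration inside an edge -/

namespace MetricGraph

variable {V E : Type*} {G : MetricGraph V E} [Fintype E]

/-- The test function supported near an interior point of an edge. -/
lemma exists_testFunction_edge [Fintype V] [Nonempty E] {p lam ρ : ℝ} (hp : 2 < p)
    {u : G.Point → ℝ} (hu : G.IsPositiveSolution p lam ρ u) {e : E} {t ε R : ℝ} (hε : 0 < ε)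
    (hR : 0 < R) (hRt : 2 * R * ε < G.depth e t)
    (hneg : ∑ i, ∫ y in (0 : ℝ)..(2 * R), energyDensity p ρ (profile p u e t (side i) ε)
      (cutoff (-(2 * R)) (2 * R) R) y < 0) :
    ∃ φ : G.Point → ℝ, G.IsTestFunction φ ∧
      tsupport φ ⊆ Metric.ball (G.pt e t) (3 * R * ε) ∧ G.Q p lam ρ u φ < 0 := by
  classical
  set χ : ℝ → ℝ := fun s => cutoff (-(2 * R)) (2 * R) R (1 / ε * (s - t)) with hχ
  have hχsm : ContDiff ℝ ∞ χ :=
    cutoff_contDiff.comp (contDiff_const.mul (contDiff_id.sub contDiff_const))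
  have h0 : ∀ s, s ∉ Ioo (t - 2 * R * ε) (t + 2 * R * ε) → χ s = 0 := fun s hs => by
    refine cutoff_eq_zero hR fun h => hs ?_
    rw [one_div, inv_mul_eq_div] at h
    have h1 := (lt_div_iff₀ hε).1 h.1
    have h2 := (div_lt_iff₀ hε).1 h.2
    exact ⟨by linarith, by linarith⟩
  have hRε : 0 < 2 * R * ε := by positivity
  have ht0 : 0 < t - 2 * R * ε := by linarith [depth_le (G := G) (e := e) (s := t)]
  have ht1 : ENNReal.ofReal (t + 2 * R * ε) < G.len e := by
    by_cases hl : G.len e = ⊤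
    · rw [hl]; exact ENNReal.ofReal_lt_top
    · refine (ENNReal.ofReal_lt_iff_lt_toReal (by linarith) hl).2 ?_
      linarith [depth_le_len_sub (s := t) hl]
  have htI : ∀ s, |s - t| ≤ 2 * R * ε → s ∈ G.I e := fun s hs =>
    mem_I_of_abs_sub_le_depth (hs.trans hRt.le)
  have hcut := isCutoff_single ht0 ht1 hχsm h0
  refine ⟨_, hcut.isTestFunction hu, ?_, ?_⟩
  · refine (closure_minimal (t := Metric.closedBall (G.pt e t) (2 * R * ε)) ?_
      Metric.isClosed_closedBall).trans (Metric.closedBall_subset_ball ?_)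
    · intro x hx
      rcases x with v | ⟨e', s, h1, h2⟩
      · exact absurd (by simp [glue]) hx
      · have hx' : (if e' = e then χ else fun _ => 0) s ≠ 0 := fun h =>
          hx (by simp only [glue, h, mul_zero])
        split_ifs at hx' with he
        · subst he
          have hs : s ∈ Ioo (t - 2 * R * ε) (t + 2 * R * ε) := by
            by_contra h
            exact hx' (h0 s h)
          have habs : |s - t| ≤ 2 * R * ε := abs_le.2 ⟨by linarith [hs.1], by linarith [hs.2]⟩
          rw [Metric.mem_closedBall, ← pt_interior e' s h1 h2]
          exact (dist_pt_le ⟨h1.le, h2.le⟩ (htI t (by simpa using hRε.le))).trans habs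
        · exact absurd rfl hx'
    · have : 0 < R * ε := by positivity
      linarith
  · rw [Q_single hp hu ht0 ht1 hχsm h0]
    set F := energyDensity p ρ (fun x => u (G.pt e x)) χ with hF
    -- The support is cut at `t` into two halves, which correspond to the two rays in the rescaled
    -- hypothesis.
    set S : Bool → Set ℝ := fun i => {x | side i / ε * (x - t) ∈ Icc 0 (2 * R)} with hS
    have hSt : S true = Icc t (t + 2 * R * ε) := by
      ext x
      simp only [hS, side, mem_ofPred_eq, one_div, inv_mul_eq_div, mem_Icc]
      rw [le_div_iff₀ hε, div_le_iff₀ hε]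
      constructor <;> rintro ⟨h1, h2⟩ <;> constructor <;> linarith
    have hSf : S false = Icc (t - 2 * R * ε) t := by
      ext x
      simp only [hS, side, mem_ofPred_eq, mem_Icc]
      rw [show -1 / ε * (x - t) = (t - x) / ε by ring, le_div_iff₀ hε, div_le_iff₀ hε]
      constructor <;> rintro ⟨h1, h2⟩ <;> constructor <;> linarith
    -- The cutoff is even, so it has the same form when read along either direction.
    have hχi : ∀ i, χ = fun s => cutoff (-(2 * R)) (2 * R) R (side i / ε * (s - t)) := by
      rintro (_ | _)
      · funext s
        simp only [hχ, side]
        rw [← cutoff_neg_left]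
        congr 1
        ring
      · rfl
    have hint : IntegrableOn F (G.I e) := by
      have := hcut.integrableOn_energyDensity hp hu e
      rwa [if_pos rfl] at this
    have hsub : ∀ i, S i ⊆ G.I e := by
      rintro (_ | _) x hx
      · rw [hSf] at hx
        exact htI x (abs_le.2 ⟨by linarith [hx.1], by linarith [hx.2]⟩)
      · rw [hSt] at hx
        exact htI x (abs_le.2 ⟨by linarith [hx.1], by linarith [hx.2]⟩)
    have hval : ∫ x in G.I e, F x = ∑ i, ∫ x in S i, F x := by
      rw [Fintype.sum_bool, add_comm]
      rw [setIntegral_eq_of_subset_of_forall_sdiff_eq_zero (s := S false ∪ S true)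
        (isClosed_I e).measurableSet (union_subset (hsub _) (hsub _)) fun x hx => ?_]
      · refine setIntegral_union₀ ?_ (by rw [hSt]; exact measurableSet_Icc.nullMeasurableSet)
          (hint.mono_set (hsub _)) (hint.mono_set (hsub _))
        refine measure_mono_null (t := {t}) ?_ (measure_singleton t)
        rw [hSf, hSt]
        rintro x ⟨h1, h2⟩
        exact le_antisymm h1.2 h2.1
      · have hx' : x ∉ Icc (t - 2 * R * ε) (t + 2 * R * ε) := fun h => hx.2 <| by
          rw [hSf, hSt]
          rcases le_total x t with hxt | hxt
          exacts [Or.inl ⟨h.1, hxt⟩, Or.inr ⟨hxt, h.2⟩]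
        exact IsCutoff.energyDensity_eq_zero (h0 x fun h => hx' (Ioo_subset_Icc_self h))
          (deriv_eq_zero_of_notMem_Icc h0 hx')
    have hval' : ∀ i, ∫ x in S i, F x = ε ^ (1 - 2 / (p - 2) * p) * ∫ y in (0 : ℝ)..(2 * R),
        energyDensity p ρ (profile p u e t (side i) ε) (cutoff (-(2 * R)) (2 * R) R) y := fun i => by
      rw [← setIntegral_energyDensity_side hp hu.pos (side_sq i) hε (by linarith), hF]
      nth_rw 1 [hχi i]
    rw [hval, Finset.sum_congr rfl fun i _ => hval' i, ← Finset.mul_sum]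
    exact mul_neg_of_pos_of_neg (Real.rpow_pos_of_pos hε _) hneg

/-- The blow-up at interior points of an edge. -/
theorem edge_blowUp [Fintype V] [Nonempty E] {k : ℕ} {p : ℝ} (hp : 2 < p) {lam ρ t ℓ δ ε : ℕ → ℝ}
    {u : ℕ → G.Point → ℝ} {e : E}
    (h : IsBlowUp G p lam ρ u (fun _ : Bool => e) (fun _ => t) side ℓ true (fun _ => 0) δ 0)
    (hk : ∀ n, G.morseIndex p (lam n) (ρ n) (u n) ≤ k)
    (hε : ∀ n, ε n = lam n ^ (-(1 / 2) : ℝ)) (htI : ∀ n, t n ∈ G.I e)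
    (hℓ : ∀ n, ℓ n ≤ G.depth e (t n)) :
    ∃ σ : ℕ → ℕ, StrictMono σ ∧
      (∃ c : ℝ, 0 < c ∧ c ≤ 1 ∧ Tendsto (fun n => δ (σ n) / ε (σ n)) atTop (𝓝 c)) ∧
      Tendsto (fun n => G.depth e (t (σ n)) / ε (σ n)) atTop atTop ∧
      ∃ W : ℝ → ℝ, IsSoliton p W ∧
        TendstoC2Loc univ (fun n => {y | t (σ n) + ε (σ n) * y ∈ G.I e})
          (fun n y => ε (σ n) ^ (2 / (p - 2)) * u (σ n) (G.pt e (t (σ n) + ε (σ n) * y))) W ∧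
        (∃ Rbar > 0, ∀ n, ∃ φ : G.Point → ℝ, G.IsTestFunction φ ∧
          tsupport φ ⊆ Metric.ball (G.pt e (t (σ n))) (Rbar * ε (σ n)) ∧
          G.Q p (lam (σ n)) (ρ (σ n)) (u (σ n)) φ < 0) ∧
        ∀ r > 0, ∀ q : ℝ, 1 ≤ q →
          Tendsto (fun n => lam (σ n) ^ (1 / 2 - q / (p - 2)) *
            G.integral (Metric.ball (G.pt e (t (σ n))) (r * ε (σ n))) (fun z => u (σ n) z ^ q)) atTop
            (𝓝 (∫ y in Metric.ball (0 : ℝ) r, W y ^ q)) ∧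
          Tendsto (fun n => ∫ y in {y | t (σ n) + ε (σ n) * y ∈ G.I e} ∩ Metric.ball (0 : ℝ) r,
            (ε (σ n) ^ (2 / (p - 2)) * u (σ n) (G.pt e (t (σ n) + ε (σ n) * y))) ^ q) atTop
            (𝓝 (∫ y in Metric.ball (0 : ℝ) r, W y ^ q)) := by
  obtain ⟨σ, hσ, hc, hL, xbar, M, U, U₁, hU, hx, hUM, hfM, hf, hg, R, hR, hRn⟩ := h.exists_limit hp hk hε
  have hε0 : ∀ n, 0 < ε n := fun n => by rw [hε]; exact Real.rpow_pos_of_pos (h.lam_pos n) _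
  have hε2 : ∀ n, ε n ^ 2 * lam n = 1 := fun n => by
    have hl := h.lam_pos n
    rw [hε, ← Real.rpow_natCast, ← Real.rpow_mul hl.le]
    nth_rw 2 [← Real.rpow_one (lam n)]
    rw [← Real.rpow_add hl]
    norm_num
  -- The rays start at the maximum point itself, so the maximum of the limit is at 0.
  obtain rfl : xbar = 0 := by
    simp only [zero_div] at hx
    exact tendsto_nhds_unique hx tendsto_const_nhds |>.symm ▸ rfl
  set f : ℕ → ℝ → ℝ := fun n => profile p (u (σ n)) e (t (σ n)) (side true) (ε (σ n)) with hfdef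
  set f₁ : ℕ → ℝ → ℝ := fun n => profileDeriv p (u (σ n)) e (t (σ n)) (side true) (ε (σ n)) with hf₁def
  have hfv : (fun n y => ε (σ n) ^ (2 / (p - 2)) * u (σ n) (G.pt e (t (σ n) + ε (σ n) * y))) = f := by
    funext n y
    simp [hfdef, profile, side]
  have hneg : ∀ n y, f n (-y) = profile p (u (σ n)) e (t (σ n)) (side false) (ε (σ n)) y :=
    fun n y => by simp [hfdef, profile, side]
  have hneg' : ∀ n y, f₁ n (-y) = -profileDeriv p (u (σ n)) e (t (σ n)) (side false) (ε (σ n)) y :=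
    fun n y => by simp [hf₁def, profileDeriv, side]
  set W := fold (U true) (U false) with hW
  set W₁ := fold (U₁ true) (fun y => -U₁ false y) with hW₁
  have hWs : IsSoliton p W := hU.isSoliton_fold
  have hWW₁ : deriv W = W₁ := funext fun y => (hU.hasDerivAt_fold y).deriv
  -- The rescaled solution on the line is the fold of its two one-sided profiles, so two-sided
  -- convergence follows from convergence on the branches.
  have u0 : ∀ a, TendstoUniformlyOn f W atTop (Icc (-a) a) := fun a => by
    have := tendstoUniformlyOn_fold (hf true a) (hf false a)
    exact this.congr (Eventually.of_forall fun n y _ => by rw [fold_eq_self (hneg n)])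
  have u1 : ∀ a, TendstoUniformlyOn f₁ W₁ atTop (Icc (-a) a) := fun a => by
    have := tendstoUniformlyOn_fold (hg true a) ((hg false a).neg)
    exact this.congr (Eventually.of_forall fun n y _ => by
      exact congrFun (fold_eq_self (f := f₁ n) (hneg' n)) y)
  have hLε : ∀ n, ε (σ n) * (ℓ (σ n) / ε (σ n)) = ℓ (σ n) := fun n =>
    mul_div_cancel₀ _ (hε0 _).ne'
  have hmem : ∀ n y, |y| ≤ ℓ (σ n) / ε (σ n) → t (σ n) + side true * ε (σ n) * y ∈ G.I e := by
    intro n y hy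
    refine mem_I_of_abs_sub_le_depth (s := t (σ n)) ?_
    rw [add_sub_cancel_left, side, one_mul, abs_mul, abs_of_pos (hε0 _)]
    refine le_trans ?_ (hℓ (σ n))
    rw [← hLε n]
    exact mul_le_mul_of_nonneg_left hy (hε0 _).le
  have hfI : ∀ n y, |y| ≤ ℓ (σ n) / ε (σ n) → f n y ∈ Icc 0 M := by
    intro n y hy
    refine ⟨mul_nonneg (Real.rpow_nonneg (hε0 _).le _) ((h.sol _).pos _).le, ?_⟩
    rcases le_total 0 y with h0 | h0
    · exact hfM true n y ⟨h0, (le_abs_self y).trans hy⟩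
    · rw [← neg_neg y, hneg]
      exact hfM false n (-y) ⟨neg_nonneg.2 h0, (neg_le_abs y).trans hy⟩
  have hWI : ∀ y, W y ∈ Icc 0 M := fun y => by
    refine ⟨(hWs.pos y).le, ?_⟩
    rw [hW]
    unfold fold
    split_ifs with hy
    exacts [hUM _ _ hy, hUM _ _ (by linarith)]
  have hev : ∀ a : ℝ, ∀ᶠ n in atTop, ∀ y ∈ Icc (-a) a, |y| ≤ ℓ (σ n) / ε (σ n) := fun a => by
    filter_upwards [hL.eventually_ge_atTop a] with n hn y hy using (abs_le.2 hy).trans hn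
  have hnhds : ∀ {n y}, |y| < ℓ (σ n) / ε (σ n) →
      Icc (-(ℓ (σ n) / ε (σ n))) (ℓ (σ n) / ε (σ n)) ∈ 𝓝 y := fun hy =>
    Icc_mem_nhds (abs_lt.1 hy).1 (abs_lt.1 hy).2
  have hd1 : ∀ {n y}, |y| < ℓ (σ n) / ε (σ n) → HasDerivAt (f n) (f₁ n y) y := fun {n y} hy =>
    (hasDerivWithinAt_profile (h.sol _) (fun z hz => hmem n z (abs_le.2 hz))
      (mem_of_mem_nhds (hnhds hy))).hasDerivAt (hnhds hy)
  have hd2 : ∀ {n y}, |y| < ℓ (σ n) / ε (σ n) →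
      HasDerivAt (f₁ n) (1 * f n y - ρ (σ n) * f n y ^ (p - 1)) y := fun {n y} hy => by
    refine ((hasDerivWithinAt_profileDeriv hp (h.sol _) (side_sq true) (hε0 (σ n))
      (fun z hz => hmem n z (abs_le.2 hz)) (mem_of_mem_nhds (hnhds hy))).hasDerivAt
      (hnhds hy)).congr_deriv ?_
    rw [hε2]
  have hev' : ∀ a : ℝ, ∀ᶠ n in atTop, ∀ y ∈ univ ∩ Icc (-a) a, |y| < ℓ (σ n) / ε (σ n) := fun a => by
    filter_upwards [hL.eventually_gt_atTop a] with n hn y hy using (abs_le.2 hy.2).trans_lt hn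
  refine ⟨σ, hσ, hc, tendsto_atTop_mono (fun n => ?_) hL, W, hWs, ?_, ⟨3 * R, by positivity,
    fun n => ?_⟩, fun r hr q hq => ?_⟩
  · exact (div_le_div_iff_of_pos_right (hε0 _)).2 (hℓ _)
  · rw [hfv]
    refine tendstoC2Loc_of_tendstoUniformlyOn uniqueDiffOn_univ (fun a ha => ?_)
      (v₁ := f₁) (v₂ := fun n y => 1 * f n y - ρ (σ n) * f n y ^ (p - 1))
      (V₁ := W₁) (V₂ := fun y => 1 * W y - 1 * W y ^ (p - 1)) (fun a _ => ?_) (fun a _ => ?_)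
      (fun a _ => ?_) (fun a _ => ?_) (fun y _ => ?_) (fun y _ => ?_) ?_ (fun a _ => ?_)
      (fun a _ => ?_) (fun a _ => ?_)
    · rw [univ_inter]; exact uniqueDiffOn_Icc (by linarith)
    · filter_upwards [hev' a] with n hn y hy
      have := hmem n y (hn y hy).le
      rwa [side, one_mul] at this
    · filter_upwards [hev' a] with n hn y hy using (hd1 (hn y hy)).hasDerivWithinAt
    · filter_upwards [hev' a] with n hn y hy using (hd2 (hn y hy)).hasDerivWithinAt
    · filter_upwards [hev' a] with n hn
      have hcf : ContinuousOn (f n) (univ ∩ Icc (-a) a) := fun y hy =>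
        (hd1 (hn y hy)).continuousAt.continuousWithinAt
      exact (continuousOn_const.mul hcf).sub (continuousOn_const.mul
        (hcf.rpow_const fun _ _ => Or.inr (by linarith)))
    · exact (hU.hasDerivAt_fold y).hasDerivWithinAt
    · rw [← hWW₁]
      exact (hWs.hasDerivAt_deriv y).hasDerivWithinAt.congr_deriv (by simp)
    · have hcW := hWs.contDiff.continuous
      exact ((continuous_const.mul hcW).sub (continuous_const.mul
        (hcW.rpow_const fun _ => Or.inr (by linarith)))).continuousOn
    · rw [univ_inter]; exact u0 a
    · rw [univ_inter]; exact u1 a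
    · rw [univ_inter]
      refine tendstoUniformlyOn_nonlinearity (M := M) hp (u0 a) tendsto_const_nhds
        (h.tendsto_rho.comp hσ.tendsto_atTop) ?_ fun y _ => hWI y
      filter_upwards [hev a] with n hn y hy using hfI n y (hn y hy)
  · refine exists_testFunction_edge hp (h.sol _) (hε0 _) hR ?_ (hRn n).2
    exact ((lt_div_iff₀ (hε0 _)).1 (hRn n).1).trans_le (hℓ _)
  -- The form needed for the bounded convergence lemma: a fixed compact set cut by an interval.
  · have hball : Metric.ball (0 : ℝ) r = Icc (-r) r ∩ Ioo (-r) r := by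
      rw [Real.ball_eq_Ioo, zero_sub, zero_add, inter_eq_right.2 Ioo_subset_Icc_self]
    have hlim : Tendsto (fun n => ∫ y in Metric.ball (0 : ℝ) r, f n y ^ q) atTop
        (𝓝 (∫ y in Metric.ball (0 : ℝ) r, W y ^ q)) := by
      rw [hball]
      refine tendsto_integral_rpow_inter_Ioo (M := M) (by linarith) measurableSet_Icc
        (by simp) ?_ ?_ (fun y hy => (u0 r).tendsto_at hy) tendsto_const_nhds tendsto_const_nhds
      · filter_upwards [hev' r] with n hn y hy
        exact (hd1 (hn y ⟨trivial, hy⟩)).continuousAt.continuousWithinAt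
      · filter_upwards [hev r] with n hn y hy using hfI n y (hn y hy)
    constructor
    · refine hlim.congr' ?_
      filter_upwards [hL.eventually_ge_atTop r] with n hn
      have hrd : r * ε (σ n) ≤ G.depth e (t (σ n)) :=
        ((le_div_iff₀ (hε0 _)).1 hn).trans (hℓ _)
      symm
      rw [integral, Finset.sum_eq_single e]
      · have hset : {x | x ∈ G.I e ∧ G.pt e x ∈ Metric.ball (G.pt e (t (σ n))) (r * ε (σ n))} =
            Ioo (t (σ n) - r * ε (σ n)) (t (σ n) + r * ε (σ n)) := by
          ext x
          constructor
          · rintro ⟨h1, h2⟩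
            have := abs_lt.1 ((pt_mem_ball_iff (htI _) h1 hrd).1 h2).2
            exact ⟨by linarith, by linarith⟩
          · rintro ⟨h1, h2⟩
            have h3 : |x - t (σ n)| < r * ε (σ n) := abs_lt.2 ⟨by linarith, by linarith⟩
            have h4 : x ∈ G.I e := mem_I_of_abs_sub_le_depth (h3.le.trans hrd)
            exact ⟨h4, (pt_mem_ball_iff (htI _) h4 hrd).2 ⟨rfl, h3⟩⟩
        rw [hset, mul_setIntegral_rpow_eq (h.lam_pos _) (hε _) (fun x => (h.sol _).pos _)
          measurableSet_Ioo (t (σ n))]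
        have hset' : {y | t (σ n) + ε (σ n) * y ∈
            Ioo (t (σ n) - r * ε (σ n)) (t (σ n) + r * ε (σ n))} = Metric.ball (0 : ℝ) r := by
          ext y
          rw [Real.ball_eq_Ioo, zero_sub, zero_add]
          have := hε0 (σ n)
          constructor
          · rintro ⟨h1, h2⟩
            exact ⟨by by_contra! h3; nlinarith, by by_contra! h3; nlinarith⟩
          · rintro ⟨h1, h2⟩
            exact ⟨by nlinarith, by nlinarith⟩
        rw [hset', ← hfv]
      · intro e' _ he'
        have : {x | x ∈ G.I e' ∧ G.pt e' x ∈ Metric.ball (G.pt e (t (σ n))) (r * ε (σ n))} = ∅ := by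
          rw [eq_empty_iff_forall_notMem]
          rintro x ⟨h1, h2⟩
          exact he' ((pt_mem_ball_iff (htI _) h1 hrd).1 h2).1
        rw [this, setIntegral_empty]
      · simp
    · refine hlim.congr' ?_
      filter_upwards [hev' r] with n hn
      have : {y | t (σ n) + ε (σ n) * y ∈ G.I e} ∩ Metric.ball (0 : ℝ) r = Metric.ball 0 r := by
        refine inter_eq_right.2 fun y hy => ?_
        rw [hball] at hy
        have := hmem n y (hn y ⟨trivial, hy.1⟩).le
        rwa [side, one_mul] at this
      rw [this, ← hfv]

end MetricGraph

/-! ### The infinite star as a metric graph carrying the limit -/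

namespace MetricGraph

section star

variable {ι : Type*}

lemma star_len_eq (i : ι) : (star ι).len i = ⊤ := rfl

lemma star_I (i : ι) : (star ι).I i = Ici 0 := I_eq_Ici rfl

lemma exists_star_pt [Nonempty ι] (P : (star ι).Point) : ∃ i y, 0 ≤ y ∧ P = (star ι).pt i y := by
  rcases P with v | ⟨i, y, h0, h1⟩
  · obtain ⟨i⟩ := ‹Nonempty ι›
    exact ⟨i, 0, le_rfl, (pt_zero i).symm⟩
  · exact ⟨i, y, h0.le, (pt_interior i y h0 h1).symm⟩

/-- The star has one vertex, so this is the distance to the vertex set, which `infDist_pt` computes.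
-/
lemma star_dist_pt (i : ι) {y : ℝ} (hy : 0 ≤ y) :
    dist ((star ι).pt i y) (.vertex ()) = y := by
  have h := infDist_pt (G := star ι) (e := i) (s := y) (by rw [star_I]; exact hy)
  rwa [vertices, range_unique, Metric.infDist_singleton, depth, if_pos (star_len_eq i)] at h

lemma star_glue_pt {c : ℝ} {U : ι → ℝ → ℝ} (h0 : ∀ i, U i 0 = c) (i : ι) {y : ℝ} (hy : 0 ≤ y) :
    (star ι).glue (fun _ => c) U ((star ι).pt i y) = U i y :=
  glue_pt (h0 i) (fun h => absurd rfl h) (by rw [star_I]; exact hy)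

variable [Fintype ι]

lemma star_sum_halfEdge (F : (star ι).HalfEdge → ℝ) :
    ∑ h, F h = ∑ i, F (.initial i) := by
  classical
  rw [HalfEdge.sum_eq]
  exact Finset.sum_congr rfl fun i _ => by rw [dif_neg (not_not.2 (star_len_eq i)), add_zero]

/-- Integrals over balls in the star graph. -/
lemma star_integral_ball [DecidableEq ι] (i₁ : ι) {x r : ℝ} (hx : 0 ≤ x) (hr : 0 < r)
    {f : (star ι).Point → ℝ} :
    (star ι).integral (Metric.ball ((star ι).pt i₁ x) r) f =
      ∑ i, ∫ y in Ici 0 ∩ Ioo (if i = i₁ then x - r else -1) (if i = i₁ then x + r else r - x),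
        f ((star ι).pt i y) := by
  refine Finset.sum_congr rfl fun i _ => ?_
  congr 2
  ext y
  have key : ∀ hy : 0 ≤ y, _ := fun hy => halfEdge_pt_mem_ball_iff (G := star ι)
    (h₀ := .initial i₁) (h := .initial i) (t := y) hr hx (fun _ => le_top) hy le_top
  simp only [HalfEdge.initial.injEq, HalfEdge.pt, ne_eq] at key
  simp only [mem_ofPred_eq, star_I, mem_inter_iff, mem_Ici, mem_Ioo]
  refine and_congr_right fun hy => (key hy).trans ?_
  by_cases hi : i = i₁
  · simp only [hi, true_and, not_true, false_and, or_false, abs_lt, if_true]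
    constructor <;> rintro ⟨h1, h2⟩ <;> constructor <;> linarith
  · simp only [hi, false_and, false_or, not_false_iff, true_and, if_false]
    exact ⟨fun h2 => ⟨by linarith, by linarith⟩, fun h1 => by linarith [h1.2]⟩

lemma setIntegral_Ici_inter_Ioo (a b : ℝ) (f : ℝ → ℝ) :
    ∫ y in Ici 0 ∩ Ioo a b, f y = ∫ y in Icc (max 0 a) b, f y := by
  refine setIntegral_congr_set ?_
  have h : Ici (0 : ℝ) ∩ Icc a b = Icc (max 0 a) b := by
    ext y
    simp only [mem_inter_iff, mem_Ici, mem_Icc, max_le_iff, and_assoc]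
  rw [← h]
  exact (ae_eq_refl _).inter Ioo_ae_eq_Icc

namespace IsStarSoliton

variable {p xbar : ℝ} {i₁ : ι} {U U₁ : ι → ℝ → ℝ}

/-- The solution, as a function on the star graph. -/
noncomputable def toStar (U : ι → ℝ → ℝ) (i₁ : ι) : (star ι).Point → ℝ :=
  (star ι).glue (fun _ => U i₁ 0) U

lemma toStar_pt (h : IsStarSoliton p i₁ xbar U U₁) (i : ι) {y : ℝ} (hy : 0 ≤ y) :
    toStar U i₁ ((star ι).pt i y) = U i y :=
  star_glue_pt (fun i => h.eq_zero i i₁) i hy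

/-- The derivatives are bounded by one constant on all branches, so the glued function is Lipschitz.
-/
lemma continuous_toStar (hp : 2 < p) (h : IsStarSoliton p i₁ xbar U U₁) :
    Continuous (toStar U i₁) := by
  set M := U i₁ xbar
  set C := M + (1 * M + 1 * M ^ (p - 1))
  have hC : ∀ i y, 0 ≤ y → |U₁ i y| ≤ C := fun i y hy =>
    (h.sol i (y + 1)).abs_deriv_le hp (fun z hz => h.le i z hz.1) (by simp) (by simp) hy le_rfl
  have hC0 : 0 ≤ C := (abs_nonneg _).trans (hC i₁ 0 le_rfl)
  have hlip := abs_sub_le_mul_dist (f := toStar U i₁) hC0 fun i s hs t ht => by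
    rw [star_I, mem_Ici] at hs ht
    rw [h.toStar_pt i hs, h.toStar_pt i ht]
    have := (convex_Ici (0 : ℝ)).norm_image_sub_le_of_norm_hasDerivWithin_le (f := U i)
      (fun y hy => IsSolOn.hasDerivWithinAt_Ici (h.sol i) hy) (fun y hy => hC i y hy) ht hs
    simpa [Real.norm_eq_abs] using this
  refine LipschitzWith.continuous (K := C.toNNReal) (LipschitzWith.of_dist_le_mul fun x y => ?_)
  rw [Real.coe_toNNReal _ hC0, Real.dist_eq]
  exact hlip x y

lemma memH1_toStar (hp : 2 < p) (h : IsStarSoliton p i₁ xbar U U₁) :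
    (star ι).MemH1 (toStar U i₁) := by
  refine ⟨h.continuous_toStar hp, fun i => ?_⟩
  rw [star_I]
  have hU := IsSolOn.continuousOn_Ici (h.sol i)
  have hU' := IsSolOn.continuousOn_Ici' (h.sol i)
  have heq : EqOn (fun y => toStar U i₁ ((star ι).pt i y)) (U i) (Ici 0) := fun y hy =>
    h.toStar_pt i hy
  refine ⟨?_, U₁ i, ?_, fun a ha b hb => ?_⟩
  · refine memLp_two_of_integrableOn_sq measurableSet_Ici (hU.congr heq) ?_
    refine IntegrableOn.congr_fun (f := fun y => U i y ^ 2)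
      (Iff.mpr integrableOn_Ici_iff_integrableOn_Ioi (h.integrable i))
      (fun y hy => ?_) measurableSet_Ici
    simp only [heq hy]
  · exact memLp_two_of_integrableOn_sq measurableSet_Ici hU'
      (Iff.mpr integrableOn_Ici_iff_integrableOn_Ioi (h.integrable' i))
  · simp only [h.toStar_pt i ha, h.toStar_pt i hb]
    exact IsSolOn.integral_deriv_eq (h.sol i) ha hb

lemma toStar_pos (h : IsStarSoliton p i₁ xbar U U₁) (P : (star ι).Point) : 0 < toStar U i₁ P := by
  have : Nonempty ι := ⟨i₁⟩
  obtain ⟨i, y, hy, rfl⟩ := exists_star_pt P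
  rw [h.toStar_pt i hy]
  exact h.pos i y hy

lemma toStar_le (h : IsStarSoliton p i₁ xbar U U₁) (P : (star ι).Point) :
    toStar U i₁ P ≤ toStar U i₁ ((star ι).pt i₁ xbar) := by
  have : Nonempty ι := ⟨i₁⟩
  obtain ⟨i, y, hy, rfl⟩ := exists_star_pt P
  rw [h.toStar_pt i hy, h.toStar_pt i₁ h.nonneg]
  exact h.le i y hy

lemma tendsto_toStar (h : IsStarSoliton p i₁ xbar U U₁) :
    Tendsto (toStar U i₁) (comap (fun P => dist P (.vertex ())) atTop) (𝓝 0) := by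
  have : Nonempty ι := ⟨i₁⟩
  rw [Metric.tendsto_nhds]
  intro η hη
  have h1 : ∀ᶠ y in atTop, ∀ i, dist (U i y) 0 < η := eventually_all.2 fun i =>
    Metric.tendsto_nhds.1 (h.tendsto i) η hη
  filter_upwards [h1.comap _] with P hP
  obtain ⟨i, y, hy, rfl⟩ := exists_star_pt P
  rw [star_dist_pt i hy] at hP
  rw [h.toStar_pt i hy]
  exact hP i

lemma isPositiveSolution_toStar (hp : 2 < p) (h : IsStarSoliton p i₁ xbar U U₁) :
    (star ι).IsPositiveSolution p 1 1 (toStar U i₁) := by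
  have heq : ∀ i, EqOn (fun y => toStar U i₁ ((star ι).pt i y)) (U i) (Ici 0) := fun i y hy =>
    h.toStar_pt i hy
  have hd : ∀ i, EqOn (derivWithin (fun y => toStar U i₁ ((star ι).pt i y)) (Ici 0)) (U₁ i) (Ici 0) :=
    fun i y hy => ((IsSolOn.hasDerivWithinAt_Ici (h.sol i) hy).congr (fun z hz => heq i hz)
      (heq i hy)).derivWithin (uniqueDiffOn_Ici 0 y hy)
  have hd2 : ∀ i, EqOn (derivWithin (U₁ i) (Ici 0)) (fun y => 1 * U i y - 1 * U i y ^ (p - 1))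
      (Ici 0) := fun i y hy => (IsSolOn.hasDerivWithinAt_Ici' (h.sol i) hy).derivWithin
    (uniqueDiffOn_Ici 0 y hy)
  refine ⟨h.continuous_toStar hp, h.toStar_pos, fun i => ?_, fun i y hy => ?_, fun v => ?_⟩
  · have hU := IsSolOn.continuousOn_Ici (h.sol i)
    rw [star_I, show (2 : WithTop ℕ∞) = 1 + 1 from rfl,
      contDiffOn_succ_iff_derivWithin (uniqueDiffOn_Ici 0)]
    refine ⟨fun y hy => ?_, by simp, ContDiffOn.congr (f := U₁ i) ?_ (hd i)⟩
    · exact ((IsSolOn.hasDerivWithinAt_Ici (h.sol i) hy).congr (fun z hz => heq i hz)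
        (heq i hy)).differentiableWithinAt
    · rw [show (1 : WithTop ℕ∞) = 0 + 1 from rfl,
        contDiffOn_succ_iff_derivWithin (uniqueDiffOn_Ici 0)]
      refine ⟨fun y hy => (IsSolOn.hasDerivWithinAt_Ici' (h.sol i) hy).differentiableWithinAt,
        by simp, contDiffOn_zero.2 (ContinuousOn.congr ?_ (hd2 i))⟩
      exact (continuousOn_const.mul hU).sub (continuousOn_const.mul
        (hU.rpow_const fun _ _ => Or.inr (by linarith)))
  · rw [star_I] at hy ⊢
    have : iteratedDerivWithin 2 (fun y => toStar U i₁ ((star ι).pt i y)) (Ici 0) y =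
        1 * U i y - 1 * U i y ^ (p - 1) := by
      rw [iteratedDerivWithin_succ, iteratedDerivWithin_one, derivWithin_congr (hd i) (hd i hy)]
      exact hd2 i hy
    rw [this, h.toStar_pt i hy]
    ring
  · refine (HalfEdge.sum_ends (G := star ι) v
      (fun h => derivWithin (fun t => toStar U i₁ (h.pt t)) (Ici 0) 0) fun h' hh => absurd rfl hh).trans ?_
    rw [star_sum_halfEdge]
    refine Eq.trans ?_ h.kirchhoff
    exact Finset.sum_congr rfl fun i _ => hd i (mem_Ici.2 le_rfl)

/-- The integrals of powers of the solution over balls. -/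
lemma integral_ball_toStar [DecidableEq ι] (h : IsStarSoliton p i₁ xbar U U₁) {r q : ℝ}
    (hr : 0 < r) :
    (star ι).integral (Metric.ball ((star ι).pt i₁ xbar) r) (fun P => toStar U i₁ P ^ q) =
      (∫ y in Icc (max 0 (xbar - r)) (xbar + r), toStar U i₁ ((star ι).pt i₁ y) ^ q) +
        ∑ i ∈ Finset.univ.erase i₁, ∫ y in Icc 0 (r - xbar), toStar U i₁ ((star ι).pt i y) ^ q := by
  rw [star_integral_ball i₁ h.nonneg hr, ← Finset.add_sum_erase _ _ (Finset.mem_univ i₁), if_pos rfl,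
    if_pos rfl, setIntegral_Ici_inter_Ioo]
  congr 1
  refine Finset.sum_congr rfl fun i hi => ?_
  rw [if_neg (Finset.ne_of_mem_erase hi), if_neg (Finset.ne_of_mem_erase hi),
    setIntegral_Ici_inter_Ioo, max_eq_left (by norm_num)]

end IsStarSoliton

end star

end MetricGraph

/-! ### Zooming at a vertex, and the test function there -/

namespace MetricGraph

variable {V E : Type*} {G : MetricGraph V E}

lemma zoom_pt {w : V} {ε : ℝ} (h : G.Ends w) {y : ℝ} (hy : 0 ≤ y) :
    G.zoom w ε ((star (G.Ends w)).pt h y) = h.1.pt (ε * y) := by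
  rcases hy.eq_or_lt with rfl | hy
  · rw [pt_zero, mul_zero, HalfEdge.pt_zero, h.2]
    rfl
  · rw [pt_interior h y hy ENNReal.ofReal_lt_top]
    rfl

lemma mul_zoom_pt {p : ℝ} {u : G.Point → ℝ} {w : V} {ε : ℝ} (h : G.Ends w) {y : ℝ} (hy : 0 ≤ y) :
    ε ^ (2 / (p - 2)) * u (G.zoom w ε ((star (G.Ends w)).pt h y)) =
      profile p u h.1.edge (h.1.coord 0) h.1.sign ε y := by
  rw [zoom_pt h hy, profile, mul_assoc, HalfEdge.coord_zero_add]

lemma pt_mem_scaledStar {w : V} {ε : ℝ} (h : G.Ends w) {y : ℝ} (hy : 0 ≤ y)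
    (hle : ENNReal.ofReal (ε * y) ≤ G.len h.1.edge) :
    (star (G.Ends w)).pt h y ∈ G.scaledStar w ε := ⟨h, y, hy, hle, rfl⟩

/-- Used for the bumps at the two ends of one edge: their supports are disjoint, so there are no
cross terms. -/
lemma energyDensity_add {p ρ : ℝ} {f χ₁ χ₂ : ℝ → ℝ} {s : ℝ} (h1 : DifferentiableAt ℝ χ₁ s)
    (h2 : DifferentiableAt ℝ χ₂ s) (h : χ₁ s * χ₂ s = 0) (h' : deriv χ₁ s * deriv χ₂ s = 0) :
    energyDensity p ρ f (fun s => χ₁ s + χ₂ s) s =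
      energyDensity p ρ f χ₁ s + energyDensity p ρ f χ₂ s := by
  simp only [energyDensity]
  rw [deriv_fun_add h1 h2]
  linear_combination (2 * f s ^ 2) * h' - (2 * (p - 2) * ρ * f s ^ p) * h

variable [Fintype E]

open Classical in
/-- The test function supported near a vertex. -/
lemma exists_testFunction_vertex [Fintype V] [Nonempty E] {p lam ρ : ℝ} (hp : 2 < p)
    {u : G.Point → ℝ} (hu : G.IsPositiveSolution p lam ρ u) {w : V} {ε R a : ℝ} (hε : 0 < ε)
    (hR : 0 < R) (ha : ∀ e, ENNReal.ofReal a ≤ G.len e) (hRa : 2 * (2 * R * ε) < a)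
    (hneg : ∑ h : G.Ends w, ∫ y in (0 : ℝ)..(2 * R), energyDensity p ρ
      (profile p u h.1.edge (h.1.coord 0) h.1.sign ε) (cutoff (-(2 * R)) (2 * R) R) y < 0) :
    ∃ φ : G.Point → ℝ, G.IsTestFunction φ ∧
      tsupport φ ⊆ Metric.ball (.vertex w) (3 * R * ε) ∧ G.Q p lam ρ u φ < 0 := by
  set θ := cutoff (-(2 * R)) (2 * R) R with hθ
  have hb0 : 0 < 2 * R * ε := by positivity
  set b := 2 * R * ε with hb
  -- For each end, a bump written in the coordinate of its edge, nonzero only when the end is at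
  -- `w`. It equals 1 at `w` and vanishes at arclength `b` and beyond.
  set χ : G.HalfEdge → ℝ → ℝ := fun h s =>
    if h.base = w then θ (h.sign / ε * (s - h.coord 0)) else 0 with hχ
  have hχsm : ∀ h, ContDiff ℝ ∞ (χ h) := fun h => by
    by_cases hw : h.base = w
    · simp only [hχ, if_pos hw]
      exact cutoff_contDiff.comp (contDiff_const.mul (contDiff_id.sub contDiff_const))
    · simp only [hχ, if_neg hw]; exact contDiff_const
  have hχd : ∀ h s, DifferentiableAt ℝ (χ h) s := fun h s =>
    ((hχsm h).differentiable (by simp)) s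
  have hθ0 : θ 0 = 1 := cutoff_eq_one hR ⟨by linarith, by linarith⟩
  have hcoord : ∀ (h : G.HalfEdge) (t : ℝ), h.sign / ε * (h.coord t - h.coord 0) = t / ε :=
    fun h t => by
      rw [h.coord_eq t, add_sub_cancel_left,
        show h.sign / ε * (h.sign * t) = h.sign ^ 2 * (t / ε) by ring, h.sign_sq, one_mul]
  have hχc : ∀ (h : G.HalfEdge) (t : ℝ), χ h (h.coord t) = if h.base = w then θ (t / ε) else 0 :=
    fun h t => by simp only [hχ, hcoord]
  have hχ0 : ∀ (h : G.HalfEdge) (t : ℝ), b ≤ t → χ h (h.coord t) = 0 := fun h t ht => by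
    rw [hχc]
    split_ifs
    · refine cutoff_eq_zero hR fun h' => ?_
      have := (div_lt_iff₀ hε).1 h'.2
      linarith
    · rfl
  have hχ0' : ∀ (h : G.HalfEdge) (t : ℝ), b < t → deriv (χ h) (h.coord t) = 0 := fun h t ht => by
    have : χ h =ᶠ[𝓝 (h.coord t)] fun _ => 0 := by
      have hcont : Continuous h.coord := by
        have : h.coord = fun t => h.coord 0 + h.sign * t := funext h.coord_eq
        rw [this]; fun_prop
      have h1 : ∀ᶠ s in 𝓝 (h.coord t), b < h.coord s := by
        refine (hcont.tendsto (h.coord t)).eventually (lt_mem_nhds ?_)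
        rwa [HalfEdge.coord_coord]
      filter_upwards [h1] with s hs
      have := hχ0 h _ hs.le
      rwa [HalfEdge.coord_coord] at this
    rw [this.deriv_eq, deriv_const]
  have hlen : ∀ e, G.len e ≠ ⊤ → 2 * b < (G.len e).toReal := fun e he =>
    hRa.trans_le ((ENNReal.ofReal_le_iff_le_toReal he).1 (ha e))
  set c : V → ℝ := fun v => if v = w then 1 else 0 with hc
  -- The bumps of both ends are added, so a loop at `w` receives one at each end. A bounded edge is
  -- longer than `2 * b`, so they do not overlap.
  set ψ : E → ℝ → ℝ := fun e s => χ (.initial e) s +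
    (if hl : G.len e ≠ ⊤ then χ (.terminal e hl) else fun _ => 0) s with hψ
  have hti : ∀ e (hl : G.len e ≠ ⊤) s, b ≤ (G.len e).toReal - s → χ (.terminal e hl) s = 0 :=
    fun e hl s hs => by
      have := hχ0 (.terminal e hl) _ hs
      simpa only [HalfEdge.coord, sub_sub_cancel] using this
  have hti' : ∀ e (hl : G.len e ≠ ⊤) s, b < (G.len e).toReal - s →
      deriv (χ (.terminal e hl)) s = 0 := fun e hl s hs => by
    have := hχ0' (.terminal e hl) _ hs
    simpa only [HalfEdge.coord, sub_sub_cancel] using this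
  have hcut : G.IsCutoff c ψ b := by
    refine ⟨fun e => ?_, fun e => ?_, fun e hl => ?_, fun e hl s hs => ?_⟩
    · refine (hχsm _).add ?_
      split_ifs
      exacts [hχsm _, contDiff_const]
    · have h1 := hχc (.initial e) 0
      rw [zero_div, hθ0] at h1
      simp only [hψ]
      refine Eq.trans ?_ h1
      change _ = χ (.initial e) 0
      split_ifs with hl
      · rw [hti e hl 0 (by linarith [hlen e hl]), add_zero]
      · rw [add_zero]
    · have h1 := hχc (.terminal e hl) 0
      rw [zero_div, hθ0] at h1
      simp only [HalfEdge.coord, sub_zero] at h1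
      have h2 := hχ0 (.initial e) (G.len e).toReal (by linarith [hlen e hl])
      simp only [HalfEdge.coord] at h2
      simp only [hψ, dif_pos hl, h1, h2, zero_add]
      rfl
    · have h2 := hχ0 (.initial e) s hs
      simp only [HalfEdge.coord] at h2
      simp only [hψ, h2, dif_neg (not_not.2 hl), add_zero]
  refine ⟨_, hcut.isTestFunction hu, ?_, ?_⟩
  · refine (closure_minimal (t := Metric.closedBall (.vertex w) b) ?_
      Metric.isClosed_closedBall).trans (Metric.closedBall_subset_ball ?_)
    · intro x hx
      have hx' : G.glue c ψ x ≠ 0 := fun h => hx (by simp only [h, mul_zero])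
      rw [Metric.mem_closedBall]
      rcases x with v | ⟨e, s, h1, h2⟩
      · have : v = w := by by_contra hv; exact hx' (if_neg hv)
        rw [this, dist_self]
        exact hb0.le
      · have hs : s ∈ G.I e := ⟨h1.le, h2.le⟩
        rw [← pt_interior e s h1 h2]
        have key : ∀ h : G.HalfEdge, h.edge = e → χ h s ≠ 0 →
            dist (G.pt e s) (.vertex w) ≤ b := by
          rintro h rfl hne
          have hw : h.base = w := by by_contra hw; exact hne (by simp only [hχ, if_neg hw])
          have ht : h.coord s < b := by
            by_contra! hle
            have := hχ0 h _ hle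
            rw [HalfEdge.coord_coord] at this
            exact hne this
          have ht' : h.coord s ∈ G.I h.edge := HalfEdge.coord_mem_I hs
          have := HalfEdge.dist_pt_le ht' (zero_mem_I h.edge)
          rw [HalfEdge.pt_eq, HalfEdge.coord_coord, HalfEdge.pt_zero, hw, sub_zero,
            abs_of_nonneg ht'.1] at this
          exact this.trans ht.le
        by_cases hi : χ (.initial e) s = 0
        · have hx2 : (if hl : G.len e ≠ ⊤ then χ (.terminal e hl) else fun _ => 0) s ≠ 0 := by
            intro h0
            refine hx' ?_
            change χ (.initial e) s + _ = 0
            rw [hi, h0, add_zero]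
          split_ifs at hx2 with hl
          · exact key (.terminal e hl) rfl hx2
          · exact absurd rfl hx2
        · exact key (.initial e) rfl hi
    · have : 0 < R * ε := by positivity
      linarith
  · rw [hcut.Q_eq hp hu]
    set F : E → G.HalfEdge → ℝ → ℝ := fun e h =>
      energyDensity p ρ (fun x => u (G.pt e x)) (χ h) with hF
    set S : G.HalfEdge → Set ℝ := fun h => {x | h.sign / ε * (x - h.coord 0) ∈ Icc 0 (2 * R)} with hS
    have hSmem : ∀ (h : G.HalfEdge) x, x ∈ S h ↔ h.coord x ∈ Icc 0 b := fun h x => by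
      have h1 := hcoord h (h.coord x)
      rw [HalfEdge.coord_coord] at h1
      simp only [hS, mem_ofPred_eq, h1, mem_Icc, hb]
      rw [le_div_iff₀ hε, div_le_iff₀ hε, zero_mul]
    have hbI : ∀ e, b ∈ G.I e := fun e => ⟨hb0.le, (ENNReal.ofReal_le_ofReal (by linarith)).trans (ha e)⟩
    have hSI : ∀ h, S h ⊆ G.I h.edge := fun h x hx => by
      rw [hSmem] at hx
      have := HalfEdge.coord_mem_I (mem_I_of_le (hbI h.edge) hx.1 hx.2)
      rwa [HalfEdge.coord_coord] at this
    have hF0 : ∀ (h : G.HalfEdge) x, x ∈ G.I h.edge → x ∉ S h → F h.edge h x = 0 := fun h x hx hxS => by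
      have h1 : b < h.coord x := by
        by_contra! hle
        exact hxS ((hSmem h x).2 ⟨(HalfEdge.coord_mem_I hx).1, hle⟩)
      have h2 := hχ0 h _ h1.le
      have h3 := hχ0' h _ h1
      rw [HalfEdge.coord_coord] at h2 h3
      exact IsCutoff.energyDensity_eq_zero h2 h3
    have hFc : ∀ h : G.HalfEdge, ContinuousOn (F h.edge h) (G.I h.edge) := fun h =>
      continuousOn_energyDensity hp (hu.continuousOn h.edge) (hχsm h)
    have hFi : ∀ h : G.HalfEdge, IntegrableOn (F h.edge h) (G.I h.edge) := fun h => by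
      refine integrableOn_I (B := b + 1) (hFc h) fun hl x hx => hF0 h x ?_ fun hxS => ?_
      · rw [I_eq_Ici hl]; exact mem_Ici.2 (by linarith)
      · rw [hSmem] at hxS
        cases h with
        | initial e => linarith [hxS.2, show HalfEdge.coord (.initial e : G.HalfEdge) x = x from rfl]
        | terminal e hl' => exact hl' hl
    have hval : ∀ h : G.HalfEdge, ∫ x in G.I h.edge, F h.edge h x =
        if h.base = w then ε ^ (1 - 2 / (p - 2) * p) * ∫ y in (0 : ℝ)..(2 * R),
          energyDensity p ρ (profile p u h.edge (h.coord 0) h.sign ε) θ y else 0 := fun h => by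
      split_ifs with hw
      · rw [setIntegral_eq_of_subset_of_forall_sdiff_eq_zero (isClosed_I _).measurableSet (hSI h)
          fun x hx => hF0 h x hx.1 hx.2, ← setIntegral_energyDensity_side hp hu.pos h.sign_sq hε
          (by linarith)]
        have : χ h = fun s => θ (h.sign / ε * (s - h.coord 0)) := by
          funext s; simp only [hχ, if_pos hw]
        simp only [hF, this, hS]
      · have : χ h = fun _ => 0 := by funext s; simp only [hχ, if_neg hw]
        refine setIntegral_eq_zero_of_forall_eq_zero fun x _ => ?_
        simp only [hF, this]
        exact IsCutoff.energyDensity_eq_zero rfl (by simp)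
    have hedge : ∀ e, ∫ x in G.I e, energyDensity p ρ (fun x => u (G.pt e x)) (ψ e) x =
        (∫ x in G.I e, F e (.initial e) x) +
          if hl : G.len e ≠ ⊤ then ∫ x in G.I e, F e (.terminal e hl) x else 0 := fun e => by
      by_cases hl : G.len e ≠ ⊤
      · have i1 : IntegrableOn (F e (.initial e)) (G.I e) := hFi (.initial e)
        have i2 : IntegrableOn (F e (.terminal e hl)) (G.I e) := hFi (.terminal e hl)
        rw [dif_pos hl, ← integral_add i1 i2]
        refine setIntegral_congr_fun (isClosed_I e).measurableSet fun x hx => ?_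
        have hψe : ψ e = fun s => χ (.initial e) s + χ (.terminal e hl) s := by
          funext s; simp only [hψ, dif_pos hl]
        simp only [hψe, hF]
        rcases lt_or_ge b x with hbx | hbx
        · have h2 : χ (.initial e) x = 0 := hχ0 (.initial e) x hbx.le
          have h3 : deriv (χ (.initial e)) x = 0 := hχ0' (.initial e) x hbx
          exact energyDensity_add (hχd _ _) (hχd _ _) (by rw [h2, zero_mul]) (by rw [h3, zero_mul])
        · have h1 := hlen e hl
          exact energyDensity_add (hχd _ _) (hχd _ _)
            (by rw [hti e hl x (by linarith), mul_zero]) (by rw [hti' e hl x (by linarith), mul_zero])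
      · rw [dif_neg hl, add_zero]
        have hψe : ψ e = χ (.initial e) := by
          funext s; simp only [hψ, dif_neg hl, add_zero]
        rw [hψe]
    -- The sum over edges becomes a sum over ends, of which only those at `w` survive; this is the
    -- form of `hneg`.
    have hsum : ∑ e, ∫ x in G.I e, energyDensity p ρ (fun x => u (G.pt e x)) (ψ e) x =
        ∑ h : G.HalfEdge, ∫ x in G.I h.edge, F h.edge h x := by
      rw [HalfEdge.sum_eq]
      exact Finset.sum_congr rfl fun e _ => hedge e
    rw [hsum, Finset.sum_congr rfl fun h _ => hval h, ← HalfEdge.sum_ends w _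
      fun h hh => if_neg hh, Finset.sum_congr rfl fun h _ => if_pos h.2, ← Finset.mul_sum]
    exact mul_neg_of_pos_of_neg (Real.rpow_pos_of_pos hε _) hneg

end MetricGraph

/-! ### Case (B): concentration at a vertex -/

namespace MetricGraph

variable {V E : Type*} {G : MetricGraph V E} [Fintype E]

/-- The scaled integral over a small ball near a vertex. -/
lemma mul_integral_ball_rpow_eq [Nonempty E] {p lam ε q t r : ℝ} {w : V} {u : G.Point → ℝ}
    (hq : 0 ≤ q) (hlam : 0 < lam) (hε : ε = lam ^ (-(1 / 2) : ℝ)) (hu : Continuous u)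
    (hpos : ∀ x, 0 < u x) (h₁ : G.Ends w) (hr : 0 < r) (ht : 0 ≤ t)
    (hℓ : ∀ e, ENNReal.ofReal (2 * (r * ε + t)) ≤ G.len e) :
    lam ^ (1 / 2 - q / (p - 2)) *
        G.integral (Metric.ball (h₁.1.pt t) (r * ε)) (fun z => u z ^ q) =
      ∑ h : G.Ends w, ∫ y in Ici 0 ∩ Ioo (if h = h₁ then t / ε - r else -1)
        (if h = h₁ then t / ε + r else r - t / ε),
        profile p u h.1.edge (h.1.coord 0) h.1.sign ε y ^ q := by
  classical
  have hε0 : 0 < ε := by rw [hε]; exact Real.rpow_pos_of_pos hlam _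
  rw [integral_ball_eq_sum (mul_pos hr hε0) ht hℓ fun e => ?_]
  · rw [← HalfEdge.sum_ends w _ fun h hh => if_neg (by rwa [h₁.2]), Finset.mul_sum]
    refine Finset.sum_congr rfl fun h _ => ?_
    rw [if_pos (h.2.trans h₁.2.symm), mul_setIntegral_rpow_eq hlam hε (fun s => hpos _)
      (measurableSet_Ici.inter measurableSet_Ioo) 0]
    have hset : {y | 0 + ε * y ∈ Ici 0 ∩ Ioo (if h.1 = h₁.1 then t - r * ε else -1)
        (if h.1 = h₁.1 then t + r * ε else r * ε - t)} =
        Ici 0 ∩ Ioo (if h = h₁ then t / ε - r else -1)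
          (if h = h₁ then t / ε + r else r - t / ε) := by
      obtain ⟨τ, rfl⟩ : ∃ τ, t = ε * τ := ⟨t / ε, (mul_div_cancel₀ _ hε0.ne').symm⟩
      rw [mul_div_cancel_left₀ _ hε0.ne']
      ext y
      have h1 : ∀ b, ε * b < ε * y ↔ b < y := fun b => mul_lt_mul_iff_right₀ hε0
      have h2 : ∀ b, ε * y < ε * b ↔ y < b := fun b => mul_lt_mul_iff_right₀ hε0
      simp only [mem_ofPred_eq, zero_add, mem_inter_iff, mem_Ici, mem_Ioo,
        mul_nonneg_iff_of_pos_left hε0]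
      refine and_congr_right fun hy => ?_
      by_cases hh : h = h₁
      · have hh' : h.1 = h₁.1 := by rw [hh]
        rw [if_pos hh, if_pos hh, if_pos hh', if_pos hh', ← h1, ← h2]
        ring_nf
      · have hh' : ¬h.1 = h₁.1 := fun he => hh (Subtype.ext he)
        rw [if_neg hh, if_neg hh, if_neg hh', if_neg hh', ← h2]
        have : 0 ≤ ε * y := mul_nonneg hε0.le hy
        constructor <;> rintro ⟨-, h3⟩ <;> exact ⟨by linarith, by linarith⟩
    rw [hset]
    congr 1
    funext y
    rw [profile, mul_assoc, HalfEdge.coord_zero_add, zero_add]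
  · exact (hu.comp_continuousOn (continuousOn_pt e)).rpow_const fun _ _ => Or.inr hq

/-- The blow-up near a vertex. -/
theorem vertex_blowUp [Fintype V] [Nonempty E] {k : ℕ} {p : ℝ} (hp : 2 < p)
    {lam ρ t ℓ δ ε : ℕ → ℝ} {u : ℕ → G.Point → ℝ} {w : V} {h₁ : G.Ends w} {B a : ℝ}
    (h : IsBlowUp G p lam ρ u (fun h : G.Ends w => h.1.edge) (fun h _ => h.1.coord 0)
      (fun h => h.1.sign) ℓ h₁ t δ B)
    (hk : ∀ n, G.morseIndex p (lam n) (ρ n) (u n) ≤ k)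
    (hε : ∀ n, ε n = lam n ^ (-(1 / 2) : ℝ)) (ha : ∀ e, ENNReal.ofReal a ≤ G.len e)
    (hℓ : ∀ n, ℓ n ≤ a / 4) (htI : ∀ n, t n ∈ G.I h₁.1.edge) :
    ∃ σ : ℕ → ℕ, StrictMono σ ∧
      (∃ c : ℝ, 0 < c ∧ c ≤ 1 ∧ Tendsto (fun n => δ (σ n) / ε (σ n)) atTop (𝓝 c)) ∧
      ∃ (W : (star (G.Ends w)).Point → ℝ) (xbar : ℝ),
        0 ≤ xbar ∧ Tendsto (fun n => t (σ n) / ε (σ n)) atTop (𝓝 xbar) ∧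
        (∀ K : Set (star (G.Ends w)).Point, IsCompact K →
          (∀ᶠ n in atTop, K ⊆ G.scaledStar w (ε (σ n))) ∧
          TendstoUniformlyOn
            (fun n P => ε (σ n) ^ (2 / (p - 2)) * u (σ n) (G.zoom w (ε (σ n)) P)) W atTop K) ∧
        (∀ h : G.Ends w, TendstoC2Loc (Ici 0)
          (fun n => {y | 0 ≤ y ∧ ENNReal.ofReal (ε (σ n) * y) ≤ G.len h.1.edge})
          (fun n y => ε (σ n) ^ (2 / (p - 2)) *
            u (σ n) (G.zoom w (ε (σ n)) ((star (G.Ends w)).pt h y)))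
          (fun y => W ((star (G.Ends w)).pt h y))) ∧
        (star (G.Ends w)).MemH1 W ∧ (star (G.Ends w)).IsPositiveSolution p 1 1 W ∧
        Tendsto W (comap (fun P => dist P (.vertex ())) atTop) (𝓝 0) ∧
        (∀ P, W P ≤ W ((star (G.Ends w)).pt h₁ xbar)) ∧
        (∃ Rbar > 0, ∀ n, ∃ φ : G.Point → ℝ, G.IsTestFunction φ ∧
          tsupport φ ⊆ Metric.ball (h₁.1.pt (t (σ n))) (Rbar * ε (σ n)) ∧
          G.Q p (lam (σ n)) (ρ (σ n)) (u (σ n)) φ < 0) ∧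
        ∀ r > 0, ∀ q : ℝ, 1 ≤ q →
          Tendsto (fun n => lam (σ n) ^ (1 / 2 - q / (p - 2)) *
            G.integral (Metric.ball (h₁.1.pt (t (σ n))) (r * ε (σ n))) (fun z => u (σ n) z ^ q)) atTop
            (𝓝 ((star (G.Ends w)).integral
              (Metric.ball ((star (G.Ends w)).pt h₁ xbar) r) (fun P => W P ^ q))) ∧
          Tendsto (fun n => (star (G.Ends w)).integral
            (G.scaledStar w (ε (σ n)) ∩
              Metric.ball ((star (G.Ends w)).pt h₁ (t (σ n) / ε (σ n))) r)
            (fun P => (ε (σ n) ^ (2 / (p - 2)) * u (σ n) (G.zoom w (ε (σ n)) P)) ^ q)) atTop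
            (𝓝 ((star (G.Ends w)).integral
              (Metric.ball ((star (G.Ends w)).pt h₁ xbar) r) (fun P => W P ^ q))) ∧
          (star (G.Ends w)).integral
              (Metric.ball ((star (G.Ends w)).pt h₁ xbar) r) (fun P => W P ^ q)
            = (∫ y in Icc (max 0 (xbar - r)) (xbar + r), W ((star (G.Ends w)).pt h₁ y) ^ q)
              + ∑ h ∈ Finset.univ.erase h₁, ∫ y in Icc 0 (r - xbar),
                W ((star (G.Ends w)).pt h y) ^ q := by
  obtain ⟨σ, hσ, hc, hL, xbar, M, U, U₁, hU, hx, hUM, hfM, hf, hg, R, hR, hRn⟩ :=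
    h.exists_limit hp hk hε
  have : Nonempty (G.Ends w) := ⟨h₁⟩
  have hε0 : ∀ n, 0 < ε n := fun n => by rw [hε]; exact Real.rpow_pos_of_pos (h.lam_pos n) _
  have hε2 : ∀ n, ε n ^ 2 * lam n = 1 := fun n => by
    have hl := h.lam_pos n
    rw [hε, ← Real.rpow_natCast, ← Real.rpow_mul hl.le]
    nth_rw 2 [← Real.rpow_one (lam n)]
    rw [← Real.rpow_add hl]
    norm_num
  set f : G.Ends w → ℕ → ℝ → ℝ := fun i n =>
    profile p (u (σ n)) i.1.edge (i.1.coord 0) i.1.sign (ε (σ n)) with hfdef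
  set f₁ : G.Ends w → ℕ → ℝ → ℝ := fun i n =>
    profileDeriv p (u (σ n)) i.1.edge (i.1.coord 0) i.1.sign (ε (σ n)) with hf₁def
  have hv : ∀ (i : G.Ends w) n y, 0 ≤ y → ε (σ n) ^ (2 / (p - 2)) *
      u (σ n) (G.zoom w (ε (σ n)) ((star (G.Ends w)).pt i y)) = f i n y := fun i n y hy =>
    mul_zoom_pt i hy
  have hεℓ : ∀ {n y}, y ≤ ℓ (σ n) / ε (σ n) → ε (σ n) * y ≤ ℓ (σ n) := fun hy =>
    (le_div_iff₀' (hε0 _)).1 hy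
  have hle : ∀ {n y}, 0 ≤ y → y ≤ ℓ (σ n) / ε (σ n) → ∀ e, ENNReal.ofReal (ε (σ n) * y) ≤ G.len e :=
    fun {n y} hy0 hy e => (ENNReal.ofReal_le_ofReal (by
      have h1 := hεℓ hy
      have h2 := hℓ (σ n)
      have h3 := mul_nonneg (hε0 (σ n)).le hy0
      linarith)).trans (ha e)
  have hmem : ∀ (i : G.Ends w) n, ∀ y ∈ Icc 0 (ℓ (σ n) / ε (σ n)),
      i.1.coord 0 + i.1.sign * ε (σ n) * y ∈ G.I i.1.edge := fun i n y hy => by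
    rw [mul_assoc]
    exact h.mem i (σ n) _ ⟨mul_nonneg (hε0 _).le hy.1, hεℓ hy.2⟩
  have hfI : ∀ i n, ∀ y ∈ Icc 0 (ℓ (σ n) / ε (σ n)), f i n y ∈ Icc 0 M := fun i n y hy =>
    ⟨mul_nonneg (Real.rpow_nonneg (hε0 _).le _) ((h.sol _).pos _).le, hfM i n y hy⟩
  have hnhds : ∀ {n y}, 0 ≤ y → y < ℓ (σ n) / ε (σ n) →
      Icc 0 (ℓ (σ n) / ε (σ n)) ∈ 𝓝[Ici 0] y := fun hy0 hy => by
    rw [← Ici_inter_Iic]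
    exact inter_mem_nhdsWithin _ (Iic_mem_nhds hy)
  have hd1 : ∀ i {n y}, 0 ≤ y → y < ℓ (σ n) / ε (σ n) →
      HasDerivWithinAt (f i n) (f₁ i n y) (Ici 0) y := fun i {n y} hy0 hy =>
    (hasDerivWithinAt_profile (h.sol _) (hmem i n) ⟨hy0, hy.le⟩).mono_of_mem_nhdsWithin
      (hnhds hy0 hy)
  have hd2 : ∀ i {n y}, 0 ≤ y → y < ℓ (σ n) / ε (σ n) →
      HasDerivWithinAt (f₁ i n) (1 * f i n y - ρ (σ n) * f i n y ^ (p - 1)) (Ici 0) y :=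
    fun i {n y} hy0 hy => by
      refine ((hasDerivWithinAt_profileDeriv hp (h.sol _) i.1.sign_sq (hε0 (σ n)) (hmem i n)
        ⟨hy0, hy.le⟩).mono_of_mem_nhdsWithin (hnhds hy0 hy)).congr_deriv ?_
      rw [hε2]
  have hIci : ∀ b : ℝ, Ici (0 : ℝ) ∩ Icc (-b) b ⊆ Icc 0 b := fun b y hy => ⟨hy.1, hy.2.2⟩
  set W := IsStarSoliton.toStar U h₁ with hW
  have hWpt : ∀ i y, 0 ≤ y → W ((star (G.Ends w)).pt i y) = U i y := fun i y hy => hU.toStar_pt i hy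
  obtain ⟨C, hC⟩ := hx.bddAbove_range
  have ht0 : ∀ n, 0 ≤ t n := fun n => (h.t_mem n).1
  have htx : ∀ n, ε (σ n) * (t (σ n) / ε (σ n)) = t (σ n) := fun n => mul_div_cancel₀ _ (hε0 _).ne'
  have htx0 : ∀ n, 0 ≤ t (σ n) / ε (σ n) := fun n => div_nonneg (ht0 _) (hε0 _).le
  refine ⟨σ, hσ, hc, W, xbar, hU.nonneg, hx, fun K hK => ?_, fun i => ?_, hU.memH1_toStar hp,
    hU.isPositiveSolution_toStar hp, hU.tendsto_toStar, hU.toStar_le, ?_, fun r hr q hq => ?_⟩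
  -- A compact set lies in a ball around the centre, that is, in the segments `[0, b]` of the
  -- finitely many branches, where convergence is already uniform.
  · obtain ⟨b, hb⟩ := hK.isBounded.subset_closedBall (.vertex ())
    have hKb : ∀ P ∈ K, ∃ i y, y ∈ Icc 0 b ∧ P = (star (G.Ends w)).pt i y := fun P hP => by
      obtain ⟨i, y, hy, rfl⟩ := exists_star_pt P
      have := hb hP
      rw [Metric.mem_closedBall, star_dist_pt i hy] at this
      exact ⟨i, y, ⟨hy, this⟩, rfl⟩
    constructor
    · filter_upwards [hL.eventually_ge_atTop b] with n hn P hP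
      obtain ⟨i, y, hy, rfl⟩ := hKb P hP
      exact pt_mem_scaledStar i hy.1 (hle hy.1 (hy.2.trans hn) _)
    · rw [Metric.tendstoUniformlyOn_iff]
      intro η hη
      filter_upwards [eventually_all.2 fun i => Metric.tendstoUniformlyOn_iff.1 (hf i b) η hη]
        with n hn P hP
      obtain ⟨i, y, hy, rfl⟩ := hKb P hP
      rw [hWpt i y hy.1, hv i n y hy.1]
      exact hn i y hy
  · have heq : ∀ n, EqOn (fun y => ε (σ n) ^ (2 / (p - 2)) *
        u (σ n) (G.zoom w (ε (σ n)) ((star (G.Ends w)).pt i y))) (f i n) (Ici 0) := fun n y hy =>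
      hv i n y hy
    have heqW : EqOn (fun y => W ((star (G.Ends w)).pt i y)) (U i) (Ici 0) := fun y hy => hWpt i y hy
    have hev : ∀ b : ℝ, ∀ᶠ n in atTop, ∀ y ∈ Ici 0 ∩ Icc (-b) b, y < ℓ (σ n) / ε (σ n) := fun b => by
      filter_upwards [hL.eventually_gt_atTop b] with n hn y hy using hy.2.2.trans_lt hn
    have hUc := IsSolOn.continuousOn_Ici (hU.sol i)
    refine tendstoC2Loc_of_tendstoUniformlyOn (uniqueDiffOn_Ici 0) (fun b hb => ?_)
      (v₁ := f₁ i) (v₂ := fun n y => 1 * f i n y - ρ (σ n) * f i n y ^ (p - 1))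
      (V₁ := U₁ i) (V₂ := fun y => 1 * U i y - 1 * U i y ^ (p - 1)) (fun b _ => ?_) (fun b _ => ?_)
      (fun b _ => ?_) (fun b _ => ?_) (fun y hy => ?_) (fun y hy => ?_) ?_ (fun b _ => ?_)
      (fun b _ => (hg i b).mono (hIci b)) (fun b _ => ?_)
    · have : Ici (0 : ℝ) ∩ Icc (-b) b = Icc 0 b :=
        (hIci b).antisymm fun y hy => ⟨hy.1, by linarith [hy.1], hy.2⟩
      rw [this]
      exact uniqueDiffOn_Icc hb
    · filter_upwards [hev b] with n hn y hy using ⟨hy.1, hle hy.1 (hn y hy).le _⟩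
    · filter_upwards [hev b] with n hn y hy
      exact (hd1 i hy.1 (hn y hy)).congr (fun z hz => heq n hz) (heq n hy.1)
    · filter_upwards [hev b] with n hn y hy using hd2 i hy.1 (hn y hy)
    · filter_upwards [hev b] with n hn
      have hcf : ContinuousOn (f i n) (Ici 0 ∩ Icc (-b) b) := fun y hy =>
        (hd1 i hy.1 (hn y hy)).continuousWithinAt.mono inter_subset_left
      exact (continuousOn_const.mul hcf).sub (continuousOn_const.mul
        (hcf.rpow_const fun _ _ => Or.inr (by linarith)))
    · exact (IsSolOn.hasDerivWithinAt_Ici (hU.sol i) hy).congr (fun z hz => heqW hz) (heqW hy)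
    · exact IsSolOn.hasDerivWithinAt_Ici' (hU.sol i) hy
    · exact (continuousOn_const.mul hUc).sub (continuousOn_const.mul
        (hUc.rpow_const fun _ _ => Or.inr (by linarith)))
    · exact (((hf i b).mono (hIci b)).congr (Eventually.of_forall fun n y hy =>
        (heq n hy.1).symm)).congr_right fun y hy => (heqW hy.1).symm
    · refine tendstoUniformlyOn_nonlinearity (M := M) hp ((hf i b).mono (hIci b)) tendsto_const_nhds
        (h.tendsto_rho.comp hσ.tendsto_atTop) ?_ fun y hy => ⟨(hU.pos i y hy.1).le, hUM i y hy.1⟩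
      filter_upwards [hev b] with n hn y hy using hfI i n y ⟨hy.1, (hn y hy).le⟩
  · have hC0 : 0 ≤ C := (htx0 0).trans (hC (mem_range_self 0))
    -- The test function lives in a ball of radius `3 * R * ε` around the vertex, and the maximum
    -- point is within `C * ε` of the vertex.
    refine ⟨3 * R + C, by positivity, fun n => ?_⟩
    have h1 := hεℓ (hRn n).1.le
    have h2 := hℓ (σ n)
    have h3 : 0 < 2 * R * ε (σ n) := mul_pos (by linarith) (hε0 _)
    obtain ⟨φ, hφ, hφs, hφQ⟩ := exists_testFunction_vertex hp (h.sol _) (hε0 (σ n)) hR ha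
      (by linarith) (hRn n).2
    refine ⟨φ, hφ, hφs.trans (Metric.ball_subset_ball' ?_), hφQ⟩
    have hxC : t (σ n) / ε (σ n) ≤ C := hC (mem_range_self n)
    have htC : t (σ n) ≤ C * ε (σ n) := (div_le_iff₀ (hε0 _)).1 hxC
    have hd := HalfEdge.dist_pt_le (zero_mem_I h₁.1.edge) (htI (σ n))
    rw [HalfEdge.pt_zero, h₁.2, zero_sub, abs_neg, abs_of_nonneg (ht0 _)] at hd
    linarith
  -- For large `n` all the balls involved stay in the segments `[0, b]`, although their centres
  -- move.
  · set b := xbar + r + 1 with hb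
    have hxb : ∀ᶠ n in atTop, t (σ n) / ε (σ n) + r < b :=
      (hx.add_const r).eventually (gt_mem_nhds (by linarith))
    have hLb := hL.eventually_gt_atTop b
    set J : ℕ → ℝ := fun n => ∑ i : G.Ends w, ∫ y in Ici 0 ∩ Ioo
      (if i = h₁ then t (σ n) / ε (σ n) - r else -1)
      (if i = h₁ then t (σ n) / ε (σ n) + r else r - t (σ n) / ε (σ n)), f i n y ^ q with hJ
    have hT : ∀ {α β : ℝ}, β ≤ b → Ici (0 : ℝ) ∩ Ioo α β = Icc 0 b ∩ Ioo α β := fun hβ => by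
      ext y
      simp only [mem_inter_iff, mem_Ici, mem_Icc, mem_Ioo]
      exact ⟨fun ⟨h1, h2, h3⟩ => ⟨⟨h1, h3.le.trans hβ⟩, h2, h3⟩, fun ⟨h1, h2⟩ => ⟨h1.1, h2⟩⟩
    have hβ : ∀ (i : G.Ends w) {x : ℝ}, 0 ≤ x → x + r ≤ b → (if i = h₁ then x + r else r - x) ≤ b :=
      fun i x h0 hx => by split_ifs <;> linarith
    have hlim : Tendsto J atTop (𝓝 ((star (G.Ends w)).integral
        (Metric.ball ((star (G.Ends w)).pt h₁ xbar) r) (fun P => W P ^ q))) := by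
      rw [star_integral_ball h₁ hU.nonneg hr]
      refine tendsto_finsetSum _ fun i _ => ?_
      have e1 : ∫ y in Ici 0 ∩ Ioo (if i = h₁ then xbar - r else -1)
          (if i = h₁ then xbar + r else r - xbar), W ((star (G.Ends w)).pt i y) ^ q =
          ∫ y in Icc 0 b ∩ Ioo (if i = h₁ then xbar - r else -1)
          (if i = h₁ then xbar + r else r - xbar), U i y ^ q := by
        rw [hT (hβ i hU.nonneg (by linarith))]
        exact setIntegral_congr_fun (measurableSet_Icc.inter measurableSet_Ioo) fun y hy => by
          simp only [hWpt i y hy.1.1]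
      rw [e1]
      refine Tendsto.congr' (f₁ := fun n => ∫ y in Icc 0 b ∩ Ioo
        (if i = h₁ then t (σ n) / ε (σ n) - r else -1)
        (if i = h₁ then t (σ n) / ε (σ n) + r else r - t (σ n) / ε (σ n)), f i n y ^ q) ?_ ?_
      · filter_upwards [hxb] with n hn
        rw [hT (hβ i (htx0 n) hn.le)]
      · refine tendsto_integral_rpow_inter_Ioo (M := M) (by linarith) measurableSet_Icc (by simp) ?_ ?_
          (fun y hy => (hf i b).tendsto_at hy) ?_ ?_
        · filter_upwards [hLb] with n hn y hy
          exact (hd1 i hy.1 (hy.2.trans_lt hn)).continuousWithinAt.mono Icc_subset_Ici_self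
        · filter_upwards [hLb] with n hn y hy using hfI i n y ⟨hy.1, hy.2.trans hn.le⟩
        · split_ifs
          exacts [hx.sub_const r, tendsto_const_nhds]
        · split_ifs
          exacts [hx.add_const r, hx.const_sub r]
    refine ⟨hlim.congr' ?_, hlim.congr' ?_, hU.integral_ball_toStar hr⟩
    · filter_upwards [hxb, hLb] with n hn hn'
      refine (mul_integral_ball_rpow_eq (by linarith) (h.lam_pos _) (hε _) (h.sol _).continuous
        (h.sol _).pos h₁ hr (ht0 _) fun e => (ENNReal.ofReal_le_ofReal ?_).trans (ha e)).symm
      have h1 := hεℓ (hn.le.trans hn'.le)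
      have h2 := hℓ (σ n)
      have h3 : 0 < r * ε (σ n) := mul_pos hr (hε0 _)
      rw [mul_add, htx] at h1
      have := ht0 (σ n)
      linarith
    · filter_upwards [hxb, hLb] with n hn hn'
      -- For large `n` the ball does not leave the rescaled edges, so the intersection in the
      -- statement is the whole ball.
      have hsub : Metric.ball ((star (G.Ends w)).pt h₁ (t (σ n) / ε (σ n))) r ⊆
          G.scaledStar w (ε (σ n)) := fun P hP => by
        obtain ⟨i, y, hy, rfl⟩ := exists_star_pt P
        refine pt_mem_scaledStar i hy (hle hy ?_ _)
        rw [Metric.mem_ball] at hP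
        have h1 := dist_triangle ((star (G.Ends w)).pt i y)
          ((star (G.Ends w)).pt h₁ (t (σ n) / ε (σ n))) (.vertex ())
        rw [star_dist_pt i hy, star_dist_pt h₁ (htx0 n)] at h1
        linarith
      rw [inter_eq_right.2 hsub, star_integral_ball h₁ (htx0 n) hr]
      refine Finset.sum_congr rfl fun i _ => ?_
      exact setIntegral_congr_fun (measurableSet_Ici.inter measurableSet_Ioo) fun y hy => by
        simp only [hv i n y hy.1]

end MetricGraph

/-! ### From the hypotheses on the maximum points to blow-up data -/

namespace MetricGraph

variable {V E : Type*} {G : MetricGraph V E}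

lemma exists_strictMono_forall_eq {α : Type*} [Finite α] (f : ℕ → α) :
    ∃ φ : ℕ → ℕ, StrictMono φ ∧ ∃ a, ∀ n, f (φ n) = a := by
  obtain ⟨a, ha⟩ := Finite.exists_infinite_fiber f
  obtain ⟨φ, hφ, hφa⟩ := extraction_of_frequently_atTop
    (Nat.frequently_atTop_iff_infinite.2 (Set.infinite_coe_iff.1 ha))
  exact ⟨φ, hφ, a, hφa⟩

/-- Every point has a nearest vertex, on an end of an edge. -/
lemma exists_halfEdge_pt [Nonempty E] (x : G.Point) : ∃ (h : G.HalfEdge) (s : ℝ),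
    s ∈ G.I h.edge ∧ x = h.pt s ∧ s = Metric.infDist x G.vertices := by
  rcases x with v | ⟨e, s, h0, h1⟩
  · obtain ⟨h, rfl⟩ := HalfEdge.exists_base (G := G) v
    exact ⟨h, 0, zero_mem_I _, h.pt_zero.symm, (Metric.infDist_zero_of_mem
      (show Point.vertex h.base ∈ G.vertices from ⟨h.base, rfl⟩)).symm⟩
  · have hs : s ∈ G.I e := ⟨h0.le, h1.le⟩
    rw [← pt_interior e s h0 h1, infDist_pt hs]
    by_cases hl : G.len e = ⊤
    · exact ⟨.initial e, s, hs, rfl, by rw [depth, if_pos hl]⟩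
    · rw [depth, if_neg hl]
      rcases le_total s ((G.len e).toReal - s) with h | h
      · exact ⟨.initial e, s, hs, rfl, (min_eq_left h).symm⟩
      · refine ⟨.terminal e hl, (G.len e).toReal - s,
          HalfEdge.coord_mem_I (h := .terminal e hl) hs, ?_, (min_eq_right h).symm⟩
        simp [HalfEdge.pt]

variable [Fintype E] [Nonempty E] {p : ℝ} {lam ρ : ℕ → ℝ} {u : ℕ → G.Point → ℝ} {x : ℕ → G.Point}
  {ε' R : ℕ → ℝ}

/-- An infinite limsup yields a subsequence along which the maximum points move away from the
vertices in the scale `ε'`; they are then interior, and finiteness of `E` fixes the edge. -/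
lemma exists_isBlowUp_edge (hp : 2 < p) (hρ : Tendsto ρ atTop (𝓝 1))
    (hu : ∀ n, G.IsPositiveSolution p (lam n) (ρ n) (u n)) (hlam : Tendsto lam atTop atTop)
    (hε' : ∀ n, ε' n = u n (x n) ^ (-((p - 2) / 2))) (hR : Tendsto R atTop atTop)
    (hmax : ∀ n, ∀ y ∈ Metric.ball (x n) (R n * ε' n), u n y ≤ u n (x n))
    (hlim : limsup (fun n => ((Metric.infDist (x n) G.vertices / ε' n : ℝ) : EReal)) atTop = ⊤) :
    ∃ σ : ℕ → ℕ, StrictMono σ ∧ ∃ (e : E) (t ℓ : ℕ → ℝ),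
      (∀ n, 0 < t n ∧ ENNReal.ofReal (t n) < G.len e ∧ x (σ n) = G.pt e (t n)) ∧
      (∀ n, ℓ n ≤ G.depth e (t n)) ∧
      IsBlowUp G p (lam ∘ σ) (ρ ∘ σ) (u ∘ σ) (fun _ : Bool => e) (fun _ => t) side ℓ true
        (fun _ => 0) (ε' ∘ σ) 0 := by
  have hε0 : ∀ n, 0 < ε' n := fun n => by
    rw [hε']; exact Real.rpow_pos_of_pos ((hu n).pos _) _
  -- The distance in units of `ε'` exceeds every level only frequently, the other two conditions
  -- hold eventually; the subsequence takes level `n` at step `n`.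
  have hfreq : ∀ m : ℕ, ∃ᶠ n in atTop, (m : ℝ) < Metric.infDist (x n) G.vertices / ε' n ∧
      0 < lam n ∧ (m : ℝ) < R n := fun m => by
    have h1 : ∃ᶠ n in atTop, ((m : ℝ) : EReal) <
        ((Metric.infDist (x n) G.vertices / ε' n : ℝ) : EReal) :=
      frequently_lt_of_lt_limsup (by isBoundedDefault) (by rw [hlim]; exact EReal.coe_lt_top _)
    refine (h1.and_eventually ((hlam.eventually_gt_atTop 0).and
      (hR.eventually_gt_atTop (m : ℝ)))).mono fun n hn => ?_
    exact ⟨EReal.coe_lt_coe_iff.1 hn.1, hn.2⟩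
  obtain ⟨φ, hφ, hφP⟩ := extraction_forall_of_frequently hfreq
  have hpt : ∀ n, ∃ (e : E) (s : ℝ), 0 < s ∧ ENNReal.ofReal s < G.len e ∧ x (φ n) = G.pt e s := by
    intro n
    have h1 : 0 < Metric.infDist (x (φ n)) G.vertices := by
      have := (Nat.cast_nonneg (α := ℝ) n).trans_lt (hφP n).1
      exact (div_pos_iff_of_pos_right (hε0 _)).1 this
    rcases hx : x (φ n) with v | ⟨e, s, h0, h2⟩
    · rw [hx, Metric.infDist_zero_of_mem (show Point.vertex v ∈ G.vertices from ⟨v, rfl⟩)] at h1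
      exact absurd h1 (lt_irrefl _)
    · exact ⟨e, s, h0, h2, (pt_interior e s h0 h2).symm⟩
  choose e s hs0 hs1 hxs using hpt
  obtain ⟨ψ, hψ, e₀, he₀⟩ := exists_strictMono_forall_eq e
  have hxt : ∀ n, x (φ (ψ n)) = G.pt e₀ (s (ψ n)) := fun n => by rw [hxs, he₀]
  have hsI : ∀ n, s (ψ n) ∈ G.I e₀ := fun n => by
    rw [← he₀ n]; exact ⟨(hs0 _).le, (hs1 _).le⟩
  have hmR : ∀ n : ℕ, (n : ℝ) < R (φ (ψ n)) := fun n =>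
    lt_of_le_of_lt (Nat.cast_le.2 (hψ.le_apply)) (hφP (ψ n)).2.2
  have hmd : ∀ n : ℕ, (n : ℝ) < G.depth e₀ (s (ψ n)) / ε' (φ (ψ n)) := fun n => by
    rw [← infDist_pt (hsI n), ← hxt]
    exact lt_of_le_of_lt (Nat.cast_le.2 (hψ.le_apply)) (hφP (ψ n)).1
  have hR0 : ∀ n, 0 < R (φ (ψ n)) := fun n => (Nat.cast_nonneg n).trans_lt (hmR n)
  have hball : ∀ n, 0 < R (φ (ψ n)) * ε' (φ (ψ n)) := fun n => mul_pos (hR0 n) (hε0 _)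
  -- The rays must stay inside the edge and inside the ball where `x n` is a maximum; half the
  -- radius makes the latter strict.
  set ℓ : ℕ → ℝ := fun n => min (G.depth e₀ (s (ψ n))) (R (φ (ψ n)) * ε' (φ (ψ n)) / 2) with hℓ
  have hmem : ∀ (i : Bool) n, ∀ τ ∈ Icc 0 (ℓ n), s (ψ n) + side i * τ ∈ G.I e₀ := fun i n τ hτ => by
    refine mem_I_of_abs_sub_le_depth (s := s (ψ n)) ?_
    rw [add_sub_cancel_left, abs_mul, abs_side, one_mul, abs_of_nonneg hτ.1]
    exact hτ.2.trans (min_le_left _ _)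
  refine ⟨φ ∘ ψ, hφ.comp hψ, e₀, fun n => s (ψ n), ℓ, fun n => ⟨hs0 _, ?_, hxt n⟩,
    fun n => min_le_left _ _, ?_⟩
  · rw [← he₀ n]; exact hs1 _
  · exact
      { lam_pos := fun n => (hφP (ψ n)).2.1
        tendsto_rho := hρ.comp (hφ.comp hψ).tendsto_atTop
        sol := fun n => hu _
        sign := side_sq
        mem := hmem
        start := fun _ _ _ => rfl
        kirchhoff := fun n => sum_side_mul _
        t_mem := fun n => by simp
        max := fun i n τ hτ => by
          simp only [mul_zero, add_zero, Function.comp_apply]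
          rw [← hxt]
          refine hmax _ _ ?_
          rw [hxt, Metric.mem_ball]
          refine (dist_pt_le (hmem i n τ hτ) (hsI n)).trans_lt ?_
          rw [add_sub_cancel_left, abs_mul, abs_side, one_mul, abs_of_nonneg hτ.1]
          have h1 : τ ≤ R (φ (ψ n)) * ε' (φ (ψ n)) / 2 := hτ.2.trans (min_le_right _ _)
          linarith [hball n]
        delta := fun n => by
          simp only [mul_zero, add_zero, Function.comp_apply]
          rw [← hxt]
          exact hε' _
        tendsto_len := by
          refine tendsto_atTop_mono (fun n => ?_)
            (tendsto_natCast_atTop_atTop.atTop_div_const (zero_lt_two (α := ℝ)))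
          have h0 := hε0 (φ (ψ n))
          have hn : (0 : ℝ) ≤ n := n.cast_nonneg
          simp only [Function.comp_apply]
          rw [le_div_iff₀ h0]
          refine le_min ?_ ?_
          · have := (lt_div_iff₀ h0).1 (hmd n)
            nlinarith
          · have := mul_lt_mul_of_pos_right (hmR n) h0
            linarith
        le := fun n => by
          simp only [Function.comp_apply, hε']
          exact sq_rpow_mul_le ((hu _).pos _) ((hu _).lam_mul_le hp (hball n) (hmax _)) }

/-- A finite limsup bounds the distance to the nearest vertex by `B * ε'`. The scale `ε'` tends to
0, so along a subsequence with a fixed nearest end the points converge to its vertex, from which the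
rays start. -/
lemma exists_isBlowUp_vertex (hp : 2 < p) (hρ : Tendsto ρ atTop (𝓝 1))
    (hu : ∀ n, G.IsPositiveSolution p (lam n) (ρ n) (u n)) (hlam : Tendsto lam atTop atTop)
    (hε' : ∀ n, ε' n = u n (x n) ^ (-((p - 2) / 2))) (hR : Tendsto R atTop atTop)
    (hmax : ∀ n, ∀ y ∈ Metric.ball (x n) (R n * ε' n), u n y ≤ u n (x n))
    (hlim : limsup (fun n => ((Metric.infDist (x n) G.vertices / ε' n : ℝ) : EReal)) atTop < ⊤) :
    ∃ σ : ℕ → ℕ, StrictMono σ ∧ ∃ (w : V) (h₁ : G.Ends w) (t ℓ : ℕ → ℝ) (a B : ℝ),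
      Tendsto (fun n => x (σ n)) atTop (𝓝 (.vertex w)) ∧
      (∀ n, t n ∈ G.I h₁.1.edge ∧ x (σ n) = h₁.1.pt (t n) ∧
        t n = Metric.infDist (x (σ n)) G.vertices) ∧
      (∀ e, ENNReal.ofReal a ≤ G.len e) ∧ (∀ n, ℓ n ≤ a / 4) ∧
      IsBlowUp G p (lam ∘ σ) (ρ ∘ σ) (u ∘ σ) (fun h : G.Ends w => h.1.edge) (fun h _ => h.1.coord 0)
        (fun h => h.1.sign) ℓ h₁ t (ε' ∘ σ) B := by
  have hε0 : ∀ n, 0 < ε' n := fun n => by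
    rw [hε']; exact Real.rpow_pos_of_pos ((hu n).pos _) _
  obtain ⟨a, ha0, ha⟩ := exists_pos_le_len G
  obtain ⟨B, hB, -⟩ := EReal.lt_iff_exists_real_btwn.1 hlim
  have hev : ∀ᶠ n in atTop, Metric.infDist (x n) G.vertices / ε' n < B ∧ 0 < lam n ∧
      2 * B < R n ∧ 0 < R n := by
    filter_upwards [eventually_lt_of_limsup_lt hB, hlam.eventually_gt_atTop 0,
      hR.eventually_gt_atTop (2 * B), hR.eventually_gt_atTop 0] with n h1 h2 h3 h4
    exact ⟨EReal.coe_lt_coe_iff.1 h1, h2, h3, h4⟩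
  have hle : ∀ n, 0 < R n → ε' n ^ 2 * lam n ≤ ρ n := fun n hn => by
    rw [hε']
    exact sq_rpow_mul_le ((hu _).pos _) ((hu _).lam_mul_le hp (mul_pos hn (hε0 n)) (hmax _))
  -- From `ε'² λ ≤ ρ`, with `λ → ∞` and `ρ → 1`.
  have hεt : Tendsto ε' atTop (𝓝 0) := by
    have h1 : Tendsto (fun n => √(ρ n / lam n)) atTop (𝓝 0) := by
      have := (Real.continuous_sqrt.tendsto 0).comp (hρ.div_atTop hlam)
      rwa [Real.sqrt_zero] at this
    refine squeeze_zero' (Eventually.of_forall fun n => (hε0 n).le) ?_ h1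
    filter_upwards [hev] with n hn
    exact Real.le_sqrt_of_sq_le ((le_div_iff₀ hn.2.1).2 (hle n hn.2.2.2))
  obtain ⟨N, hN⟩ := eventually_atTop.1 hev
  choose h s hsI hxs hsd using fun n => exists_halfEdge_pt (x n)
  obtain ⟨ψ, hψ, h₀, hh₀⟩ := exists_strictMono_forall_eq fun n => h (n + N)
  set σ : ℕ → ℕ := fun n => ψ n + N with hσ
  have hσm : StrictMono σ := fun m n hmn => Nat.add_lt_add_right (hψ hmn) N
  have hσt := hσm.tendsto_atTop
  have hσN : ∀ n, _ := fun n => hN (σ n) (Nat.le_add_left N (ψ n))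
  set t : ℕ → ℝ := fun n => s (σ n) with ht
  have htI : ∀ n, t n ∈ G.I h₀.edge := fun n => by rw [← hh₀ n]; exact hsI _
  have hxt : ∀ n, x (σ n) = h₀.pt (t n) := fun n => by rw [← hh₀ n]; exact hxs _
  have ht0 : ∀ n, 0 ≤ t n := fun n => (htI n).1
  have htB : ∀ n, t n ≤ B * ε' (σ n) := fun n => by
    have := (hσN n).1
    rw [← hsd] at this
    exact ((div_lt_iff₀ (hε0 _)).1 this).le
  have hdist : ∀ n, dist (x (σ n)) (.vertex h₀.base) ≤ t n := fun n => by
    have := HalfEdge.dist_pt_le (htI n) (zero_mem_I h₀.edge)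
    rwa [HalfEdge.pt_zero, ← hxt, sub_zero, abs_of_nonneg (ht0 n)] at this
  have hxval : ∀ n, G.pt h₀.edge (h₀.coord 0 + h₀.sign * t n) = x (σ n) := fun n => by
    rw [HalfEdge.coord_zero_add, hxt]
  -- The bound `a / 4` keeps the rays in the near half of every edge. The rays start at the vertex
  -- and not at `x n`: a point of a ray is within `R ε'/2 + B ε'` of `x n`, which is less than `R
  -- ε'` because `2 * B < R`.
  set ℓ : ℕ → ℝ := fun n => min (a / 4) (R (σ n) * ε' (σ n) / 2) with hℓ
  have hℓI : ∀ (i : G.HalfEdge) n, ∀ τ ∈ Icc 0 (ℓ n), τ ∈ G.I i.edge := fun i n τ hτ =>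
    ⟨hτ.1, (ENNReal.ofReal_le_ofReal (by
      have := hτ.2.trans (min_le_left _ _)
      linarith)).trans (ha _)⟩
  refine ⟨σ, hσm, h₀.base, ⟨h₀, rfl⟩, t, ℓ, a, B, ?_, fun n => ⟨htI n, hxt n, hsd _⟩, ha,
    fun n => min_le_left _ _, ?_⟩
  · rw [tendsto_iff_dist_tendsto_zero]
    refine squeeze_zero (fun n => dist_nonneg) (fun n => (hdist n).trans (htB n)) ?_
    simpa using (hεt.comp hσt).const_mul B
  · exact
      { lam_pos := fun n => (hσN n).2.1
        tendsto_rho := hρ.comp hσt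
        sol := fun n => hu _
        sign := fun i => i.1.sign_sq
        mem := fun i n τ hτ => by
          rw [← HalfEdge.coord_eq]
          exact HalfEdge.coord_mem_I (hℓI i.1 n τ hτ)
        start := fun i j n => by
          rw [← HalfEdge.pt_eq, ← HalfEdge.pt_eq, HalfEdge.pt_zero, HalfEdge.pt_zero, i.2, j.2]
        kirchhoff := fun n => (hu _).sum_sign_mul_edgeDeriv _
        t_mem := fun n => ⟨ht0 n, htB n⟩
        max := fun i n τ hτ => by
          rw [HalfEdge.coord_zero_add, hxval]
          refine hmax _ _ ?_
          have h1 := HalfEdge.dist_pt_le (hℓI i.1 n τ hτ) (zero_mem_I _)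
          rw [HalfEdge.pt_zero, i.2, sub_zero, abs_of_nonneg hτ.1] at h1
          have h2 := dist_triangle_right (i.1.pt τ) (x (σ n)) (.vertex h₀.base)
          have h3 : τ ≤ R (σ n) * ε' (σ n) / 2 := hτ.2.trans (min_le_right _ _)
          have h4 := mul_lt_mul_of_pos_right (hσN n).2.2.1 (hε0 (σ n))
          rw [Metric.mem_ball]
          linarith [hdist n, htB n]
        delta := fun n => by
          rw [hxval]
          exact hε' _
        tendsto_len := by
          have h1 : Tendsto (fun n => a / 4 * (ε' (σ n))⁻¹) atTop atTop :=
            Tendsto.const_mul_atTop (by positivity) (Tendsto.inv_tendsto_nhdsGT_zero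
              (tendsto_nhdsWithin_iff.2 ⟨hεt.comp hσt, Eventually.of_forall fun n => hε0 _⟩))
          have h2 := (hR.comp hσt).atTop_div_const (zero_lt_two (α := ℝ))
          refine tendsto_atTop.2 fun b => ?_
          filter_upwards [h1.eventually_ge_atTop b, h2.eventually_ge_atTop b] with n hn1 hn2
          have h0 := hε0 (σ n)
          simp only [Function.comp_apply] at hn2 ⊢
          rw [le_div_iff₀ h0]
          refine le_min ((le_mul_inv_iff₀ h0).1 hn1) ?_
          have := mul_le_mul_of_nonneg_right hn2 h0.le
          linarith
        le := fun n => hle _ (hσN n).2.2.2 }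

end MetricGraph

/-! ### The theorem -/

theorem theorem4p2 {V E : Type*} [Fintype V] [Fintype E] [Nonempty E] (G : MetricGraph V E)
    (p : ℝ) (hp : 2 < p)
    (lam ρ : ℕ → ℝ) (u : ℕ → G.Point → ℝ)
    (hρ : Tendsto ρ atTop (𝓝 1))
    (huH1 : ∀ n, G.MemH1 (u n))
    (hu : ∀ n, G.IsPositiveSolution p (lam n) (ρ n) (u n))
    (hlam : Tendsto lam atTop atTop)
    (kbar : ℕ) (hkbar : 1 ≤ kbar)
    (hmorse : ∀ n, G.morseIndex p (lam n) (ρ n) (u n) ≤ kbar)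
    (x : ℕ → G.Point) (ε' ε R : ℕ → ℝ)
    (hε' : ∀ n, ε' n = u n (x n) ^ (-((p - 2) / 2)))
    (hε : ∀ n, ε n = lam n ^ (-(1 / 2) : ℝ))
    (hR : Tendsto R atTop atTop)
    (hmax : ∀ n, ∀ y ∈ Metric.ball (x n) (R n * ε' n), u n y ≤ u n (x n)) :
    (limsup (fun n => ((Metric.infDist (x n) G.vertices / ε' n : ℝ) : EReal)) atTop = ⊤ →
      ∃ σ : ℕ → ℕ, StrictMono σ ∧
      -- (i)
      ∃ (e : E) (t : ℕ → ℝ),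
        (∀ n, 0 < t n ∧ ENNReal.ofReal (t n) < G.len e ∧ x (σ n) = G.pt e (t n)) ∧
      -- (ii)
        (∃ c : ℝ, 0 < c ∧ c ≤ 1 ∧ Tendsto (fun n => ε' (σ n) / ε (σ n)) atTop (𝓝 c)) ∧
        Tendsto (fun n => Metric.infDist (x (σ n)) G.vertices / ε (σ n)) atTop atTop ∧
      ∃ (D : ℕ → Set ℝ) (v : ℕ → ℝ → ℝ) (W : ℝ → ℝ),
        (∀ n, D n = {y | t n + ε (σ n) * y ∈ G.I e}) ∧
        (∀ n y, v n y = ε (σ n) ^ (2 / (p - 2)) * u (σ n) (G.pt e (t n + ε (σ n) * y))) ∧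
        MetricGraph.IsSoliton p W ∧ (∀ W', MetricGraph.IsSoliton p W' → W' = W) ∧
        MetricGraph.TendstoC2Loc Set.univ D v W ∧
      -- (iii)
        (∃ Rbar > 0, ∀ n, ∃ φ : G.Point → ℝ, G.IsTestFunction φ ∧
          tsupport φ ⊆ Metric.ball (x (σ n)) (Rbar * ε (σ n)) ∧
          G.Q p (lam (σ n)) (ρ (σ n)) (u (σ n)) φ < 0) ∧
      -- (iv)
        (∀ r > 0, ∀ q : ℝ, 1 ≤ q →
          Tendsto (fun n => lam (σ n) ^ (1 / 2 - q / (p - 2)) *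
            G.integral (Metric.ball (x (σ n)) (r * ε (σ n))) (fun z => u (σ n) z ^ q)) atTop
            (𝓝 (∫ y in Metric.ball (0 : ℝ) r, W y ^ q)) ∧
          Tendsto (fun n => ∫ y in D n ∩ Metric.ball (0 : ℝ) r, v n y ^ q) atTop
            (𝓝 (∫ y in Metric.ball (0 : ℝ) r, W y ^ q)))) ∧
    (limsup (fun n => ((Metric.infDist (x n) G.vertices / ε' n : ℝ) : EReal)) atTop < ⊤ →
      ∃ σ : ℕ → ℕ, StrictMono σ ∧
      -- (i')
      ∃ (w : V) (h₁ : G.Ends w) (t : ℕ → ℝ),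
        Tendsto (fun n => x (σ n)) atTop (𝓝 (MetricGraph.Point.vertex w)) ∧
        (∀ n, 0 ≤ t n ∧ ENNReal.ofReal (t n) ≤ G.len h₁.1.edge ∧ x (σ n) = h₁.1.pt (t n) ∧
          t n = Metric.infDist (x (σ n)) G.vertices) ∧
      -- (ii')
        (∃ c : ℝ, 0 < c ∧ c ≤ 1 ∧ Tendsto (fun n => ε' (σ n) / ε (σ n)) atTop (𝓝 c)) ∧
        limsup (fun n => ((Metric.infDist (x (σ n)) G.vertices / ε (σ n) : ℝ) : EReal)) atTop < ⊤ ∧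
      ∃ (v : ℕ → (MetricGraph.star (G.Ends w)).Point → ℝ)
        (W : (MetricGraph.star (G.Ends w)).Point → ℝ) (xbarn : ℕ → ℝ) (xbar : ℝ),
        (∀ n P, v n P = ε (σ n) ^ (2 / (p - 2)) * u (σ n) (G.zoom w (ε (σ n)) P)) ∧
        (∀ K : Set (MetricGraph.star (G.Ends w)).Point, IsCompact K →
          (∀ᶠ n in atTop, K ⊆ G.scaledStar w (ε (σ n))) ∧ TendstoUniformlyOn v W atTop K) ∧
        (∀ h : G.Ends w, MetricGraph.TendstoC2Loc (Set.Ici 0)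
          (fun n => {y | 0 ≤ y ∧ ENNReal.ofReal (ε (σ n) * y) ≤ G.len h.1.edge})
          (fun n y => v n ((MetricGraph.star (G.Ends w)).pt h y))
          (fun y => W ((MetricGraph.star (G.Ends w)).pt h y))) ∧
        (MetricGraph.star (G.Ends w)).MemH1 W ∧
        (MetricGraph.star (G.Ends w)).IsPositiveSolution p 1 1 W ∧
        Tendsto W (comap (fun P => dist P (MetricGraph.Point.vertex ())) atTop) (𝓝 0) ∧
        (∀ n, xbarn n = Metric.infDist (x (σ n)) G.vertices / ε (σ n)) ∧
        0 ≤ xbar ∧ Tendsto xbarn atTop (𝓝 xbar) ∧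
        (∀ P, W P ≤ W ((MetricGraph.star (G.Ends w)).pt h₁ xbar)) ∧
      -- (iii')
        (∃ Rbar > 0, ∀ n, ∃ φ : G.Point → ℝ, G.IsTestFunction φ ∧
          tsupport φ ⊆ Metric.ball (x (σ n)) (Rbar * ε (σ n)) ∧
          G.Q p (lam (σ n)) (ρ (σ n)) (u (σ n)) φ < 0) ∧
      -- (iv')
        (∀ r > 0, ∀ q : ℝ, 1 ≤ q →
          Tendsto (fun n => lam (σ n) ^ (1 / 2 - q / (p - 2)) *
            G.integral (Metric.ball (x (σ n)) (r * ε (σ n))) (fun z => u (σ n) z ^ q)) atTop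
            (𝓝 ((MetricGraph.star (G.Ends w)).integral
              (Metric.ball ((MetricGraph.star (G.Ends w)).pt h₁ xbar) r) (fun P => W P ^ q))) ∧
          Tendsto (fun n => (MetricGraph.star (G.Ends w)).integral
            (G.scaledStar w (ε (σ n)) ∩
              Metric.ball ((MetricGraph.star (G.Ends w)).pt h₁ (xbarn n)) r)
            (fun P => v n P ^ q)) atTop
            (𝓝 ((MetricGraph.star (G.Ends w)).integral
              (Metric.ball ((MetricGraph.star (G.Ends w)).pt h₁ xbar) r) (fun P => W P ^ q))) ∧
          (MetricGraph.star (G.Ends w)).integral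
              (Metric.ball ((MetricGraph.star (G.Ends w)).pt h₁ xbar) r) (fun P => W P ^ q)
            = (∫ y in Set.Icc (max 0 (xbar - r)) (xbar + r),
                W ((MetricGraph.star (G.Ends w)).pt h₁ y) ^ q)
              + ∑ h ∈ Finset.univ.erase h₁, ∫ y in Set.Icc 0 (r - xbar),
                W ((MetricGraph.star (G.Ends w)).pt h y) ^ q)) := by
  refine ⟨fun hlim => ?_, fun hlim => ?_⟩
  · obtain ⟨σ₁, hσ₁, e, t, ℓ, ht, hℓ, hB⟩ :=
      MetricGraph.exists_isBlowUp_edge hp hρ hu hlam hε' hR hmax hlim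
    have htI : ∀ n, t n ∈ G.I e := fun n => ⟨(ht n).1.le, (ht n).2.1.le⟩
    obtain ⟨σ₂, hσ₂, hc, hd, W, hW, hC, h3, h4⟩ := MetricGraph.edge_blowUp hp hB
      (fun n => hmorse (σ₁ n)) (ε := ε ∘ σ₁) (fun n => hε (σ₁ n)) htI hℓ
    have hx : ∀ n, x (σ₁ (σ₂ n)) = G.pt e (t (σ₂ n)) := fun n => (ht _).2.2
    refine ⟨σ₁ ∘ σ₂, hσ₁.comp hσ₂, e, t ∘ σ₂, fun n => ht _, hc, ?_, _, _, W, fun n => rfl,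
      fun n y => rfl, hW, fun W' hW' => hW'.unique hp hW, hC, ?_, ?_⟩
    · simpa only [Function.comp_apply, hx, MetricGraph.infDist_pt (htI _)] using hd
    · simpa only [Function.comp_apply, hx] using h3
    · simpa only [Function.comp_apply, hx] using h4
  · obtain ⟨σ₁, hσ₁, w, h₁, t, ℓ, a, B, hxw, ht, ha, hℓ, hB⟩ :=
      MetricGraph.exists_isBlowUp_vertex hp hρ hu hlam hε' hR hmax hlim
    obtain ⟨σ₂, hσ₂, hc, W, xbar, h0, hxb, hK, hC, hH1, hpos, hinf, hM, h3, h4⟩ :=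
      MetricGraph.vertex_blowUp hp hB (fun n => hmorse (σ₁ n)) (ε := ε ∘ σ₁)
        (fun n => hε (σ₁ n)) ha hℓ fun n => (ht n).1
    have hx : ∀ n, x (σ₁ (σ₂ n)) = h₁.1.pt (t (σ₂ n)) := fun n => (ht _).2.1
    have hxb' : Tendsto (fun n => Metric.infDist (x (σ₁ (σ₂ n))) G.vertices / ε (σ₁ (σ₂ n))) atTop
        (𝓝 xbar) := hxb.congr fun n => by rw [(ht _).2.2]; rfl
    refine ⟨σ₁ ∘ σ₂, hσ₁.comp hσ₂, w, h₁, t ∘ σ₂, hxw.comp hσ₂.tendsto_atTop,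
      fun n => ⟨(ht _).1.1, (ht _).1.2, (ht _).2.1, (ht _).2.2⟩, hc, ?_, _, W, _, xbar,
      fun n P => rfl, hK, hC, hH1, hpos, hinf, fun n => rfl, h0, hxb', hM, ?_, ?_⟩
    -- The rescaled distances converge to the finite number `xbar`, so their limsup is finite.
    · exact ((continuous_coe_real_ereal.tendsto xbar).comp hxb').limsup_eq.trans_lt
        (EReal.coe_lt_top _)
    · simpa only [Function.comp_apply, hx] using h3
    · simp only [Function.comp_apply, ← hx] at h4
      simp only [(ht _).2.2] at h4
      exact h4
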